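/- **Theorem (classically-realizable remote state preparation resources are describable).** *Systems.* All objects are families indexed by a security parameter $n\in\mathbb N$. A *system* has a left and a right interface, each consisting of finitely many wires (classical bits and qubits), a finite qubit memory initialised to $|0\cdots0\rangle$, and a finite classical control. Whenever it is activated (from the left, from the right, or by itself), it applies a quantum instrument (completely positive maps, one for each classical outcome, with trace-preserving sum) to its memory and the wires of its two interfaces; classical wires only ever carry classical data. The outcome decides the next control state and the move: activate the left neighbour, activate the right neighbour, continue, stop (with an output, for distinguishers and measuring devices), or never act again. Connecting neighbouring interfaces, written as juxtaposition, turns two systems into one system, exactly one component being active at each time. A *resource* is a system with the client's interface on the left and the server's on the right. A *converter* is a system that stops after a bounded number of steps; attached to the client's side of a resource its outer interface is the left one, attached to the server's side the right one. The *classical channel* $\mathcal C$ (of arbitrary finite width, usable any number of times) forwards classical messages between its two interfaces. *Admissible families.* Fix one of two security levels. *Information-theoretic*: converters, distinguishers and measuring devices that make finitely many steps, each step being arbitrary. *Computational*: non-uniform quantum polynomial-time ones, i.e. the total number of steps and the number of control states (program lines) are bounded by a polynomial in $n$, and every step is an instrument on at most two qubits. A distinguisher $D$ is attached to both interfaces of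 a resource and outputs a bit. For $\varepsilon:\mathbb N\to\mathbb R$, $\mathcal R\approx_\varepsilon\mathcal S$ means that $|\Pr[D_n\mathcal R_n=1]-\Pr[D_n\mathcal S_n=1]|\le\varepsilon(n)$ for every admissible family of distinguishers $D$. Every inequality depending on $n$, here and below, is meant for all $n$, or throughout for all sufficiently large $n$, or throughout eventually along any fixed filter on $\mathbb N$. *Definitions.* Let $\mathcal S$ be a family of resources and $\vdash$ (the filter) a family of converters for its server's interface. 1. $\mathcal S$ (with filter $\vdash$) is *$\varepsilon$-classically-realizable* if there are admissible converters $\pi_A,\pi_B,\sigma$ and a classical channel $\mathcal C$ with $\pi_A\,\mathcal C\,\pi_B\approx_\varepsilon\mathcal S\vdash$ and $\pi_A\,\mathcal C\approx_\varepsilon\mathcal S\,\sigma$. 2. Let $\mathcal A$ be a converter for the client's interface that delivers a single classical message $[\rho]$, a bit string each of whose values is read as a density matrix or the null matrix $\rho$ on $d(n)$ qubits. Let $\mathcal Q$ be a converter for the outer interface of $\vdash$ that delivers a single quantum message $\rho'$ of $d(n)$ qubits. $\mathcal S$ is a *remote state preparation resource within $\varepsilon$ with respect to $\mathcal A$ and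 $\mathcal Q$* if $\mathcal A,\mathcal Q$ are admissible, $$\mathbb E_{([\rho],\rho')\leftarrow\mathcal A\,\mathcal S\vdash\mathcal Q}\big[\operatorname{Tr}(\rho\rho')\big]\ \ge\ 1-\varepsilon(n),$$ and the measurement $\{\rho,\,I-\rho\}$ can be performed by an admissible measuring device that is given $[\rho]$ (as any of the bit strings) and the state to be measured. 3. $\mathcal S$ is *$\varepsilon$-describable with respect to $\mathcal A$* if there is a (possibly computationally unbounded) converter $\mathcal P$ for the server's interface of $\mathcal S$ that delivers a single classical message $[\rho']$ describing a density matrix $\rho'$, with $$\mathbb E_{([\rho],[\rho'])\leftarrow\mathcal A\,\mathcal S\,\mathcal P}\big[\operatorname{Tr}(\rho\rho')\big]\ \ge\ 1-\varepsilon(n).$$ In 2 and 3 the two outer interfaces are activated in turn, starting with the left one, until both messages have been delivered; runs in which this does not happen count as $0$. *Theorem.* Let $\varepsilon_1,\varepsilon_2:\mathbb N\to\mathbb R$. At either security level (in particular, if only non-uniform quantum polynomial-time distinguishers are considered), if $\mathcal S$ with filter $\vdash$ is a remote state preparation resource within $\varepsilon_1$ with respect to $\mathcal A$ and $\mathcal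 Q$ and is $\varepsilon_2$-classically-realizable, then $\mathcal S$ is $(\varepsilon_1+2\varepsilon_2)$-describable with respect to $\mathcal A$. In particular, if $\varepsilon_1$ and $\varepsilon_2$ are negligible, then $\mathcal S$ is describable within the negligible error $\varepsilon_1+2\varepsilon_2$. -/

import Mathlib

open scoped ComplexOrder

noncomputable section

namespace RSP

/-! ### Quantum operations on finitely many wires -/

/-- Operators on the Hilbert space of the qubits (wires) `W`, in the computational basis. -/
abbrev Op (W : Type) : Type := Matrix (W → Bool) (W → Bool) ℂ

/-- Complete positivity, through a finite family of Kraus operators. -/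
def IsCP {W : Type} [Fintype W] [DecidableEq W] (Φ : Op W → Op W) : Prop :=
  ∃ (k : ℕ) (K : Fin k → Op W), ∀ X, Φ X = ∑ i, K i * X * (K i).conjTranspose

/-- `Φ ⊗ id`: the map `Φ`, acting on the wires `e v`, `v : V`, and as the identity on all other
wires of `W` (`e` is always injective). For fixed values of the other wires, `Φ` is applied to
the corresponding block. -/
def onWires {V W : Type} (e : V → W) (Φ : Op V → Op V) (X : Op W) : Op W :=
  Matrix.of fun x y =>
    Φ (Matrix.of fun a b => X (Function.extend e a x) (Function.extend e b y)) (x ∘ e) (y ∘ e)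

/-- The partial trace over all wires that are not of the form `e v`. -/
def marginal {V W : Type} [Fintype V] [Fintype W] [DecidableEq W] (e : V → W) (X : Op W) : Op V :=
  Matrix.of fun a b => ∑ x : W → Bool, if x ∘ e = a then X x (Function.extend e b x) else 0

/-- The state in which every wire is `|0⟩`. -/
def zeroState (W : Type) [Fintype W] [DecidableEq W] : Op W :=
  Matrix.single (fun _ => false) (fun _ => false) 1

/-- The wires in `c` are classical: no coherence between different values of them. -/
def IsClassicalOn {W : Type} (c : Set W) (X : Op W) : Prop :=
  ∀ x y, (∃ w ∈ c, x w ≠ y w) → X x y = 0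

/-- Density matrices. -/
def IsDensity {W : Type} [Fintype W] [DecidableEq W] (ρ : Op W) : Prop :=
  ρ.PosSemidef ∧ ρ.trace = 1

/-! ### Interactive quantum machines

Systems form a line (or, once a distinguisher is attached, a ring). Neighbours share the wires of
an interface. At each time exactly one system is active; it acts on its memory and on the wires of
its two interfaces, and then, depending on a classical outcome, keeps control or hands it to a
neighbour. No system learns how many steps the others take. -/

/-- An interface: `bits` wires for classical messages and `qubits` wires for quantum messages. -/
structure Iface where
  bits : ℕ
  qubits : ℕ

abbrev Iface.Wire (I : Iface) : Type := Fin I.bits ⊕ Fin I.qubits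

/-- How a machine was activated: from one of its two interfaces, or it kept control itself. -/
inductive Entry where
  | fromLeft
  | fromRight
  | resume
deriving DecidableEq

instance : Fintype Entry where
  elems := {.fromLeft, .fromRight, .resume}
  complete := by intro e; cases e <;> simp

/-- What a machine does after a step: activate the system on its left or right, continue itself,
stop with an output, or never act again. -/
inductive Move (O : Type) where
  | toLeft
  | toRight
  | stay
  | halt (o : O)
  | hang

/-- The run goes on after this move. -/
def Move.Continues {O : Type} : Move O → Prop
  | .toLeft => True
  | .toRight => True
  | .stay => True
  | .halt _ => False
  | .hang => False

/-- A machine with left interface `I`, right interface `J` and outputs `O`: a quantum memory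
`Mem` (initially `|0…0⟩`), a finite classical control, and for each control state and each way of
being activated a family of operations `op` indexed by the classical outcomes `Out`; the outcome
determines the move and the next control state. -/
structure Machine (I J : Iface) (O : Type) where
  Mem : Type
  [memFintype : Fintype Mem]
  [memDecEq : DecidableEq Mem]
  Ctrl : Type
  [ctrlFintype : Fintype Ctrl]
  Out : Type
  [outFintype : Fintype Out]
  init : Ctrl
  op : Ctrl → Entry → Out → Op (I.Wire ⊕ Mem ⊕ J.Wire) → Op (I.Wire ⊕ Mem ⊕ J.Wire)
  next : Ctrl → Entry → Out → Move O × Ctrl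

attribute [instance] Machine.memFintype Machine.memDecEq Machine.ctrlFintype Machine.outFintype

/-- A system without final output. Resources have the client's interface on the left and the
server's interface on the right. A client-side converter has its outer interface on the left, a
server-side converter has its outer interface on the right. -/
abbrev Sys (I J : Iface) : Type 1 := Machine I J Empty

namespace Machine

variable {I J K : Iface} {O : Type}

abbrev Wire (X : Machine I J O) : Type := I.Wire ⊕ X.Mem ⊕ J.Wire

/-- The classical wires of the two interfaces. -/
def classicalWires (X : Machine I J O) : Set X.Wire :=
  {w | (∃ i, w = .inl (.inl i)) ∨ ∃ j, w = .inr (.inr (.inl j))}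

/-- The laws of quantum mechanics: every step is a quantum instrument, and classical wires only
ever carry classical data. -/
structure Valid (X : Machine I J O) : Prop where
  completelyPositive : ∀ q e a, IsCP (X.op q e a)
  tracePreserving : ∀ q e ρ, ∑ a, (X.op q e a ρ).trace = ρ.trace
  classical : ∀ q e a ρ, IsClassicalOn X.classicalWires ρ →
    IsClassicalOn X.classicalWires (X.op q e a ρ)

/-- After at most `N` steps the machine stops, whatever the rest of the world does: a bound on the
number of remaining steps goes down with each step. -/
def RunsWithin (X : Machine I J O) (N : ℕ) : Prop :=
  ∃ rank : X.Ctrl → ℕ, rank X.init ≤ N ∧ ∀ q e a,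
    (X.next q e a).1.Continues → rank (X.next q e a).2 < rank q

/-- Each step is an elementary operation: an instrument on at most two qubits. -/
def IsElementary (X : Machine I J O) : Prop :=
  ∀ q e, ∃ s : Finset X.Wire, s.card ≤ 2 ∧
    ∀ a, ∃ Φ : Op s → Op s, X.op q e a = onWires (Subtype.val : s → X.Wire) Φ

/-- Position of the wires of `X` among those of the composition of `X` and `Y`. -/
def embFst (X : Machine I J O) (Y : Machine J K O) :
    X.Wire → I.Wire ⊕ (X.Mem ⊕ J.Wire ⊕ Y.Mem) ⊕ K.Wire
  | .inl i => .inl i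
  | .inr (.inl m) => .inr (.inl (.inl m))
  | .inr (.inr j) => .inr (.inl (.inr (.inl j)))

/-- Position of the wires of `Y` among those of the composition of `X` and `Y`. -/
def embSnd (X : Machine I J O) (Y : Machine J K O) :
    Y.Wire → I.Wire ⊕ (X.Mem ⊕ J.Wire ⊕ Y.Mem) ⊕ K.Wire
  | .inl j => .inr (.inl (.inr (.inl j)))
  | .inr (.inl m) => .inr (.inl (.inr (.inr m)))
  | .inr (.inr k) => .inr (.inr k)

/-- Which of two composed machines acts (`inl`: the left one, `inr`: the right one), and how it
was activated; `f` is the entry that is pending inside the composition. -/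
def focus (f : Entry ⊕ Entry) : Entry → Entry ⊕ Entry
  | .fromLeft => .inl .fromLeft
  | .fromRight => .inr .fromRight
  | .resume => f

/-- A move of the left machine, seen from outside, with the new pending entry. -/
def moveFst : Move O → Move O × (Entry ⊕ Entry)
  | .toLeft => (.toLeft, .inl .resume)
  | .toRight => (.stay, .inr .fromLeft)
  | .stay => (.stay, .inl .resume)
  | .halt o => (.halt o, .inl .resume)
  | .hang => (.hang, .inl .resume)

/-- A move of the right machine, seen from outside, with the new pending entry. -/
def moveSnd : Move O → Move O × (Entry ⊕ Entry)
  | .toLeft => (.stay, .inl .fromRight)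
  | .toRight => (.toRight, .inl .resume)
  | .stay => (.stay, .inr .resume)
  | .halt o => (.halt o, .inl .resume)
  | .hang => (.hang, .inl .resume)

/-- Connecting the right interface of `X` with the left interface of `Y`. Each step of the
composition is one step of `X` or one step of `Y`. -/
def comp (X : Machine I J O) (Y : Machine J K O) : Machine I K O where
  Mem := X.Mem ⊕ J.Wire ⊕ Y.Mem
  Ctrl := X.Ctrl × Y.Ctrl × (Entry ⊕ Entry)
  Out := X.Out ⊕ Y.Out
  init := (X.init, Y.init, .inl .resume)
  op := fun q e c =>
    match focus q.2.2 e, c with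
    | .inl e', .inl a => onWires (embFst X Y) (X.op q.1 e' a)
    | .inr e', .inr b => onWires (embSnd X Y) (Y.op q.2.1 e' b)
    | _, _ => fun _ => 0
  next := fun q e c =>
    match focus q.2.2 e, c with
    | .inl e', .inl a =>
        ((moveFst (X.next q.1 e' a).1).1,
          ((X.next q.1 e' a).2, q.2.1, (moveFst (X.next q.1 e' a).1).2))
    | .inr e', .inr b =>
        ((moveSnd (Y.next q.2.1 e' b).1).1,
          (q.1, (Y.next q.2.1 e' b).2, (moveSnd (Y.next q.2.1 e' b).1).2))
    | _, _ => (.hang, q)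

end Machine

infixl:65 " ⋈ " => Machine.comp

/-! ### Running a resource with an environment -/

section Run

variable {I J : Iface} {O : Type}

/-- All wires when both interfaces of the resource `R` are attached to `D`. -/
abbrev RingWire (D : Machine J I O) (R : Sys I J) : Type := R.Wire ⊕ D.Mem

/-- The right interface of `D` is the left interface of `R`, and the left interface of `D` is the
right interface of `R`. -/
def embEnv (D : Machine J I O) (R : Sys I J) : D.Wire → RingWire D R
  | .inl j => .inl (.inr (.inr j))
  | .inr (.inl m) => .inr m
  | .inr (.inr i) => .inl (.inl i)

/-- `run D R t f p q ρ o` is the part, with output `o` of `D`, of the (unnormalized) final state of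
the runs that end within `t` steps, when started from the state `ρ` with control states `p`, `q`
and with `D` (`f = inl e`) or `R` (`f = inr e`) being activated with entry `e`. -/
def run [DecidableEq O] (D : Machine J I O) (R : Sys I J) :
    ℕ → Entry ⊕ Entry → D.Ctrl → R.Ctrl → Op (RingWire D R) → O → Op (RingWire D R)
  | 0, _, _, _, _, _ => 0
  | t + 1, .inl e, p, q, ρ, o => ∑ a : D.Out,
      match D.next p e a with
      | (.toLeft, p') => run D R t (.inr .fromRight) p' q (onWires (embEnv D R) (D.op p e a) ρ) o
      | (.toRight, p') => run D R t (.inr .fromLeft) p' q (onWires (embEnv D R) (D.op p e a) ρ) o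
      | (.stay, p') => run D R t (.inl .resume) p' q (onWires (embEnv D R) (D.op p e a) ρ) o
      | (.halt o', _) => if o' = o then onWires (embEnv D R) (D.op p e a) ρ else 0
      | (.hang, _) => 0
  | t + 1, .inr e, p, q, ρ, o => ∑ b : R.Out,
      match R.next q e b with
      | (.toLeft, q') => run D R t (.inl .fromRight) p q' (onWires Sum.inl (R.op q e b) ρ) o
      | (.toRight, q') => run D R t (.inl .fromLeft) p q' (onWires Sum.inl (R.op q e b) ρ) o
      | (.stay, q') => run D R t (.inr .resume) p q' (onWires Sum.inl (R.op q e b) ρ) o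
      | (.halt x, _) => x.elim
      | (.hang, _) => 0

/-- The unnormalized final state of the runs with output `o` that end within `t` steps; `D` acts
first. -/
def finalState [DecidableEq O] (D : Machine J I O) (R : Sys I J) (t : ℕ) (o : O) :
    Op (RingWire D R) :=
  run D R t (.inl .resume) D.init R.init (zeroState _) o

/-- The probability that the distinguisher `D`, given access to `R`, outputs `1`. -/
def acceptProb (D : Machine J I Bool) (R : Sys I J) : ℝ :=
  ⨆ t : ℕ, ((finalState D R t true).trace).re

end Run

/-! ### Efficiency and indistinguishability -/

/-- Information-theoretic or computational security. -/
inductive Level where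
  | unbounded
  | polynomial

/-- The admissible families of converters, distinguishers and measurements, indexed by the security
parameter. `unbounded`: finitely many steps, each of them arbitrary. `polynomial`:
(non-uniform) quantum polynomial time, that is, polynomially many steps and polynomially many
control states (lines of the program), each line being an operation on at most two qubits (so that
only polynomially many qubits are ever used). -/
def Feasible (lev : Level) {I J : ℕ → Iface} {O : Type} (X : ∀ n, Machine (I n) (J n) O) : Prop :=
  match lev with
  | .unbounded => ∀ n, (X n).Valid ∧ ∃ N, (X n).RunsWithin N
  | .polynomial => ∃ p : Polynomial ℕ, ∀ n, (X n).Valid ∧ (X n).IsElementary ∧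
      (X n).RunsWithin (p.eval n) ∧ Fintype.card (X n).Ctrl ≤ p.eval n

/-- No admissible distinguisher has an advantage greater than `ε n`. The filter `l` says for
which `n` this is meant: `⊤` for all `n`, `atTop` for all large `n`. -/
def Indist (lev : Level) (l : Filter ℕ) {I J : ℕ → Iface} (R S : ∀ n, Sys (I n) (J n))
    (ε : ℕ → ℝ) : Prop :=
  ∀ D : ∀ n, Machine (J n) (I n) Bool, Feasible lev D →
    ∀ᶠ n in l, |acceptProb (D n) (R n) - acceptProb (D n) (S n)| ≤ ε n

/-! ### Constructing a resource from a classical channel -/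

/-- The classical interface of width `w`. -/
abbrev classicalIface (w : ℕ) : Iface := ⟨w, 0⟩

/-- Measure the wires `src` in the computational basis and write the outcome to the wires `dst`
(for the case that there are no other wires). -/
def copyClassical {V W : Type} [Fintype V] [Fintype W] [DecidableEq W] (src dst : V → W)
    (X : Op W) : Op W :=
  Matrix.of fun x y =>
    if x = y ∧ x ∘ dst = x ∘ src then
      ∑ z : W → Bool, if z ∘ src = x ∘ src then X z z else 0
    else 0

/-- The classical channel for messages of `w` bits, usable any number of times: whenever a party
hands over a message, it is forwarded to the other party. -/
def classicalChannel (w : ℕ) : Sys (classicalIface w) (classicalIface w) where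
  Mem := Empty
  Ctrl := Unit
  Out := Unit
  init := ()
  op := fun _ e _ =>
    match e with
    | .fromLeft => copyClassical Sum.inl (Sum.inr ∘ Sum.inr)
    | .fromRight => copyClassical (Sum.inr ∘ Sum.inr) Sum.inl
    | .resume => id
  next := fun _ e _ =>
    match e with
    | .fromLeft => (.toRight, ())
    | .fromRight => (.toLeft, ())
    | .resume => (.hang, ())

section Realize

variable {IA IB IB' : ℕ → Iface}

/-- The protocol `(πA, πB)` securely constructs `S` (with filter `filt`) from `R` within `ε`, for a
protocol and a simulator from the admissible converters. -/
def Constructs (lev : Level) (l : Filter ℕ) {JA JB : ℕ → Iface}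
    (R : ∀ n, Sys (JA n) (JB n)) (πA : ∀ n, Sys (IA n) (JA n)) (πB : ∀ n, Sys (JB n) (IB' n))
    (S : ∀ n, Sys (IA n) (IB n)) (filt : ∀ n, Sys (IB n) (IB' n)) (ε : ℕ → ℝ) : Prop :=
  Feasible lev πA ∧ Feasible lev πB ∧
  Indist lev l (fun n => πA n ⋈ R n ⋈ πB n) (fun n => S n ⋈ filt n) ε ∧
  ∃ σ : ∀ n, Sys (IB n) (JB n), Feasible lev σ ∧
    Indist lev l (fun n => πA n ⋈ R n) (fun n => S n ⋈ σ n) ε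

/-- `S` is `ε`-classically-realizable. -/
def ClassicallyRealizable (lev : Level) (l : Filter ℕ)
    (S : ∀ n, Sys (IA n) (IB n)) (filt : ∀ n, Sys (IB n) (IB' n)) (ε : ℕ → ℝ) : Prop :=
  ∃ (w : ℕ → ℕ) (πA : ∀ n, Sys (IA n) (classicalIface (w n)))
    (πB : ∀ n, Sys (classicalIface (w n)) (IB' n)),
    Constructs lev l (fun n => classicalChannel (w n)) πA πB S filt ε

end Realize

/-! ### Remote state preparation and describability -/

/-- An outer interface for delivering a single message of `c` bits and `q` qubits: one more
classical wire, the first one, is set when the message has been delivered. -/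
abbrev outIface (c q : ℕ) : Iface := ⟨c + 1, q⟩

/-- The projection onto the computational basis states in `s`. -/
def project {W : Type} (s : Set (W → Bool)) [DecidablePred (· ∈ s)] (X : Op W) : Op W :=
  Matrix.of fun x y => if x ∈ s ∧ y ∈ s then X x y else 0

/-- The environment that collects the two messages of a resource: it activates the two interfaces
in turn, starting on the left, until both messages have been delivered. -/
def collector (c q c' q' : ℕ) : Machine (outIface c' q') (outIface c q) Unit where
  Mem := Empty
  Ctrl := Unit
  Out := Bool
  init := ()
  op := fun _ e done =>
    match e, done with
    | .resume, true => fun _ => 0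
    | .resume, false => id
    | _, true => project {x | x (.inl (.inl 0)) = true ∧ x (.inr (.inr (.inl 0))) = true}
    | _, false => project {x | ¬ (x (.inl (.inl 0)) = true ∧ x (.inr (.inr (.inl 0))) = true)}
  next := fun _ e done =>
    match e, done with
    | .resume, _ => (.toRight, ())
    | _, true => (.halt (), ())
    | .fromLeft, false => (.toRight, ())
    | .fromRight, false => (.toLeft, ())

/-- The wires that hold the two messages. -/
def messageWires {c q c' q' : ℕ} (Z : Sys (outIface c q) (outIface c' q')) :
    (Fin c ⊕ Fin q) ⊕ (Fin c' ⊕ Fin q') → RingWire (collector c q c' q') Z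
  | .inl (.inl i) => .inl (.inl (.inl i.succ))
  | .inl (.inr j) => .inl (.inl (.inr j))
  | .inr (.inl i) => .inl (.inr (.inr (.inl i.succ)))
  | .inr (.inr j) => .inl (.inr (.inr (.inr j)))

/-- The joint (unnormalized) state of the two messages of `Z`, over the runs in which both have
been delivered within `t` steps. -/
def outputState {c q c' q' : ℕ} (Z : Sys (outIface c q) (outIface c' q')) (t : ℕ) :
    Op ((Fin c ⊕ Fin q) ⊕ (Fin c' ⊕ Fin q')) :=
  marginal (messageWires Z) (finalState (collector c q c' q') Z t ())

/-- `E[Tr(ρ ρ')]` over the outputs `([ρ], ρ')` of `Z`: the left message is a bit string `κ`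
describing `ρ = desc κ`, the right message is the quantum state `ρ'`. Runs without an output count
as `0`. -/
def expectedOverlap {k d : ℕ} (Z : Sys (outIface k 0) (outIface 0 d))
    (desc : (Fin k → Bool) → Op (Fin d)) : ℝ :=
  ⨆ t : ℕ, ∑ κ : Fin k → Bool,
    (Matrix.trace (desc κ * Matrix.of fun a b : Fin d → Bool =>
      outputState Z t (Sum.elim (Sum.elim κ Fin.elim0) (Sum.elim Fin.elim0 a))
        (Sum.elim (Sum.elim κ Fin.elim0) (Sum.elim Fin.elim0 b)))).re

/-- `E[Tr(ρ ρ')]` over the outputs `([ρ], [ρ'])` of `Z`: both messages are bit strings, describing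
`ρ = desc κ` and `ρ' = desc' κ'`. Runs without an output count as `0`. -/
def expectedDescribedOverlap {k k' d : ℕ} (Z : Sys (outIface k 0) (outIface k' 0))
    (desc : (Fin k → Bool) → Op (Fin d)) (desc' : (Fin k' → Bool) → Op (Fin d)) : ℝ :=
  ⨆ t : ℕ, ∑ κ : Fin k → Bool, ∑ κ' : Fin k' → Bool,
    (outputState Z t (Sum.elim (Sum.elim κ Fin.elim0) (Sum.elim κ' Fin.elim0))
      (Sum.elim (Sum.elim κ Fin.elim0) (Sum.elim κ' Fin.elim0))).re *
    (Matrix.trace (desc κ * desc' κ')).re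

/-- The final state of a machine running on its own, on the runs with output `o` that end within
`t` steps. -/
def soloRun {I J : Iface} {O : Type} [DecidableEq O] (T : Machine I J O) :
    ℕ → T.Ctrl → Op T.Wire → O → Op T.Wire
  | 0, _, _, _ => 0
  | t + 1, q, ρ, o => ∑ a : T.Out,
      match T.next q .resume a with
      | (.stay, q') => soloRun T t q' (T.op q .resume a ρ) o
      | (.halt o', _) => if o' = o then T.op q .resume a ρ else 0
      | (.toLeft, _) => 0
      | (.toRight, _) => 0
      | (.hang, _) => 0

/-- The state with `|κ⟩` on the left interface, `ρ` on the right interface and memory `|0…0⟩`. -/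
def testInput {k d : ℕ} {O : Type} (T : Machine (classicalIface k) ⟨0, d⟩ O)
    (κ : Fin k → Bool) (ρ : Op (Fin d)) : Op T.Wire :=
  Matrix.of fun x y =>
    if (∀ i, x (.inl (.inl i)) = κ i ∧ y (.inl (.inl i)) = κ i) ∧
        (∀ m, x (.inr (.inl m)) = false ∧ y (.inr (.inl m)) = false) then
      ρ (fun j => x (.inr (.inr (.inr j)))) (fun j => y (.inr (.inr (.inr j))))
    else 0

/-- The measurements `{E₀, E₁}` with `E₀ = desc κ` and `E₁ = 1 - desc κ` can be performed by an
admissible measuring device, which is given the classical description `κ` and the state to be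
measured; output `true` stands for the outcome `E₀`. -/
def POVMImplementable (lev : Level) {k d : ℕ → ℕ}
    (desc : ∀ n, (Fin (k n) → Bool) → Op (Fin (d n))) : Prop :=
  ∃ T : ∀ n, Machine (classicalIface (k n)) ⟨0, d n⟩ Bool, Feasible lev T ∧
    ∀ n κ ρ, IsDensity ρ →
      (⨆ t : ℕ, ((soloRun (T n) t (T n).init (testInput (T n) κ ρ) true).trace).re)
        = ((desc n κ * ρ).trace).re ∧
      (⨆ t : ℕ, ((soloRun (T n) t (T n).init (testInput (T n) κ ρ) false).trace).re)
        = (((1 - desc n κ) * ρ).trace).re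

/-- `S` (with filter `filt`) is a remote state preparation resource within `ε` with respect to `A`
and `Q`. The strings output by `A` are read through `desc`. -/
structure IsRSP (lev : Level) (l : Filter ℕ) {IA IB IB' : ℕ → Iface} {k d : ℕ → ℕ}
    (S : ∀ n, Sys (IA n) (IB n)) (filt : ∀ n, Sys (IB n) (IB' n))
    (A : ∀ n, Sys (outIface (k n) 0) (IA n))
    (desc : ∀ n, (Fin (k n) → Bool) → Op (Fin (d n)))
    (Q : ∀ n, Sys (IB' n) (outIface 0 (d n))) (ε : ℕ → ℝ) : Prop where
  feasible_left : Feasible lev A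
  feasible_right : Feasible lev Q
  desc_valid : ∀ n κ, IsDensity (desc n κ) ∨ desc n κ = 0
  accurate : ∀ᶠ n in l, 1 - ε n ≤ expectedOverlap (A n ⋈ S n ⋈ filt n ⋈ Q n) (desc n)
  testable : POVMImplementable lev desc

/-- `S` is `ε`-describable with respect to `A`: some (possibly inefficient) converter `P` on the
server's interface outputs a classical description of a density matrix that is close to the state
described by `A`. -/
def Describable (l : Filter ℕ) {IA IB : ℕ → Iface} {k d : ℕ → ℕ}
    (S : ∀ n, Sys (IA n) (IB n)) (A : ∀ n, Sys (outIface (k n) 0) (IA n))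
    (desc : ∀ n, (Fin (k n) → Bool) → Op (Fin (d n))) (ε : ℕ → ℝ) : Prop :=
  ∃ (k' : ℕ → ℕ) (P : ∀ n, Sys (IB n) (outIface (k' n) 0))
    (desc' : ∀ n, (Fin (k' n) → Bool) → Op (Fin (d n))),
    Feasible .unbounded P ∧ (∀ n κ', IsDensity (desc' n κ')) ∧
    ∀ᶠ n in l, 1 - ε n ≤ expectedDescribedOverlap (A n ⋈ S n ⋈ P n) (desc n) (desc' n)

/-- Negligible functions: `n ^ c * ε n` tends to `0` for every `c`. -/
def Negligible (ε : ℕ → ℝ) : Prop :=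
  Asymptotics.SuperpolynomialDecay Filter.atTop (fun n : ℕ => (n : ℝ)) ε

end RSP

end

open RSP

open scoped ComplexOrder

noncomputable section

namespace RSP

set_option synthInstance.maxSize 4096

open Machine

/-! ### Operators on wires -/

/-! ### Overwriting bits of a basis state: `Function.extend e a x` is `x` with the bits at the wires
`e v` replaced by `a`. -/

section Extend

variable {U V W : Type}

/-! A quantum message that arrives through a classical channel is determined by classical data. If a
party receives only classical messages, then, conditioned on its own measurement outcomes and on all
classical messages so far, its private state is a known density matrix. An unbounded party can
sample the outcomes, keep the list of steps in place of the quantum state, and finally output that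
list; it describes the conditional state exactly.

To reach such a situation, let the distinguisher `D` consist of `A`, `Q` and a tester, which waits
for both messages and then measures the quantum one with `{ρ, 1 - ρ}`. Its acceptance probability is
the expected overlap (`overlap_acceptWithin`), so with `S` and the filter it is at least `1 - ε₁`
(`expectedOverlap_le_acceptProb`). Correctness replaces the resource by `πA`, the channel and `πB`,
at the cost `ε₂`. Moving `πB` from the resource to the distinguisher changes nothing
(`acceptProb_rotate`). Security then replaces `πA` and the channel by `S` and `σ`, again at the cost
`ε₂`. In the resulting chain `A`, `S`, `σ`, `πB`, `Q`, the link between `σ` and `πB` is classical.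
Hence `πB` with `Q` may be replaced by its transcript without any loss (`exists_described`, resting
on `ringValue_transcript`), and `P` is `σ` followed by this transcript machine.

Three technical points account for most of the length.

The condition `Valid` constrains a machine only on states that are classical on all its classical
wires. After a composition the inner wires belong to the memory, so validity is not inherited
directly. Each machine is therefore replaced by its `dephased` version, which measures the classical
wires it touches. This is `StrictlyValid`, a condition stable under composition, and it agrees with
the original on all states that occur in a run (`ClassicallyEq`).

Regrouping components is done by unfolding everything into a cyclic list of nodes on one common set
of wires. The value of such a ring, `ringValue`, does not depend on the bracketing, and it is the
same for each number of steps, because one step of a composition is one step of a component. A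
change of the wire set, with fresh wires in `|0⟩`, is a simulation along `fill`.

The tester is not bounded by itself, since it forwards control as long as it is activated. Together
with the bounded converters `A` and `Q` it is (`RelaysWithin.runsWithin`), so `D` is admissible. -/

theorem extend_extend {e : V → W} (he : e.Injective) (a b : V → Bool) (x : W → Bool) :
    Function.extend e a (Function.extend e b x) = Function.extend e a x := by
  funext w
  by_cases h : ∃ v, e v = w
  · obtain ⟨v, rfl⟩ := h
    simp [he.extend_apply]
  · simp [Function.extend_apply' _ _ _ h]

theorem extend_comp_self {e : V → W} (he : e.Injective) (x : W → Bool) :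
    Function.extend e (x ∘ e) x = x := by
  funext w
  by_cases h : ∃ v, e v = w
  · obtain ⟨v, rfl⟩ := h
    simp [he.extend_apply]
  · simp [Function.extend_apply' _ _ _ h]

theorem extend_extend_comp {f : V → W} {g : U → V} (hf : f.Injective) (hg : g.Injective)
    (a : U → Bool) (x : W → Bool) :
    Function.extend f (Function.extend g a (x ∘ f)) x = Function.extend (f ∘ g) a x := by
  funext w
  by_cases h : ∃ v, f v = w
  · obtain ⟨v, rfl⟩ := h
    rw [hf.extend_apply]
    by_cases h' : ∃ u, g u = v
    · obtain ⟨u, rfl⟩ := h'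
      rw [hg.extend_apply]
      exact ((hf.comp hg).extend_apply a x u).symm
    · rw [Function.extend_apply' _ _ _ h', Function.extend_apply']
      · rfl
      · rintro ⟨u, hu⟩
        exact h' ⟨u, hf hu⟩
  · rw [Function.extend_apply' _ _ _ h, Function.extend_apply']
    rintro ⟨u, hu⟩
    exact h ⟨g u, hu⟩

theorem extend_comp_of_disjoint {e : V → W} {f : U → W} (h : ∀ u v, f u ≠ e v)
    (a : V → Bool) (x : W → Bool) : Function.extend e a x ∘ f = x ∘ f := by
  funext u
  simp only [Function.comp_apply]
  rw [Function.extend_apply']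
  rintro ⟨v, hv⟩
  exact h u v hv.symm

end Extend

/-! ### Local operations. -/

section OnWires

variable {U V W : Type}

theorem onWires_comp {f : V → W} {g : U → V} (hf : f.Injective) (hg : g.Injective)
    (Φ : Op U → Op U) : onWires f (onWires g Φ) = onWires (f ∘ g) Φ := by
  funext X
  ext x y
  simp only [onWires, Matrix.of_apply, extend_extend_comp hf hg]
  rfl

theorem onWires_id (Φ : Op W → Op W) : onWires id Φ = Φ := by
  funext X
  have h : ∀ a x : W → Bool, Function.extend id a x = a := fun a x =>
    funext fun w => Function.injective_id.extend_apply a x w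
  ext x y
  simp only [onWires, Matrix.of_apply, h]
  rfl

theorem onWires_id_map (e : V → W) (he : e.Injective) : onWires e (id : Op V → Op V) = id := by
  funext X
  ext x y
  simp [onWires, extend_comp_self he]

theorem onWires_zero_map (e : V → W) : onWires e (fun _ => (0 : Op V)) = fun _ => 0 := by
  funext X
  ext x y
  simp [onWires]

theorem onWires_map_zero {e : V → W} {Φ : Op V → Op V} (h : Φ 0 = 0) : onWires e Φ 0 = 0 := by
  ext x y
  have : (Matrix.of fun _ _ : V → Bool => (0 : ℂ)) = 0 := rfl
  simp [onWires, this, h]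

theorem onWires_linear {e : V → W} {Φ : Op V → Op V} (h : IsLinearMap ℂ Φ) :
    IsLinearMap ℂ (onWires e Φ) where
  map_add X Y := by
    ext x y
    have : (Matrix.of fun a b : V → Bool => (X + Y) (Function.extend e a x)
        (Function.extend e b y)) = (Matrix.of fun a b => X (Function.extend e a x)
        (Function.extend e b y)) + Matrix.of fun a b => Y (Function.extend e a x)
        (Function.extend e b y) := rfl
    simp only [onWires, Matrix.of_apply, Matrix.add_apply] at this ⊢
    rw [this, h.map_add, Matrix.add_apply]
  map_smul c X := by
    ext x y
    have : (Matrix.of fun a b : V → Bool => (c • X) (Function.extend e a x)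
        (Function.extend e b y)) = c • (Matrix.of fun a b => X (Function.extend e a x)
        (Function.extend e b y)) := rfl
    simp only [onWires, Matrix.of_apply, Matrix.smul_apply] at this ⊢
    rw [this, h.map_smul, Matrix.smul_apply]

end OnWires

/-! ### Partial traces. -/

section Marginal

variable {V W : Type} [Fintype V] [Fintype W] [DecidableEq W]

/-- The bits of `x` at `e` merely label the row, so they can be frozen at any `a₀`. The range of
summation then no longer depends on `a`, which makes the partial trace a sum of submatrices. -/
theorem marginal_apply_eq [DecidableEq V] {e : V → W} (he : e.Injective) (a₀ : V → Bool)
    (X : Op W) (a b : V → Bool) :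
    marginal e X a b = ∑ x : W → Bool,
      if x ∘ e = a₀ then X (Function.extend e a x) (Function.extend e b x) else 0 := by
  simp only [marginal, Matrix.of_apply, ← Finset.sum_filter]
  refine Finset.sum_nbij' (fun x => Function.extend e a₀ x) (fun x => Function.extend e a x)
    ?_ ?_ ?_ ?_ ?_
  · intro x _
    simp [Function.extend_comp he]
  · intro x _
    simp [Function.extend_comp he]
  · intro x hx
    have hx : x ∘ e = a := by simpa using hx
    rw [extend_extend he, ← hx, extend_comp_self he]
  · intro x hx
    have hx : x ∘ e = a₀ := by simpa using hx
    rw [extend_extend he, ← hx, extend_comp_self he]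
  · intro x hx
    have hx : x ∘ e = a := by simpa using hx
    rw [extend_extend he, extend_extend he, ← hx, extend_comp_self he]

theorem marginal_eq_sum [DecidableEq V] {e : V → W} (he : e.Injective) (X : Op W) :
    marginal e X = ∑ x : W → Bool, if x ∘ e = (fun _ => false) then
      X.submatrix (fun a => Function.extend e a x) (fun b => Function.extend e b x) else 0 := by
  ext a b
  rw [marginal_apply_eq he (fun _ => false), Matrix.sum_apply]
  refine Finset.sum_congr rfl fun x _ => ?_
  split_ifs <;> rfl

theorem marginal_linear (e : V → W) : IsLinearMap ℂ (marginal e) where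
  map_add X Y := by
    ext a b
    simp only [marginal, Matrix.of_apply, Matrix.add_apply, ← Finset.sum_add_distrib]
    refine Finset.sum_congr rfl fun x _ => ?_
    split_ifs <;> simp
  map_smul c X := by
    ext a b
    simp only [marginal, Matrix.of_apply, Matrix.smul_apply, Finset.smul_sum]
    refine Finset.sum_congr rfl fun x _ => ?_
    split_ifs <;> simp

/-- For each value of the traced-out bits, `Φ` acts on one submatrix in `marginal_eq_sum`; linearity
collects these terms. -/
theorem marginal_onWires [DecidableEq V] {e : V → W} (he : e.Injective) {Φ : Op V → Op V}
    (hΦ : IsLinearMap ℂ Φ) (X : Op W) : marginal e (onWires e Φ X) = Φ (marginal e X) := by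
  have : Φ (marginal e X) = hΦ.mk' Φ (marginal e X) := rfl
  rw [this, marginal_eq_sum he X, map_sum]
  ext a b
  rw [marginal_apply_eq he (fun _ => false), Matrix.sum_apply]
  refine Finset.sum_congr rfl fun x _ => ?_
  split_ifs
  · simp only [onWires, Matrix.of_apply, extend_extend he, Function.extend_comp he]
    rfl
  · rw [map_zero]
    rfl

theorem trace_marginal [DecidableEq V] {e : V → W} (he : e.Injective) (X : Op W) :
    (marginal e X).trace = X.trace := by
  simp only [Matrix.trace, Matrix.diag, marginal, Matrix.of_apply]
  rw [Finset.sum_comm]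
  refine Finset.sum_congr rfl fun x _ => ?_
  rw [Finset.sum_eq_single (x ∘ e)]
  · simp [extend_comp_self he]
  · intro b _ hb
    rw [if_neg (Ne.symm hb)]
  · simp

theorem trace_onWires [DecidableEq V] {e : V → W} (he : e.Injective) {Φ : Op V → Op V}
    (hΦ : IsLinearMap ℂ Φ) (X : Op W) : (onWires e Φ X).trace = (Φ (marginal e X)).trace := by
  rw [← trace_marginal he, marginal_onWires he hΦ]

theorem posSemidef_marginal [DecidableEq V] {e : V → W} (he : e.Injective) {X : Op W}
    (hX : X.PosSemidef) : (marginal e X).PosSemidef := by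
  rw [marginal_eq_sum he]
  refine Matrix.posSemidef_sum _ fun x _ => ?_
  split_ifs
  · exact hX.submatrix _
  · exact Matrix.PosSemidef.zero

end Marginal

/-! ### Completely positive maps -/

section CP

variable {V W : Type} [Fintype V] [DecidableEq V] [Fintype W] [DecidableEq W]

theorem IsCP.linear {Φ : Op W → Op W} (h : IsCP Φ) : IsLinearMap ℂ Φ := by
  obtain ⟨k, K, hK⟩ := h
  constructor
  · intro X Y
    simp [hK, Matrix.mul_add, Matrix.add_mul, Finset.sum_add_distrib]
  · intro c X
    simp [hK, Finset.smul_sum]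

theorem IsCP.map_zero {Φ : Op W → Op W} (h : IsCP Φ) : Φ 0 = 0 :=
  h.linear.map_zero

theorem IsCP.posSemidef {Φ : Op W → Op W} (h : IsCP Φ) {X : Op W} (hX : X.PosSemidef) :
    (Φ X).PosSemidef := by
  obtain ⟨k, K, hK⟩ := h
  rw [hK]
  exact Matrix.posSemidef_sum _ fun i _ => hX.mul_mul_conjTranspose_same (K i)

theorem isCP_of_kraus {ι : Type} [Fintype ι] {Φ : Op W → Op W} (K : ι → Op W)
    (h : ∀ X, Φ X = ∑ i, K i * X * (K i).conjTranspose) : IsCP Φ := by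
  refine ⟨Fintype.card ι, fun i => K ((Fintype.equivFin ι).symm i), fun X => ?_⟩
  rw [h]
  exact ((Fintype.equivFin ι).symm.sum_comp
    (fun i => K i * X * (K i).conjTranspose)).symm

theorem isCP_zero : IsCP (fun _ : Op W => 0) := ⟨0, Fin.elim0, by simp⟩

theorem isCP_id : IsCP (id : Op W → Op W) :=
  isCP_of_kraus (ι := Unit) (fun _ => 1) (by simp)

theorem IsCP.comp {Φ Ψ : Op W → Op W} (h : IsCP Φ) (h' : IsCP Ψ) : IsCP (fun X => Φ (Ψ X)) := by
  obtain ⟨k, K, hK⟩ := h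
  obtain ⟨m, L, hL⟩ := h'
  refine isCP_of_kraus (ι := Fin k × Fin m) (fun p => K p.1 * L p.2) fun X => ?_
  simp only [hK, hL, Fintype.sum_prod_type, Matrix.conjTranspose_mul]
  refine Finset.sum_congr rfl fun i _ => ?_
  simp only [Finset.mul_sum, Finset.sum_mul, Matrix.mul_assoc]

open Classical in
/-- `K ⊗ 1`, for an operator `K` on the wires `e v`. -/
def liftOp (e : V → W) (K : Op V) : Op W :=
  Matrix.of fun x y => if ∃ a, y = Function.extend e a x then K (x ∘ e) (y ∘ e) else 0

/-- Row `x` of `K ⊗ 1` is supported on the states that differ from `x` only at `e`. The function `f`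
is left general to serve both for multiplication by the operator on the left and by its adjoint on
the right. -/
theorem sum_liftOp {e : V → W} (he : e.Injective) (K : Op V) (x : W → Bool)
    (f : ℂ → (W → Bool) → ℂ) (hf : ∀ u, f 0 u = 0) :
    ∑ u, f (liftOp e K x u) u = ∑ a, f (K (x ∘ e) a) (Function.extend e a x) := by
  classical
  refine (Fintype.sum_of_injective (fun a => Function.extend e a x) ?_ _ _ ?_ ?_).symm
  · intro a b hab
    have := congrArg (· ∘ e) hab
    simpa [Function.extend_comp he] using this
  · intro u hu
    have : ¬ ∃ a, u = Function.extend e a x := fun ⟨a, ha⟩ => hu ⟨a, ha.symm⟩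
    simp [liftOp, this, hf]
  · intro a
    have : ∃ b, Function.extend e a x = Function.extend e b x := ⟨a, rfl⟩
    simp [liftOp, this, Function.extend_comp he]

theorem IsCP.onWires {e : V → W} (he : e.Injective) {Φ : Op V → Op V} (h : IsCP Φ) :
    IsCP (onWires e Φ) := by
  obtain ⟨k, K, hK⟩ := h
  refine ⟨k, fun i => liftOp e (K i), fun X => ?_⟩
  ext x y
  simp only [RSP.onWires, hK, Matrix.of_apply, Matrix.sum_apply]
  refine Finset.sum_congr rfl fun i _ => ?_
  simp only [Matrix.mul_apply, Matrix.conjTranspose_apply, Matrix.of_apply]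
  refine Eq.trans ?_ (sum_liftOp he (K i) y
    (fun c v => (∑ u, liftOp e (K i) x u * X u v) * star c) (by simp)).symm
  refine Finset.sum_congr rfl fun b _ => ?_
  congr 1
  exact (sum_liftOp he (K i) x (fun c u => c * X u (Function.extend e b y)) (by simp)).symm

theorem isCP_project (s : Set (W → Bool)) [DecidablePred (· ∈ s)] : IsCP (project s) := by
  refine isCP_of_kraus (ι := Unit)
    (fun _ => Matrix.diagonal fun x => if x ∈ s then 1 else 0) fun X => ?_
  ext x y
  simp only [project, Matrix.of_apply, Finset.univ_unique, Finset.sum_singleton,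
    Matrix.diagonal_conjTranspose, Matrix.mul_diagonal, Matrix.diagonal_mul]
  by_cases hx : x ∈ s <;> by_cases hy : y ∈ s <;> simp [hx, hy]

end CP

/-! ### Dephasing -/

section Dephase

variable {V W : Type}

open Classical in
/-- Measurement of the wires in `c` in the computational basis, forgetting the outcome. -/
def dephase (c : Set W) (X : Op W) : Op W :=
  Matrix.of fun x y => if ∀ w ∈ c, x w = y w then X x y else 0

theorem dephase_of_classical {c : Set W} {X : Op W} (h : IsClassicalOn c X) : dephase c X = X := by
  ext x y
  simp only [dephase, Matrix.of_apply, ite_eq_left_iff, not_forall]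
  rintro ⟨w, hw, hxy⟩
  exact (h x y ⟨w, hw, hxy⟩).symm

theorem IsClassicalOn.mono {c c' : Set W} {X : Op W} (h : IsClassicalOn c X) (hc : c' ⊆ c) :
    IsClassicalOn c' X := fun x y ⟨w, hw, hxy⟩ => h x y ⟨w, hc hw, hxy⟩

theorem isClassicalOn_dephase (c : Set W) (X : Op W) : IsClassicalOn c (dephase c X) := by
  rintro x y ⟨w, hw, hxy⟩
  simp only [dephase, Matrix.of_apply, ite_eq_right_iff]
  intro h
  exact absurd (h w hw) hxy

theorem IsClassicalOn.dephase {c : Set W} {X : Op W} (h : IsClassicalOn c X) (c' : Set W) :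
    IsClassicalOn c (dephase c' X) := by
  rintro x y hw
  simp [RSP.dephase, h x y hw]

/-- The Kraus operators are the projections onto the possible values `z` of the wires in `c`. -/
theorem isCP_dephase [Fintype W] [DecidableEq W] (c : Set W) : IsCP (dephase c) := by
  classical
  refine isCP_of_kraus (ι := c → Bool)
    (fun z => Matrix.diagonal fun x => if (fun w : c => x w) = z then 1 else 0) fun X => ?_
  ext x y
  simp only [dephase, Matrix.of_apply, Matrix.sum_apply,
    Matrix.diagonal_conjTranspose, Matrix.mul_diagonal, Matrix.diagonal_mul]
  rw [Finset.sum_eq_single (fun w : c => x w)]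
  · have : (∀ w ∈ c, x w = y w) ↔ (fun w : c => y w) = (fun w : c => x w) := by
      simp only [funext_iff, Subtype.forall]
      exact forall₂_congr fun _ _ => eq_comm
    by_cases h : (fun w : c => y w) = (fun w : c => x w)
    · rw [if_pos (this.2 h)]
      simp [h]
    · rw [if_neg (mt this.1 h)]
      simp [h]
  · intro z _ hz
    simp [Ne.symm hz]
  · simp

theorem trace_dephase [Fintype W] [DecidableEq W] (c : Set W) (X : Op W) :
    (dephase c X).trace = X.trace := by
  simp [Matrix.trace, dephase]

theorem dephase_onWires {e : V → W} (c : Set V) (Φ : Op V → Op V) (X : Op W) :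
    dephase (e '' c) (onWires e Φ X) = onWires e (fun Y => dephase c (Φ Y)) X := by
  classical
  ext x y
  simp only [dephase, onWires, Set.forall_mem_image, Matrix.of_apply, Function.comp_apply]

theorem onWires_dephase {e : V → W} (he : e.Injective) (c : Set V) (Φ : Op V → Op V) (X : Op W) :
    onWires e Φ (dephase (e '' c) X) = onWires e (fun Y => Φ (dephase c Y)) X := by
  classical
  ext x y
  simp only [dephase, onWires, Matrix.of_apply, Set.forall_mem_image, he.extend_apply]

/-- The value of a local operation at `(x, y)` only depends on the block of `(x, y)`. -/
theorem onWires_apply_congr {e : V → W} {Φ : Op V → Op V} {X Y : Op W} {x y : W → Bool}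
    (h : ∀ a b, X (Function.extend e a x) (Function.extend e b y) =
      Y (Function.extend e a x) (Function.extend e b y)) :
    onWires e Φ X x y = onWires e Φ Y x y := by
  simp only [onWires, Matrix.of_apply, h]

/-- An operation that does not touch `w` cannot create coherence there: the block of `X` that it
sees at `(x, y)` keeps the different values at `w`, hence vanishes. -/
theorem onWires_apply_eq_zero {e : V → W} {Φ : Op V → Op V} {X : Op W} {x y : W → Bool}
    (h0 : onWires e Φ 0 = 0) {w : W} (hw : ∀ v, e v ≠ w) (hxy : x w ≠ y w)
    (hX : ∀ x y, x w ≠ y w → X x y = 0) : onWires e Φ X x y = 0 := by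
  have : onWires e Φ X x y = onWires e Φ 0 x y := by
    refine onWires_apply_congr fun a b => ?_
    have hn : ¬ ∃ v, e v = w := fun ⟨v, hv⟩ => hw v hv
    rw [hX, Matrix.zero_apply]
    rwa [Function.extend_apply' _ _ _ hn, Function.extend_apply' _ _ _ hn]
  rw [this, h0, Matrix.zero_apply]

/-- A local operation preserves classicality of wires, if it does so for those it acts on. -/
theorem IsClassicalOn.onWires {e : V → W} (he : e.Injective) {Φ : Op V → Op V} (h0 : Φ 0 = 0)
    {c : Set W} (hΦ : ∀ Y, IsClassicalOn (e ⁻¹' c) Y → IsClassicalOn (e ⁻¹' c) (Φ Y)) {X : Op W}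
    (hX : IsClassicalOn c X) : IsClassicalOn c (onWires e Φ X) := by
  rintro x y ⟨w, hw, hxy⟩
  by_cases hr : ∃ v, e v = w
  · obtain ⟨v, rfl⟩ := hr
    refine hΦ _ ?_ (x ∘ e) (y ∘ e) ⟨v, hw, hxy⟩
    rintro a b ⟨u, hu, hab⟩
    refine hX _ _ ⟨e u, hu, ?_⟩
    rwa [he.extend_apply, he.extend_apply]
  · exact onWires_apply_eq_zero (onWires_map_zero h0) (fun v hv => hr ⟨v, hv⟩) hxy
      fun x y h => hX x y ⟨w, hw, h⟩

end Dephase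

/-! ### Additional wires in the state zero -/

section Fill

variable {U V W : Type}

/-- All wires that are not of the form `ι v` are zero. -/
def ZeroOff (ι : V → W) (x : W → Bool) : Prop := ∀ w, (∀ v, ι v ≠ w) → x w = false

theorem zeroOff_extend (ι : V → W) (z : V → Bool) :
    ZeroOff ι (Function.extend ι z (fun _ => false)) := by
  intro w hw
  rw [Function.extend_apply']
  rintro ⟨v, hv⟩
  exact hw v hv

theorem ZeroOff.eq_extend {ι : V → W} (hι : ι.Injective) {x : W → Bool} (h : ZeroOff ι x) :
    x = Function.extend ι (x ∘ ι) (fun _ => false) := by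
  funext w
  by_cases hr : ∃ v, ι v = w
  · obtain ⟨v, rfl⟩ := hr
    simp [hι.extend_apply]
  · rw [Function.extend_apply' _ _ _ hr]
    exact h w fun v hv => hr ⟨v, hv⟩

open Classical in
/-- The state `X` on the wires `ι v`, and `|0⟩` on all other wires. -/
def fill (ι : V → W) (X : Op V) : Op W :=
  Matrix.of fun x y => if ZeroOff ι x ∧ ZeroOff ι y then X (x ∘ ι) (y ∘ ι) else 0

theorem fill_id (X : Op W) : fill id X = X := by
  ext x y
  have h : ∀ x : W → Bool, ZeroOff id x := fun x w hw => absurd rfl (hw w)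
  simp [fill, h]

theorem onWires_fill {ι : V → W} (hι : ι.Injective) {e : U → V} (he : e.Injective)
    {Φ : Op U → Op U} (h0 : Φ 0 = 0) (X : Op V) :
    onWires (ι ∘ e) Φ (fill ι X) = fill ι (onWires e Φ X) := by
  classical
  ext x y
  have key : ∀ (z : W → Bool) (a : U → Bool), Function.extend (ι ∘ e) a z ∘ ι =
      Function.extend e a (z ∘ ι) := by
    intro z a
    rw [← extend_extend_comp hι he, Function.extend_comp hι]
  have key' : ∀ (z : W → Bool) (a : U → Bool),
      ZeroOff ι (Function.extend (ι ∘ e) a z) ↔ ZeroOff ι z := by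
    intro z a
    refine forall₂_congr fun w hw => ?_
    rw [Function.extend_apply']
    rintro ⟨u, hu⟩
    exact hw _ hu
  simp only [onWires, fill, Matrix.of_apply, key', key]
  by_cases hz : ZeroOff ι x ∧ ZeroOff ι y
  · simp only [if_pos hz]
    rfl
  · simp only [if_neg hz]
    have : (Matrix.of fun _ _ : U → Bool => (0 : ℂ)) = 0 := rfl
    rw [this, h0, Matrix.zero_apply]

/-- This is why runs in two rings with different wire sets start from corresponding states. -/
theorem fill_zeroState [Fintype V] [DecidableEq V] [Fintype W] [DecidableEq W] {ι : V → W}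
    (hι : ι.Injective) : fill ι (zeroState V) = zeroState W := by
  ext x y
  have h : ∀ x : W → Bool, (ZeroOff ι x ∧ (fun _ => false) = x ∘ ι) ↔ (fun _ => false) = x := by
    intro x
    constructor
    · rintro ⟨h1, h2⟩
      rw [h1.eq_extend hι, ← h2]
      funext w
      by_cases hr : ∃ v, ι v = w
      · obtain ⟨v, rfl⟩ := hr
        simp [hι.extend_apply]
      · simp [Function.extend_apply' _ _ _ hr]
    · rintro rfl
      exact ⟨fun _ _ => rfl, rfl⟩
  have hx := h x
  have hy := h y
  simp only [fill, zeroState, Matrix.single_apply, Matrix.of_apply]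
  split_ifs <;> first | rfl | (exfalso; tauto)

theorem sum_fill [Fintype V] [DecidableEq V] [Fintype W] [DecidableEq W] {ι : V → W}
    (hι : ι.Injective) (g : (W → Bool) → ℂ) (hg : ∀ x, ¬ ZeroOff ι x → g x = 0) :
    ∑ x, g x = ∑ z : V → Bool, g (Function.extend ι z (fun _ => false)) := by
  refine (Fintype.sum_of_injective (fun z => Function.extend ι z (fun _ => false)) ?_ _ _ ?_
    fun _ => rfl).symm
  · intro a b hab
    have := congrArg (· ∘ ι) hab
    simpa [Function.extend_comp hι] using this
  · intro x hx
    exact hg x fun h => hx ⟨_, (h.eq_extend hι).symm⟩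

/-- Partial traces of a state with additional wires in the state zero. -/
theorem marginal_fill {V' W' : Type} [Fintype V] [DecidableEq V] [Fintype V'] [DecidableEq V']
    [Fintype W] [DecidableEq W] [Fintype W'] [DecidableEq W']
    {ι : W → W'} (hι : ι.Injective) {j : V → V'} {e : V → W}
    (he : e.Injective) {e' : V' → W'} (he' : e'.Injective) (hc : ∀ v, e' (j v) = ι (e v))
    (hd : ∀ v', (∀ v, j v ≠ v') → ∀ w, ι w ≠ e' v') (X : Op W) :
    marginal e' (fill ι X) = fill j (marginal e X) := by
  classical
  ext a b
  -- By `hc` and `hd` the four embeddings form a pullback square: a wire lies in the images of both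
  -- `e'` and `ι` exactly when it comes from `V`. The wires of `V'` outside the image of `j` are
  -- fresh, hence zero.
  have hext : ∀ (x : W → Bool) (b : V' → Bool),
      Function.extend e' b (Function.extend ι x (fun _ => false)) ∘ ι =
        Function.extend e (b ∘ j) x := by
    intro x b
    funext w
    by_cases hr : ∃ v, e v = w
    · obtain ⟨v, rfl⟩ := hr
      simp only [Function.comp_apply]
      rw [he.extend_apply, ← hc, he'.extend_apply]
      rfl
    · simp only [Function.comp_apply]
      rw [Function.extend_apply' _ _ _ hr, Function.extend_apply', hι.extend_apply]
      rintro ⟨v', hv'⟩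
      by_cases hv : ∃ v, j v = v'
      · obtain ⟨v, rfl⟩ := hv
        exact hr ⟨v, hι (by rw [← hc, hv'])⟩
      · exact hd v' (fun v h => hv ⟨v, h⟩) w hv'.symm
  have hzero : ∀ (x : W → Bool) (b : V' → Bool),
      ZeroOff ι (Function.extend e' b (Function.extend ι x (fun _ => false))) ↔ ZeroOff j b := by
    intro x b
    constructor
    · intro h v' hv'
      have := h (e' v') (hd v' hv')
      rwa [he'.extend_apply] at this
    · intro h w hw
      by_cases hr : ∃ v', e' v' = w
      · obtain ⟨v', rfl⟩ := hr
        rw [he'.extend_apply]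
        refine h v' fun v hv => ?_
        subst hv
        exact hw (e v) (hc v).symm
      · rw [Function.extend_apply' _ _ _ hr, Function.extend_apply']
        rintro ⟨v, hv⟩
        exact hw v hv
  simp only [marginal, Matrix.of_apply]
  rw [sum_fill hι]
  · have hcond : ∀ x : W → Bool, (Function.extend ι x (fun _ => false) ∘ e' = a) ↔
        (ZeroOff j a ∧ x ∘ e = a ∘ j) := by
      intro x
      constructor
      · rintro rfl
        constructor
        · intro v' hv'
          simp only [Function.comp_apply]
          rw [Function.extend_apply']
          rintro ⟨w, hw⟩
          exact hd v' hv' w hw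
        · funext v
          simp [hc, hι.extend_apply]
      · rintro ⟨h1, h2⟩
        funext v'
        by_cases hv : ∃ v, j v = v'
        · obtain ⟨v, rfl⟩ := hv
          simp only [Function.comp_apply, hc, hι.extend_apply]
          exact congrFun h2 v
        · rw [h1 v' fun v h => hv ⟨v, h⟩]
          simp only [Function.comp_apply]
          rw [Function.extend_apply']
          rintro ⟨w, hw⟩
          exact hd v' (fun v h => hv ⟨v, h⟩) w hw
    simp only [fill, Matrix.of_apply, hcond, hzero, hext, Function.extend_comp hι,
      zeroOff_extend, true_and]
    by_cases ha : ZeroOff j a <;> by_cases hb : ZeroOff j b <;> simp [ha, hb]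
  · intro x hx
    split_ifs
    · simp only [fill, Matrix.of_apply]
      rw [if_neg fun h => hx h.1]
    · rfl

theorem trace_fill [Fintype V] [DecidableEq V] [Fintype W] [DecidableEq W] {ι : V → W}
    (hι : ι.Injective) (X : Op V) : (fill ι X).trace = X.trace := by
  simp only [Matrix.trace, Matrix.diag]
  rw [sum_fill hι]
  · refine Finset.sum_congr rfl fun z _ => ?_
    simp [fill, Function.extend_comp hι, zeroOff_extend]
  · intro x hx
    simp only [fill, Matrix.of_apply]
    rw [if_neg fun h => hx h.1]

end Fill

/-! ### Machines that keep every single classical wire classical -/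

/-- The moves with renamed outputs. -/
def Move.map {O O' : Type} (f : O → O') : Move O → Move O'
  | .toLeft => .toLeft
  | .toRight => .toRight
  | .stay => .stay
  | .halt o => .halt (f o)
  | .hang => .hang

namespace Machine

variable {I J K : Iface} {O : Type}

/-- Each step is an instrument which, on each of the classical wires separately, turns classical
data into classical data. Unlike `Valid`, this is stable under composition. -/
structure StrictlyValid (X : Machine I J O) : Prop where
  completelyPositive : ∀ q e a, IsCP (X.op q e a)
  tracePreserving : ∀ q e ρ, ∑ a, (X.op q e a ρ).trace = ρ.trace
  classical : ∀ c ⊆ X.classicalWires, ∀ q e a ρ, IsClassicalOn c ρ →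
    IsClassicalOn c (X.op q e a ρ)

theorem StrictlyValid.valid {X : Machine I J O} (h : X.StrictlyValid) : X.Valid :=
  ⟨h.1, h.2, h.3 _ subset_rfl⟩

theorem embFst_injective (X : Machine I J O) (Y : Machine J K O) : (embFst X Y).Injective := by
  rintro (i | m | j) (i' | m' | j') h <;> simp_all [embFst]

theorem embSnd_injective (X : Machine I J O) (Y : Machine J K O) : (embSnd X Y).Injective := by
  rintro (i | m | j) (i' | m' | j') h <;> simp_all [embSnd]

/-- The operations of a composition, when the component to act is known. -/
def compOp (X : Machine I J O) (Y : Machine J K O) (x : X.Ctrl) (y : Y.Ctrl) :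
    Entry ⊕ Entry → X.Out ⊕ Y.Out → Op (I.Wire ⊕ (X.Mem ⊕ J.Wire ⊕ Y.Mem) ⊕ K.Wire) →
      Op (I.Wire ⊕ (X.Mem ⊕ J.Wire ⊕ Y.Mem) ⊕ K.Wire)
  | .inl e, .inl a => onWires (embFst X Y) (X.op x e a)
  | .inr e, .inr b => onWires (embSnd X Y) (Y.op y e b)
  | _, _ => fun _ => 0

/-- The control of a composition, when the component to act is known. -/
def compNext {C D A B : Type} (next : C → Entry → A → Move O × C)
    (next' : D → Entry → B → Move O × D) (q : C × D × (Entry ⊕ Entry)) :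
    Entry ⊕ Entry → A ⊕ B → Move O × C × D × (Entry ⊕ Entry)
  | .inl e, .inl a => ((moveFst (next q.1 e a).1).1,
      ((next q.1 e a).2, q.2.1, (moveFst (next q.1 e a).1).2))
  | .inr e, .inr b => ((moveSnd (next' q.2.1 e b).1).1,
      (q.1, (next' q.2.1 e b).2, (moveSnd (next' q.2.1 e b).1).2))
  | _, _ => (.hang, q)

/-- The composition of `X` and `Y`, with an arbitrary choice `f` of the component that is to act
first. -/
abbrev compAt (X : Machine I J O) (Y : Machine J K O) (f : Entry ⊕ Entry) : Machine I K O where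
  Mem := X.Mem ⊕ J.Wire ⊕ Y.Mem
  Ctrl := X.Ctrl × Y.Ctrl × (Entry ⊕ Entry)
  Out := X.Out ⊕ Y.Out
  init := (X.init, Y.init, f)
  op := fun q e c => compOp X Y q.1 q.2.1 (focus q.2.2 e) c
  next := fun q e c => compNext X.next Y.next q (focus q.2.2 e) c

/-- `comp` lets the left component respond to the first `resume`. In the distinguishers below it is
often the right component that must begin, so the general theory is about `compAt`, where the
starting component is free. -/
theorem comp_eq_compAt (X : Machine I J O) (Y : Machine J K O) :
    X ⋈ Y = X.compAt Y (.inl .resume) := by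
  have : (X ⋈ Y).op = fun q e c => compOp X Y q.1 q.2.1 (focus q.2.2 e) c := by
    funext q e c
    simp only [comp]
    rcases focus q.2.2 e with e' | e' <;> rcases c with a | b <;> rfl
  have h : (X ⋈ Y).next = fun q e c => compNext X.next Y.next q (focus q.2.2 e) c := by
    funext q e c
    simp only [comp]
    rcases focus q.2.2 e with e' | e' <;> rcases c with a | b <;> rfl
  show Machine.mk _ _ _ _ (X ⋈ Y).op (X ⋈ Y).next = _
  rw [this, h]
  rfl

theorem isCP_compOp {X : Machine I J O} {Y : Machine J K O} (hX : ∀ q e a, IsCP (X.op q e a))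
    (hY : ∀ q e a, IsCP (Y.op q e a)) (x : X.Ctrl) (y : Y.Ctrl) (f : Entry ⊕ Entry)
    (c : X.Out ⊕ Y.Out) : IsCP (compOp X Y x y f c) := by
  rcases f with e | e <;> rcases c with a | b
  · exact (hX _ _ _).onWires (embFst_injective X Y)
  · exact isCP_zero
  · exact isCP_zero
  · exact (hY _ _ _).onWires (embSnd_injective X Y)

/-- In a composition the connecting wires are memory and may carry coherences. The condition
survives because it treats each set of classical wires on its own: an outer set pulls back to
classical wires of the acting component, with no assumption on the inner ones. -/
theorem StrictlyValid.compAt {X : Machine I J O} {Y : Machine J K O} (hX : X.StrictlyValid)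
    (hY : Y.StrictlyValid) (f : Entry ⊕ Entry) : (X.compAt Y f).StrictlyValid where
  completelyPositive q e a := isCP_compOp hX.1 hY.1 _ _ _ _
  tracePreserving := by
    intro q e ρ
    simp only [Fintype.sum_sum_type]
    rcases focus q.2.2 e with e' | e'
    · simp only [compOp, Matrix.trace_zero, Finset.sum_const_zero, add_zero]
      simp only [trace_onWires (embFst_injective X Y) (hX.1 _ _ _).linear]
      rw [hX.2, trace_marginal (embFst_injective X Y)]
    · simp only [compOp, Matrix.trace_zero, Finset.sum_const_zero, zero_add]
      simp only [trace_onWires (embSnd_injective X Y) (hY.1 _ _ _).linear]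
      rw [hY.2, trace_marginal (embSnd_injective X Y)]
  classical := by
    intro c hc q e a ρ hρ
    show IsClassicalOn c (compOp X Y q.1 q.2.1 (focus q.2.2 e) a ρ)
    rcases focus q.2.2 e with e' | e' <;> rcases a with a | a
    · refine hρ.onWires (embFst_injective X Y) (hX.1 _ _ _).map_zero
        (fun Z => hX.3 _ (fun w hw => ?_) _ _ _ Z)
      have := hc hw
      rcases w with i | m | j
      · simpa [classicalWires, embFst] using this
      · simp [classicalWires, embFst] at this
      · simp [classicalWires, embFst] at this
    · exact fun _ _ _ => rfl
    · exact fun _ _ _ => rfl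
    · refine hρ.onWires (embSnd_injective X Y) (hY.1 _ _ _).map_zero
        (fun Z => hY.3 _ (fun w hw => ?_) _ _ _ Z)
      have := hc hw
      rcases w with i | m | j
      · simp [classicalWires, embSnd] at this
      · simp [classicalWires, embSnd] at this
      · simpa [classicalWires, embSnd] using this

theorem StrictlyValid.comp {X : Machine I J O} {Y : Machine J K O} (hX : X.StrictlyValid)
    (hY : Y.StrictlyValid) : (X ⋈ Y).StrictlyValid := by
  rw [comp_eq_compAt]
  exact hX.compAt hY _

/-- A machine without output, seen as one with outputs in `O`. -/
abbrev liftOut (O : Type) (X : Sys I J) : Machine I J O where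
  Mem := X.Mem
  Ctrl := X.Ctrl
  Out := X.Out
  init := X.init
  op := X.op
  next := fun q e a => ((X.next q e a).1.map Empty.elim, (X.next q e a).2)

theorem StrictlyValid.liftOut {X : Sys I J} (h : X.StrictlyValid) :
    (X.liftOut O).StrictlyValid :=
  ⟨h.1, h.2, h.3⟩

/-! ### Locality -/

/-- The operations of `X` are local operations on at most two wires. -/
theorem isElementary_of_embedding {X : Machine I J O}
    (h : ∀ q e, ∃ (V : Type) (_ : Fintype V) (f : V → X.Wire), f.Injective ∧
      Fintype.card V ≤ 2 ∧ ∀ a, ∃ Φ : Op V → Op V, X.op q e a = onWires f Φ) :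
    X.IsElementary := by
  classical
  intro q e
  obtain ⟨V, _, f, hf, hV, h⟩ := h q e
  refine ⟨Finset.univ.image f, ?_, fun a => ?_⟩
  · exact Finset.card_image_le.trans hV
  · obtain ⟨Φ, hΦ⟩ := h a
    let g : V → (Finset.univ.image f : Finset X.Wire) := fun v => ⟨f v, by simp⟩
    have hg : g.Injective := fun v w hvw => hf (congrArg Subtype.val hvw)
    refine ⟨onWires g Φ, ?_⟩
    rw [onWires_comp Subtype.val_injective hg, hΦ]
    rfl

theorem IsElementary.embedding {X : Machine I J O} (h : X.IsElementary) (q : X.Ctrl) (e : Entry) :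
    ∃ (V : Type) (_ : Fintype V) (f : V → X.Wire), f.Injective ∧
      Fintype.card V ≤ 2 ∧ ∀ a, ∃ Φ : Op V → Op V, X.op q e a = onWires f Φ := by
  obtain ⟨s, hs, h⟩ := h q e
  exact ⟨s, inferInstance, Subtype.val, Subtype.val_injective, by simpa using hs, h⟩

theorem IsElementary.compAt {X : Machine I J O} {Y : Machine J K O} (hX : X.IsElementary)
    (hY : Y.IsElementary) (f : Entry ⊕ Entry) : (X.compAt Y f).IsElementary := by
  refine isElementary_of_embedding fun q e => ?_
  show ∃ (V : Type) (_ : Fintype V) (g : V → _), g.Injective ∧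
      Fintype.card V ≤ 2 ∧ ∀ a, ∃ Φ, compOp X Y q.1 q.2.1 (focus q.2.2 e) a = onWires g Φ
  rcases focus q.2.2 e with e' | e'
  · obtain ⟨V, hV, g, hg, hc, hΦ⟩ := hX.embedding q.1 e'
    refine ⟨V, hV, embFst X Y ∘ g, (embFst_injective X Y).comp hg, hc, ?_⟩
    rintro (a | b)
    · obtain ⟨Φ, hΦ⟩ := hΦ a
      exact ⟨Φ, by rw [← onWires_comp (embFst_injective X Y) hg, ← hΦ]; rfl⟩
    · exact ⟨fun _ => 0, by rw [onWires_zero_map]; rfl⟩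
  · obtain ⟨V, hV, g, hg, hc, hΦ⟩ := hY.embedding q.2.1 e'
    refine ⟨V, hV, embSnd X Y ∘ g, (embSnd_injective X Y).comp hg, hc, ?_⟩
    rintro (a | b)
    · exact ⟨fun _ => 0, by rw [onWires_zero_map]; rfl⟩
    · obtain ⟨Φ, hΦ⟩ := hΦ b
      exact ⟨Φ, by rw [← onWires_comp (embSnd_injective X Y) hg, ← hΦ]; rfl⟩

/-- The whole set of wires always works; for an elementary machine a support with at most two wires
is chosen. -/
theorem exists_support (X : Machine I J O) (q : X.Ctrl) (e : Entry) :
    ∃ s : Set X.Wire, (X.IsElementary → s.ncard ≤ 2) ∧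
      ∀ a, ∃ Φ : Op s → Op s, X.op q e a = onWires (Subtype.val : s → X.Wire) Φ := by
  by_cases h : X.IsElementary
  · obtain ⟨s, hs, h'⟩ := h q e
    refine ⟨(s : Set X.Wire), fun _ => ?_, h'⟩
    rwa [Set.ncard_coe_finset]
  · refine ⟨Set.univ, fun h' => absurd h' h, fun a => ?_⟩
    let g : X.Wire → (Set.univ : Set X.Wire) := fun w => ⟨w, trivial⟩
    have hg : g.Injective := fun v w hvw => congrArg Subtype.val hvw
    refine ⟨onWires g (X.op q e a), ?_⟩
    rw [onWires_comp Subtype.val_injective hg]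
    exact (onWires_id _).symm

/-- The wires on which a step acts. -/
def support (X : Machine I J O) (q : X.Ctrl) (e : Entry) : Set X.Wire :=
  (X.exists_support q e).choose

theorem support_spec (X : Machine I J O) (q : X.Ctrl) (e : Entry) (a : X.Out) :
    ∃ Φ : Op (X.support q e) → Op (X.support q e), X.op q e a = onWires Subtype.val Φ :=
  (X.exists_support q e).choose_spec.2 a

/-- The machine which measures the classical wires it acts on before and after each step. -/
abbrev dephased (X : Machine I J O) : Machine I J O :=
  { X with
    op := fun q e a ρ => dephase (X.support q e ∩ X.classicalWires)
      (X.op q e a (dephase (X.support q e ∩ X.classicalWires) ρ)) }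

/-- A classical wire in the support is classical after the final measurement. A wire outside the
support is untouched, so it stays classical if it was so before. -/
theorem Valid.dephased {X : Machine I J O} (h : X.Valid) : X.dephased.StrictlyValid where
  completelyPositive q e a := (isCP_dephase _).comp ((h.1 q e a).comp (isCP_dephase _))
  tracePreserving q e ρ := by
    refine Eq.trans ?_ (trace_dephase (X.support q e ∩ X.classicalWires) ρ)
    rw [← h.2 q e]
    exact Finset.sum_congr rfl fun a _ => trace_dephase _ _
  classical := by
    rintro c hc q e a ρ hρ x y ⟨w, hw, hxy⟩
    by_cases hs : w ∈ X.support q e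
    · exact isClassicalOn_dephase _ _ x y ⟨w, ⟨hs, hc hw⟩, hxy⟩
    · have hρ' := hρ.dephase (X.support q e ∩ X.classicalWires)
      obtain ⟨Φ, hΦ⟩ := X.support_spec q e a
      have : X.op q e a (dephase (X.support q e ∩ X.classicalWires) ρ) x y = 0 := by
        rw [hΦ]
        refine onWires_apply_eq_zero ?_ (w := w) ?_ hxy fun x y h => hρ' x y ⟨w, hw, h⟩
        · rw [← hΦ]
          exact (h.1 q e a).map_zero
        · rintro ⟨v, hv⟩ rfl
          exact hs hv
      show dephase _ (X.op q e a (dephase _ ρ)) x y = 0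
      simp only [dephase, Matrix.of_apply] at this ⊢
      rw [this]
      simp

/-- Here it matters that only wires in the support are measured: the step still acts on at most two
wires. -/
theorem IsElementary.dephased {X : Machine I J O} (h : X.IsElementary) :
    X.dephased.IsElementary := by
  classical
  refine isElementary_of_embedding fun q e => ?_
  have hf : Fintype (X.support q e) := Fintype.ofFinite _
  refine ⟨X.support q e, hf, Subtype.val, Subtype.val_injective, ?_, fun a => ?_⟩
  · have : (X.support q e).ncard ≤ 2 := (X.exists_support q e).choose_spec.1 h
    rwa [Set.ncard_eq_toFinset_card', Set.toFinset_card] at this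
  · obtain ⟨Φ, hΦ⟩ := X.support_spec q e a
    let c : Set (X.support q e) := Subtype.val ⁻¹' X.classicalWires
    have hc : X.support q e ∩ X.classicalWires = Subtype.val '' c := by
      simp [c, Subtype.image_preimage_coe]
    refine ⟨fun Y => dephase c (Φ (dephase c Y)), ?_⟩
    funext ρ
    show dephase _ (X.op q e a (dephase _ ρ)) = _
    rw [hΦ, hc, onWires_dephase Subtype.val_injective, dephase_onWires]

theorem IsElementary.liftOut {X : Sys I J} (h : X.IsElementary) : (X.liftOut O).IsElementary :=
  h

/-! ### Time bounds -/

theorem moveFst_continues (m : Move O) : (moveFst m).1.Continues ↔ m.Continues := by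
  cases m <;> simp [moveFst, Move.Continues]

theorem moveSnd_continues (m : Move O) : (moveSnd m).1.Continues ↔ m.Continues := by
  cases m <;> simp [moveSnd, Move.Continues]

theorem RunsWithin.compAt {X : Machine I J O} {Y : Machine J K O} {N M : ℕ}
    (hX : X.RunsWithin N) (hY : Y.RunsWithin M) (f : Entry ⊕ Entry) :
    (X.compAt Y f).RunsWithin (N + M) := by
  obtain ⟨r, hr, hr'⟩ := hX
  obtain ⟨s, hs, hs'⟩ := hY
  -- Each step of the composition lowers the rank of exactly one component and leaves the other one
  -- alone.
  refine ⟨fun q => r q.1 + s q.2.1, Nat.add_le_add hr hs, ?_⟩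
  intro q e a h
  simp only at h ⊢
  revert h
  rcases focus q.2.2 e with e' | e' <;> rcases a with a | a <;> intro h
  · have := hr' _ _ _ ((moveFst_continues _).1 h)
    simp only [compNext]
    omega
  · exact h.elim
  · exact h.elim
  · have := hs' _ _ _ ((moveSnd_continues _).1 h)
    simp only [compNext]
    omega

theorem RunsWithin.dephased {X : Machine I J O} {N : ℕ} (h : X.RunsWithin N) :
    X.dephased.RunsWithin N := h

theorem Move.continues_map {O O' : Type} (f : O → O') (m : Move O) :
    (m.map f).Continues ↔ m.Continues := by
  cases m <;> simp [Move.map, Move.Continues]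

theorem RunsWithin.liftOut {X : Sys I J} {N : ℕ} (h : X.RunsWithin N) :
    (X.liftOut O).RunsWithin N := by
  obtain ⟨r, hr, hr'⟩ := h
  refine ⟨r, hr, fun q e a h => hr' q e a ?_⟩
  exact (Move.continues_map _ _).1 h

theorem RunsWithin.mono {X : Machine I J O} {N M : ℕ} (h : X.RunsWithin N) (hNM : N ≤ M) :
    X.RunsWithin M :=
  let ⟨r, hr, hr'⟩ := h
  ⟨r, hr.trans hNM, hr'⟩

theorem card_entry : Fintype.card Entry = 3 := rfl

theorem card_ctrl_compAt (X : Machine I J O) (Y : Machine J K O) (f : Entry ⊕ Entry) :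
    Fintype.card (X.compAt Y f).Ctrl = Fintype.card X.Ctrl * Fintype.card Y.Ctrl * 6 := by
  refine (Fintype.card_congr (Equiv.refl (X.Ctrl × Y.Ctrl × (Entry ⊕ Entry)))).trans ?_
  rw [Fintype.card_prod, Fintype.card_prod, Fintype.card_sum, card_entry, mul_assoc]

/-! ### Machines that agree on classical wires -/

/-- The classical wires of the interfaces, and the wires in `C` of the memory. -/
def markedWires (X : Machine I J O) (C : Set X.Mem) : Set X.Wire :=
  X.classicalWires ∪ {w | ∃ m ∈ C, w = .inr (.inl m)}

/-- `X'` is `X` with operations that agree with those of `X` on all states that are classical on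
the interfaces and on certain wires `C` of the memory; these states are preserved. -/
def ClassicallyEq (X X' : Machine I J O) : Prop :=
  ∃ (op' : X.Ctrl → Entry → X.Out → Op X.Wire → Op X.Wire) (C : Set X.Mem),
    X' = { X with op := op' } ∧ ∀ q e a, X.op q e a 0 = 0 ∧ op' q e a 0 = 0 ∧
      ∀ ρ, IsClassicalOn (X.markedWires C) ρ →
        IsClassicalOn (X.markedWires C) (X.op q e a ρ) ∧ op' q e a ρ = X.op q e a ρ

theorem markedWires_empty (X : Machine I J O) : X.markedWires ∅ = X.classicalWires := by
  simp [markedWires]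

theorem ClassicallyEq.refl {X : Machine I J O} (h0 : ∀ q e a, X.op q e a 0 = 0)
    (h : ∀ q e a ρ, IsClassicalOn X.classicalWires ρ →
      IsClassicalOn X.classicalWires (X.op q e a ρ)) : X.ClassicallyEq X := by
  refine ⟨X.op, ∅, rfl, fun q e a => ⟨h0 q e a, h0 q e a, fun ρ hρ => ⟨?_, rfl⟩⟩⟩
  rw [markedWires_empty] at hρ ⊢
  exact h q e a ρ hρ

theorem Valid.classicallyEq_self {X : Machine I J O} (h : X.Valid) : X.ClassicallyEq X :=
  .refl (fun q e a => (h.1 q e a).map_zero) h.3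

/-- Measuring wires that are already classical does nothing, and validity keeps them classical after
the step. -/
theorem Valid.classicallyEq_dephased {X : Machine I J O} (h : X.Valid) :
    X.ClassicallyEq X.dephased := by
  refine ⟨X.dephased.op, ∅, rfl, fun q e a => ⟨(h.1 q e a).map_zero,
    (h.dephased.1 q e a).map_zero, fun ρ hρ => ?_⟩⟩
  rw [markedWires_empty] at hρ ⊢
  refine ⟨h.3 q e a ρ hρ, ?_⟩
  show dephase _ (X.op q e a (dephase _ ρ)) = _
  rw [dephase_of_classical (hρ.mono Set.inter_subset_right),
    dephase_of_classical ((h.3 q e a ρ hρ).mono Set.inter_subset_right)]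

/-- The marked wires of the memory of a composition. -/
def compMarks (X : Machine I J O) (Y : Machine J K O) (C : Set X.Mem) (D : Set Y.Mem) :
    Set (X.Mem ⊕ J.Wire ⊕ Y.Mem) :=
  {w | (∃ m ∈ C, w = .inl m) ∨ (∃ j, w = .inr (.inl (.inl j))) ∨ ∃ m ∈ D, w = .inr (.inr m)}

theorem embFst_preimage (X : Machine I J O) (Y : Machine J K O) (C : Set X.Mem) (D : Set Y.Mem)
    (f : Entry ⊕ Entry) :
    embFst X Y ⁻¹' ((X.compAt Y f).markedWires (compMarks X Y C D)) = X.markedWires C := by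
  ext w
  rw [Set.mem_preimage]
  rcases w with (i | i) | m | (j | j) <;>
    simp [markedWires, classicalWires, compMarks, embFst]

theorem embSnd_preimage (X : Machine I J O) (Y : Machine J K O) (C : Set X.Mem) (D : Set Y.Mem)
    (f : Entry ⊕ Entry) :
    embSnd X Y ⁻¹' ((X.compAt Y f).markedWires (compMarks X Y C D)) = Y.markedWires D := by
  ext w
  rw [Set.mem_preimage]
  rcases w with (i | i) | m | (j | j) <;>
    simp [markedWires, classicalWires, compMarks, embSnd]

theorem onWires_eq_of_classical {V W : Type} {e : V → W} (he : e.Injective) {Φ Ψ : Op V → Op V}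
    {c : Set W} (h : ∀ Y, IsClassicalOn (e ⁻¹' c) Y → Φ Y = Ψ Y) {X : Op W}
    (hX : IsClassicalOn c X) : onWires e Φ X = onWires e Ψ X := by
  ext x y
  simp only [onWires, Matrix.of_apply]
  rw [h]
  rintro a b ⟨u, hu, hab⟩
  refine hX _ _ ⟨e u, hu, ?_⟩
  rwa [he.extend_apply, he.extend_apply]

theorem compOp_zero {X : Machine I J O} {Y : Machine J K O} (hX : ∀ q e a, X.op q e a 0 = 0)
    (hY : ∀ q e a, Y.op q e a 0 = 0) (x : X.Ctrl) (y : Y.Ctrl) (f : Entry ⊕ Entry)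
    (c : X.Out ⊕ Y.Out) : compOp X Y x y f c 0 = 0 := by
  rcases f with e | e <;> rcases c with a | b
  · exact onWires_map_zero (hX _ _ _)
  · rfl
  · rfl
  · exact onWires_map_zero (hY _ _ _)

/-- The inner classical wires are added to the marked wires of the memory (`compMarks`). Seen from
either component, the marked wires of the composition are then exactly those of the component. -/
theorem ClassicallyEq.compAt {X X' : Machine I J O} {Y Y' : Machine J K O}
    (hX : X.ClassicallyEq X') (hY : Y.ClassicallyEq Y') (f : Entry ⊕ Entry) :
    (X.compAt Y f).ClassicallyEq (X'.compAt Y' f) := by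
  obtain ⟨opX, C, rfl, hX⟩ := hX
  obtain ⟨opY, D, rfl, hY⟩ := hY
  refine ⟨(Machine.compAt { X with op := opX } { Y with op := opY } f).op,
    compMarks X Y C D, rfl, fun q e a => ⟨?_, ?_, fun ρ hρ => ?_⟩⟩
  · exact compOp_zero (fun q e a => (hX q e a).1) (fun q e a => (hY q e a).1) _ _ _ _
  · exact compOp_zero (X := { X with op := opX }) (Y := { Y with op := opY })
      (fun q e a => (hX q e a).2.1) (fun q e a => (hY q e a).2.1) _ _ _ _
  · have e1 := embFst_preimage X Y C D f
    have e2 := embSnd_preimage X Y C D f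
    have h1 : embFst { X with op := opX } { Y with op := opY } = embFst X Y := by
      funext w
      rcases w with i | m | j <;> rfl
    have h2 : embSnd { X with op := opX } { Y with op := opY } = embSnd X Y := by
      funext w
      rcases w with i | m | j <;> rfl
    show IsClassicalOn _ (compOp X Y q.1 q.2.1 (focus q.2.2 e) a ρ) ∧
      compOp { X with op := opX } { Y with op := opY } q.1 q.2.1 (focus q.2.2 e) a ρ =
        compOp X Y q.1 q.2.1 (focus q.2.2 e) a ρ
    rcases focus q.2.2 e with e' | e' <;> rcases a with a | a
    · constructor
      · refine IsClassicalOn.onWires (embFst_injective X Y) (hX _ _ _).1 (fun Z hZ => ?_) hρ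
        rw [e1] at hZ ⊢
        exact ((hX _ _ _).2.2 Z hZ).1
      · show onWires (embFst { X with op := opX } { Y with op := opY }) (opX q.1 e' a) ρ =
          onWires (embFst X Y) (X.op q.1 e' a) ρ
        rw [h1]
        refine onWires_eq_of_classical (embFst_injective X Y) (fun Z hZ => ?_) hρ
        rw [e1] at hZ
        exact ((hX _ _ _).2.2 Z hZ).2
    · exact ⟨fun _ _ _ => rfl, rfl⟩
    · exact ⟨fun _ _ _ => rfl, rfl⟩
    · constructor
      · refine IsClassicalOn.onWires (embSnd_injective X Y) (hY _ _ _).1 (fun Z hZ => ?_) hρ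
        rw [e2] at hZ ⊢
        exact ((hY _ _ _).2.2 Z hZ).1
      · show onWires (embSnd { X with op := opX } { Y with op := opY }) (opY q.2.1 e' a) ρ =
          onWires (embSnd X Y) (Y.op q.2.1 e' a) ρ
        rw [h2]
        refine onWires_eq_of_classical (embSnd_injective X Y) (fun Z hZ => ?_) hρ
        rw [e2] at hZ
        exact ((hY _ _ _).2.2 Z hZ).2

theorem ClassicallyEq.comp {X X' : Machine I J O} {Y Y' : Machine J K O}
    (hX : X.ClassicallyEq X') (hY : Y.ClassicallyEq Y') : (X ⋈ Y).ClassicallyEq (X' ⋈ Y') := by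
  rw [comp_eq_compAt, comp_eq_compAt]
  exact hX.compAt hY _

theorem ClassicallyEq.liftOut {X X' : Sys I J} (h : X.ClassicallyEq X') :
    (X.liftOut O).ClassicallyEq (X'.liftOut O) := by
  obtain ⟨op', C, rfl, h⟩ := h
  exact ⟨op', C, rfl, h⟩

end Machine

open Machine

section Ring

variable {I J : Iface} {O : Type}

theorem embEnv_injective (D : Machine J I O) (R : Sys I J) : (embEnv D R).Injective := by
  rintro (i | m | j) (i' | m' | j') h <;> simp_all [embEnv]

/-- The marked wires of a ring. -/
def ringMarks (D : Machine J I O) (R : Sys I J) (C : Set D.Mem) (C' : Set R.Mem) :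
    Set (RingWire D R) :=
  {w | (∃ v ∈ R.markedWires C', w = .inl v) ∨ ∃ m ∈ C, w = .inr m}

theorem embEnv_preimage (D : Machine J I O) (R : Sys I J) (C : Set D.Mem) (C' : Set R.Mem) :
    embEnv D R ⁻¹' (ringMarks D R C C') = D.markedWires C := by
  ext w
  rcases w with (i | i) | m | (j | j) <;>
    simp [ringMarks, markedWires, classicalWires, embEnv]

theorem inl_preimage (D : Machine J I O) (R : Sys I J) (C : Set D.Mem) (C' : Set R.Mem) :
    (Sum.inl : R.Wire → RingWire D R) ⁻¹' (ringMarks D R C C') = R.markedWires C' := by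
  ext w
  rw [Set.mem_preimage]
  constructor
  · rintro (⟨v, hv, h⟩ | ⟨m, _, h⟩)
    · cases h
      exact hv
    · cases h
  · exact fun h => .inl ⟨w, h, rfl⟩

/-- Every state that is reached is classical on the marked wires of the ring, and there the old and
the new operations agree. The control is shared, so the two runs branch in the same way. -/
theorem run_withOp [DecidableEq O] (D : Machine J I O) (R : Sys I J) (C : Set D.Mem) (C' : Set R.Mem)
    (opD : D.Ctrl → Entry → D.Out → Op D.Wire → Op D.Wire)
    (opR : R.Ctrl → Entry → R.Out → Op R.Wire → Op R.Wire)
    (hD : ∀ q e a, D.op q e a 0 = 0 ∧ opD q e a 0 = 0 ∧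
      ∀ ρ, IsClassicalOn (D.markedWires C) ρ →
        IsClassicalOn (D.markedWires C) (D.op q e a ρ) ∧ opD q e a ρ = D.op q e a ρ)
    (hR : ∀ q e a, R.op q e a 0 = 0 ∧ opR q e a 0 = 0 ∧
      ∀ ρ, IsClassicalOn (R.markedWires C') ρ →
        IsClassicalOn (R.markedWires C') (R.op q e a ρ) ∧ opR q e a ρ = R.op q e a ρ)
    (t : ℕ) (f : Entry ⊕ Entry) (p : D.Ctrl) (q : R.Ctrl) (ρ : Op (RingWire D R)) (o : O)
    (hρ : IsClassicalOn (ringMarks D R C C') ρ) :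
    run { D with op := opD } { R with op := opR } t f p q ρ o = run D R t f p q ρ o := by
  have eD := embEnv_preimage D R C C'
  have eR := inl_preimage D R C C'
  have hD1 : ∀ q e a ρ, IsClassicalOn (ringMarks D R C C') ρ →
      IsClassicalOn (ringMarks D R C C') (onWires (embEnv D R) (D.op q e a) ρ) :=
    fun q e a ρ hρ => hρ.onWires (embEnv_injective D R) (hD q e a).1
      fun Z hZ => eD ▸ ((hD q e a).2.2 Z (eD ▸ hZ)).1
  have hemb : embEnv { D with op := opD } { R with op := opR } = embEnv D R := by
    funext w
    rcases w with i | m | j <;> rfl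
  have hD2 : ∀ q e a ρ, IsClassicalOn (ringMarks D R C C') ρ →
      onWires (embEnv { D with op := opD } { R with op := opR }) (opD q e a) ρ =
        onWires (embEnv D R) (D.op q e a) ρ := by
    intro q e a ρ hρ
    rw [hemb]
    exact onWires_eq_of_classical (embEnv_injective D R)
      (fun Z hZ => ((hD q e a).2.2 Z (eD ▸ hZ)).2) hρ
  have hR1 : ∀ q e a ρ, IsClassicalOn (ringMarks D R C C') ρ →
      IsClassicalOn (ringMarks D R C C') (onWires Sum.inl (R.op q e a) ρ) :=
    fun q e a ρ hρ => hρ.onWires Sum.inl_injective (hR q e a).1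
      fun Z hZ => eR ▸ ((hR q e a).2.2 Z (eR ▸ hZ)).1
  have hR2 : ∀ q e a ρ, IsClassicalOn (ringMarks D R C C') ρ →
      onWires (Sum.inl : R.Wire → RingWire D R) (opR q e a) ρ =
        onWires Sum.inl (R.op q e a) ρ :=
    fun q e a ρ hρ => onWires_eq_of_classical Sum.inl_injective
      (fun Z hZ => ((hR q e a).2.2 Z (eR ▸ hZ)).2) hρ
  induction t generalizing f p q ρ with
  | zero => cases f <;> rfl
  | succ t ih =>
    rcases f with e | e
    · refine Finset.sum_congr rfl fun a _ => ?_
      dsimp only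
      have e1 := hD2 p e a ρ hρ
      have e2 := hD1 p e a ρ hρ
      rcases D.next p e a with ⟨_ | _ | _ | o' | _, p'⟩
      · exact (congrArg (fun z => run { D with op := opD } { R with op := opR } t _ _ _ z o)
          e1).trans (ih _ _ _ _ e2)
      · exact (congrArg (fun z => run { D with op := opD } { R with op := opR } t _ _ _ z o)
          e1).trans (ih _ _ _ _ e2)
      · exact (congrArg (fun z => run { D with op := opD } { R with op := opR } t _ _ _ z o)
          e1).trans (ih _ _ _ _ e2)
      · show (if o' = o then _ else _) = _
        exact congrArg (fun z => if o' = o then z else 0) e1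
      · rfl
    · refine Finset.sum_congr rfl fun a _ => ?_
      dsimp only
      have e1 := hR2 q e a ρ hρ
      have e2 := hR1 q e a ρ hρ
      rcases R.next q e a with ⟨_ | _ | _ | o' | _, q'⟩
      · exact (congrArg (fun z => run { D with op := opD } { R with op := opR } t _ _ _ z o)
          e1).trans (ih _ _ _ _ e2)
      · exact (congrArg (fun z => run { D with op := opD } { R with op := opR } t _ _ _ z o)
          e1).trans (ih _ _ _ _ e2)
      · exact (congrArg (fun z => run { D with op := opD } { R with op := opR } t _ _ _ z o)
          e1).trans (ih _ _ _ _ e2)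
      · exact o'.elim
      · rfl

theorem isClassicalOn_zeroState {W : Type} [Fintype W] [DecidableEq W] (c : Set W) :
    IsClassicalOn c (zeroState W) := by
  rintro x y ⟨w, _, hxy⟩
  rw [zeroState, Matrix.single_apply, if_neg]
  rintro ⟨rfl, rfl⟩
  exact hxy rfl

/-- The probability that the distinguisher accepts within `t` steps. -/
def acceptWithin (D : Machine J I Bool) (R : Sys I J) (t : ℕ) : ℝ :=
  ((finalState D R t true).trace).re

theorem acceptWithin_congr {D D' : Machine J I Bool} {R R' : Sys I J} (hD : D.ClassicallyEq D')
    (hR : R.ClassicallyEq R') (t : ℕ) : acceptWithin D R t = acceptWithin D' R' t := by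
  obtain ⟨opD, C, rfl, hD⟩ := hD
  obtain ⟨opR, C', rfl, hR⟩ := hR
  have := run_withOp D R C C' opD opR hD hR t (.inl .resume) D.init R.init (zeroState _) true
    (isClassicalOn_zeroState _)
  exact congrArg (fun X : Op (RingWire D R) => X.trace.re) this.symm

theorem project_zero {W : Type} (s : Set (W → Bool)) {_ : DecidablePred (· ∈ s)} :
    project s (0 : Op W) = 0 := by
  ext x y
  simp [project]

theorem IsClassicalOn.project {W : Type} {c : Set W} {X : Op W} (h : IsClassicalOn c X)
    (s : Set (W → Bool)) {_ : DecidablePred (· ∈ s)} : IsClassicalOn c (project s X) := by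
  intro x y hxy
  simp [RSP.project, h x y hxy]

/-- The repeated clauses match the hypothesis of `run_withOp` with unchanged operations of the
collector. -/
theorem collector_preserves (c q c' q' : ℕ) (p : (collector c q c' q').Ctrl) (e : Entry)
    (a : (collector c q c' q').Out) : (collector c q c' q').op p e a 0 = 0 ∧
      (collector c q c' q').op p e a 0 = 0 ∧
      ∀ ρ, IsClassicalOn ((collector c q c' q').markedWires ∅) ρ →
        IsClassicalOn ((collector c q c' q').markedWires ∅) ((collector c q c' q').op p e a ρ) ∧
        (collector c q c' q').op p e a ρ = (collector c q c' q').op p e a ρ := by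
  have h0 : (collector c q c' q').op p e a 0 = 0 := by
    rcases e with _ | _ | _ <;> rcases a with _ | _ <;> dsimp only [collector] <;>
      first | rfl | exact project_zero _
  refine ⟨h0, h0, fun ρ h => ⟨?_, rfl⟩⟩
  rcases e with _ | _ | _ <;> rcases a with _ | _ <;> dsimp only [collector] <;>
    first | exact h | exact fun (_ _ : _ → Bool) _ => rfl | exact h.project _

theorem outputState_congr {c q c' q' : ℕ} {Z Z' : Sys (outIface c q) (outIface c' q')}
    (h : Z.ClassicallyEq Z') (t : ℕ) : outputState Z t = outputState Z' t := by
  obtain ⟨opR, C', rfl, hR⟩ := h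
  have := run_withOp _ Z ∅ C' _ opR (collector_preserves c q c' q') hR t (.inl .resume) (collector c q c' q').init Z.init
    (zeroState _) () (isClassicalOn_zeroState _)
  exact congrArg (fun X : Op (RingWire (collector c q c' q') Z) =>
    marginal (messageWires Z) X) this.symm

end Ring

/-! ### Rings of machines on a common set of wires -/

/-- A machine which acts on the wires `W`; its output is a payoff, a function of the final
state. -/
structure Node (W : Type) where
  Ctrl : Type
  Out : Type
  [outFintype : Fintype Out]
  op : Ctrl → Entry → Out → Op W → Op W
  next : Ctrl → Entry → Out → Move (Op W → ℝ) × Ctrl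

attribute [instance] Node.outFintype

/-- A node together with its control state. -/
structure NodeState (W : Type) where
  node : Node W
  ctrl : node.Ctrl

section Flat

variable {W : Type}

/-- The ring seen from the right neighbour of the active node `s`, where `rest` lists the other
nodes from left to right. -/
def goRight (s : NodeState W) : List (NodeState W) → NodeState W × List (NodeState W)
  | [] => (s, [])
  | m :: l => (m, l ++ [s])

/-- The ring seen from the left neighbour of the active node. -/
def goLeft (s : NodeState W) (rest : List (NodeState W)) : NodeState W × List (NodeState W) :=
  match rest.reverse with
  | [] => (s, [])
  | m :: l => (m, s :: l.reverse)

@[simp] theorem goLeft_concat (s m : NodeState W) (l : List (NodeState W)) :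
    goLeft s (l ++ [m]) = (m, s :: l) := by
  simp [goLeft]

/-- The payoff after a move to the control state `p.2`, if `F` gives the payoffs of later
activations. -/
def afterMove (F : Entry → NodeState W → List (NodeState W) → Op W → ℝ) (N : Node W)
    (rest : List (NodeState W)) (ρ : Op W) (p : Move (Op W → ℝ) × N.Ctrl) : ℝ :=
  match p.1 with
  | .toLeft => F .fromRight (goLeft ⟨N, p.2⟩ rest).1 (goLeft ⟨N, p.2⟩ rest).2 ρ
  | .toRight => F .fromLeft (goRight ⟨N, p.2⟩ rest).1 (goRight ⟨N, p.2⟩ rest).2 ρ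
  | .stay => F .resume ⟨N, p.2⟩ rest ρ
  | .halt g => g ρ
  | .hang => 0

/-- The expected payoff within `t` steps of a ring of nodes, when `s` is activated with entry `e`
and the nodes to its right are `rest`, up to the left neighbour of `s`. -/
def ringValue : ℕ → Entry → NodeState W → List (NodeState W) → Op W → ℝ
  | 0, _, _, _, _ => 0
  | t + 1, e, s, rest, ρ => ∑ a : s.node.Out,
      afterMove (ringValue t) s.node rest (s.node.op s.ctrl e a ρ) (s.node.next s.ctrl e a)

/-- The operations of a composition of nodes. -/
def Node.compOp (X Y : Node W) (x : X.Ctrl) (y : Y.Ctrl) :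
    Entry ⊕ Entry → X.Out ⊕ Y.Out → Op W → Op W
  | .inl e, .inl a => X.op x e a
  | .inr e, .inr b => Y.op y e b
  | _, _ => fun _ => 0

/-- The composition of nodes. -/
abbrev Node.comp (X Y : Node W) : Node W where
  Ctrl := X.Ctrl × Y.Ctrl × (Entry ⊕ Entry)
  Out := X.Out ⊕ Y.Out
  op := fun q e c => Node.compOp X Y q.1 q.2.1 (focus q.2.2 e) c
  next := fun q e c => compNext X.next Y.next q (focus q.2.2 e) c

/-- Here and in the next two lemmas, `F` stands for `ringValue t`, and `hF`, `hF'` are the two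
halves of the induction hypothesis of `ringValue_comp_aux`: the composition is active, or it is one
of the waiting nodes. -/
theorem afterMove_fst (F : Entry → NodeState W → List (NodeState W) → Op W → ℝ)
    (X Y : Node W) (rest : List (NodeState W)) (y : Y.Ctrl) (ρ : Op W)
    (hF : ∀ e x y f rest ρ, F e ⟨X.comp Y, (x, y, f)⟩ rest ρ =
      match focus f e with
      | .inl e' => F e' ⟨X, x⟩ (⟨Y, y⟩ :: rest) ρ
      | .inr e' => F e' ⟨Y, y⟩ (rest ++ [⟨X, x⟩]) ρ)
    (hF' : ∀ e s L x y f R ρ, F e s (L ++ ⟨X.comp Y, (x, y, f)⟩ :: R) ρ =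
      F e s (L ++ ⟨X, x⟩ :: ⟨Y, y⟩ :: R) ρ) (m : Move (Op W → ℝ)) (x : X.Ctrl) :
    afterMove F (X.comp Y) rest ρ ((moveFst m).1, (x, y, (moveFst m).2)) =
      afterMove F X (⟨Y, y⟩ :: rest) ρ (m, x) := by
  cases m with
  | toLeft =>
    rcases List.eq_nil_or_concat rest with rfl | ⟨L, m, rfl⟩
    · exact hF _ _ _ _ _ _
    · have h1 : goLeft ⟨X, x⟩ (⟨Y, y⟩ :: (L ++ [m])) = (m, ⟨X, x⟩ :: ⟨Y, y⟩ :: L) :=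
        goLeft_concat _ _ (⟨Y, y⟩ :: L)
      simp only [afterMove, moveFst, List.concat_eq_append, h1, goLeft_concat]
      exact hF' _ _ [] _ _ _ _ _
  | toRight => exact hF _ _ _ _ _ _
  | stay => exact hF _ _ _ _ _ _
  | halt g => rfl
  | hang => rfl

theorem afterMove_snd (F : Entry → NodeState W → List (NodeState W) → Op W → ℝ)
    (X Y : Node W) (rest : List (NodeState W)) (x : X.Ctrl) (ρ : Op W)
    (hF : ∀ e x y f rest ρ, F e ⟨X.comp Y, (x, y, f)⟩ rest ρ =
      match focus f e with
      | .inl e' => F e' ⟨X, x⟩ (⟨Y, y⟩ :: rest) ρ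
      | .inr e' => F e' ⟨Y, y⟩ (rest ++ [⟨X, x⟩]) ρ)
    (hF' : ∀ e s L x y f R ρ, F e s (L ++ ⟨X.comp Y, (x, y, f)⟩ :: R) ρ =
      F e s (L ++ ⟨X, x⟩ :: ⟨Y, y⟩ :: R) ρ) (m : Move (Op W → ℝ)) (y : Y.Ctrl) :
    afterMove F (X.comp Y) rest ρ ((moveSnd m).1, (x, y, (moveSnd m).2)) =
      afterMove F Y (rest ++ [⟨X, x⟩]) ρ (m, y) := by
  cases m with
  | toLeft =>
    simp only [afterMove, moveSnd, goLeft_concat]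
    exact hF _ _ _ _ _ _
  | toRight =>
    rcases rest with _ | ⟨m, l⟩
    · exact hF _ _ _ _ _ _
    · simp only [afterMove, moveSnd, goRight, List.cons_append, List.append_assoc,
        List.nil_append]
      exact hF' _ _ _ _ _ _ [] _
  | stay => exact hF _ _ _ _ _ _
  | halt g => rfl
  | hang => rfl

theorem afterMove_rest (F : Entry → NodeState W → List (NodeState W) → Op W → ℝ)
    (X Y N : Node W) (L R : List (NodeState W)) (x : X.Ctrl) (y : Y.Ctrl) (f : Entry ⊕ Entry)
    (ρ : Op W)
    (hF : ∀ e x y f rest ρ, F e ⟨X.comp Y, (x, y, f)⟩ rest ρ =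
      match focus f e with
      | .inl e' => F e' ⟨X, x⟩ (⟨Y, y⟩ :: rest) ρ
      | .inr e' => F e' ⟨Y, y⟩ (rest ++ [⟨X, x⟩]) ρ)
    (hF' : ∀ e s L x y f R ρ, F e s (L ++ ⟨X.comp Y, (x, y, f)⟩ :: R) ρ =
      F e s (L ++ ⟨X, x⟩ :: ⟨Y, y⟩ :: R) ρ) (p : Move (Op W → ℝ) × N.Ctrl) :
    afterMove F N (L ++ ⟨X.comp Y, (x, y, f)⟩ :: R) ρ p =
      afterMove F N (L ++ ⟨X, x⟩ :: ⟨Y, y⟩ :: R) ρ p := by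
  obtain ⟨m, c⟩ := p
  cases m with
  | toLeft =>
    rcases List.eq_nil_or_concat R with rfl | ⟨R, m, rfl⟩
    · have h1 : goLeft ⟨N, c⟩ (L ++ [⟨X, x⟩, ⟨Y, y⟩]) = (⟨Y, y⟩, ⟨N, c⟩ :: (L ++ [⟨X, x⟩])) := by
        have := goLeft_concat ⟨N, c⟩ ⟨Y, y⟩ (L ++ [⟨X, x⟩])
        simpa using this
      simp only [afterMove, goLeft_concat, h1]
      exact hF _ _ _ _ _ _
    · have h1 : ∀ s t : NodeState W, ∀ l, goLeft s (L ++ t :: (l ++ [m])) =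
          (m, s :: (L ++ t :: l)) := by
        intro s t l
        have := goLeft_concat s m (L ++ t :: l)
        simpa using this
      have h2 := h1 ⟨N, c⟩ ⟨X, x⟩ (⟨Y, y⟩ :: R)
      simp only [List.cons_append] at h2
      simp only [afterMove, List.concat_eq_append, h1, h2]
      exact hF' _ _ (_ :: L) _ _ _ _ _
  | toRight =>
    rcases L with _ | ⟨m, l⟩
    · exact hF _ _ _ _ _ _
    · simp only [afterMove, goRight, List.cons_append, List.append_assoc]
      exact hF' _ _ _ _ _ _ _ _
  | stay => exact hF' _ _ _ _ _ _ _ _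
  | halt g => rfl
  | hang => rfl

/-- Both halves are proved together, since a move may turn the active composition into a waiting one
and conversely. The number of steps is the same on both sides because inner moves of a composition
count as steps. -/
theorem ringValue_comp_aux (X Y : Node W) (t : ℕ) :
    (∀ e x y f rest ρ, ringValue t e ⟨X.comp Y, (x, y, f)⟩ rest ρ =
      match focus f e with
      | .inl e' => ringValue t e' ⟨X, x⟩ (⟨Y, y⟩ :: rest) ρ
      | .inr e' => ringValue t e' ⟨Y, y⟩ (rest ++ [⟨X, x⟩]) ρ) ∧
    ∀ e s L x y f R ρ, ringValue t e s (L ++ ⟨X.comp Y, (x, y, f)⟩ :: R) ρ =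
      ringValue t e s (L ++ ⟨X, x⟩ :: ⟨Y, y⟩ :: R) ρ := by
  induction t with
  | zero =>
    refine ⟨fun e x y f rest ρ => ?_, fun _ _ _ _ _ _ _ _ => rfl⟩
    cases focus f e <;> rfl
  | succ t ih =>
    refine ⟨fun e x y f rest ρ => ?_, fun e s L x y f R ρ => ?_⟩
    · have h : ringValue (t + 1) e ⟨X.comp Y, (x, y, f)⟩ rest ρ =
          ∑ c : X.Out ⊕ Y.Out, afterMove (ringValue t) (X.comp Y) rest
            (Node.compOp X Y x y (focus f e) c ρ)
            (compNext X.next Y.next (x, y, f) (focus f e) c) := rfl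
      rw [h, Fintype.sum_sum_type]
      rcases focus f e with e' | e'
      · refine (congrArg (_ + ·) (Finset.sum_eq_zero fun b _ => rfl)).trans
          ((add_zero _).trans ?_)
        exact Finset.sum_congr rfl fun a _ => afterMove_fst _ X Y rest y _ ih.1 ih.2 _ _
      · refine (congrArg (· + _) (Finset.sum_eq_zero fun b _ => rfl)).trans
          ((zero_add _).trans ?_)
        exact Finset.sum_congr rfl fun a _ => afterMove_snd _ X Y rest x _ ih.1 ih.2 _ _
    · exact Finset.sum_congr rfl fun a _ => afterMove_rest _ X Y _ L R x y f _ ih.1 ih.2 _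

/-- A composition in a ring may be replaced by its two components. -/
theorem ringValue_comp (t : ℕ) (e : Entry) (s : NodeState W) (L : List (NodeState W))
    (X Y : Node W) (x : X.Ctrl) (y : Y.Ctrl) (f : Entry ⊕ Entry) (R : List (NodeState W))
    (ρ : Op W) : ringValue t e s (L ++ ⟨X.comp Y, (x, y, f)⟩ :: R) ρ =
      ringValue t e s (L ++ ⟨X, x⟩ :: ⟨Y, y⟩ :: R) ρ :=
  (ringValue_comp_aux X Y t).2 _ _ _ _ _ _ _ _

theorem ringValue_comp_fst (t : ℕ) (e : Entry) (X Y : Node W) (x : X.Ctrl) (y : Y.Ctrl)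
    (rest : List (NodeState W)) (ρ : Op W) :
    ringValue t .resume ⟨X.comp Y, (x, y, .inl e)⟩ rest ρ =
      ringValue t e ⟨X, x⟩ (⟨Y, y⟩ :: rest) ρ :=
  (ringValue_comp_aux X Y t).1 _ _ _ _ _ _

theorem ringValue_comp_snd (t : ℕ) (e : Entry) (X Y : Node W) (x : X.Ctrl) (y : Y.Ctrl)
    (rest : List (NodeState W)) (ρ : Op W) :
    ringValue t .resume ⟨X.comp Y, (x, y, .inr e)⟩ rest ρ =
      ringValue t e ⟨Y, y⟩ (rest ++ [⟨X, x⟩]) ρ :=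
  (ringValue_comp_aux X Y t).1 _ _ _ _ _ _

end Flat

/-! ### Machines as nodes -/

section Nodes

variable {I J K : Iface} {O : Type} {W W' : Type}

/-- The control of `X`, with operations `act` and payoffs `pay`. -/
abbrev Machine.nodeWith (X : Machine I J O) (act : X.Ctrl → Entry → X.Out → Op W → Op W)
    (pay : O → Op W → ℝ) : Node W where
  Ctrl := X.Ctrl
  Out := X.Out
  op := act
  next := fun q e a => ((X.next q e a).1.map pay, (X.next q e a).2)

/-- The machine `X`, acting on the wires `f w`, as a node. -/
abbrev Machine.node (X : Machine I J O) (f : X.Wire → W) (pay : O → Op W → ℝ) : Node W :=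
  X.nodeWith (fun q e a => onWires f (X.op q e a)) pay

theorem moveFst_map {O' : Type} (g : O → O') (m : Move O) :
    moveFst (m.map g) = ((moveFst m).1.map g, (moveFst m).2) := by
  cases m <;> rfl

theorem moveSnd_map {O' : Type} (g : O → O') (m : Move O) :
    moveSnd (m.map g) = ((moveSnd m).1.map g, (moveSnd m).2) := by
  cases m <;> rfl

theorem nodeState_compAt (X : Machine I J O) (Y : Machine J K O) (f : Entry ⊕ Entry)
    {emb : (X.compAt Y f).Wire → W} (he : emb.Injective) (pay : O → Op W → ℝ)
    (c : (X.compAt Y f).Ctrl) :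
    (⟨(X.compAt Y f).node emb pay, c⟩ : NodeState W) =
      ⟨(X.node (emb ∘ embFst X Y) pay).comp (Y.node (emb ∘ embSnd X Y) pay), c⟩ := by
  have h1 : (fun (q : X.Ctrl × Y.Ctrl × (Entry ⊕ Entry)) (e : Entry) (c : X.Out ⊕ Y.Out) =>
      onWires emb (compOp X Y q.1 q.2.1 (focus q.2.2 e) c)) = fun q e c =>
      Node.compOp (X.node (emb ∘ embFst X Y) pay) (Y.node (emb ∘ embSnd X Y) pay) q.1 q.2.1
        (focus q.2.2 e) c := by
    funext q e c
    rcases focus q.2.2 e with e' | e' <;> rcases c with a | b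
    · exact onWires_comp he (embFst_injective X Y) _
    · exact onWires_zero_map _
    · exact onWires_zero_map _
    · exact onWires_comp he (embSnd_injective X Y) _
  have h2 : (fun (q : X.Ctrl × Y.Ctrl × (Entry ⊕ Entry)) (e : Entry) (c : X.Out ⊕ Y.Out) =>
      ((compNext X.next Y.next q (focus q.2.2 e) c).1.map pay,
        (compNext X.next Y.next q (focus q.2.2 e) c).2)) = fun q e c =>
      compNext (X.node (emb ∘ embFst X Y) pay).next (Y.node (emb ∘ embSnd X Y) pay).next q
        (focus q.2.2 e) c := by
    funext q e c
    rcases focus q.2.2 e with e' | e' <;> rcases c with a | b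
    · simp only [compNext, moveFst_map]
    · rfl
    · rfl
    · simp only [compNext, moveSnd_map]
  exact congrArg₂ (fun op nx => (⟨⟨X.Ctrl × Y.Ctrl × (Entry ⊕ Entry), X.Out ⊕ Y.Out, op, nx⟩, c⟩ :
    NodeState W)) h1 h2

theorem nodeState_liftOut (X : Sys I J) (emb : X.Wire → W) (pay : O → Op W → ℝ) (c : X.Ctrl) :
    (⟨(X.liftOut O).node emb pay, c⟩ : NodeState W) = ⟨X.node emb Empty.elim, c⟩ := by
  have : (fun (q : X.Ctrl) (e : Entry) (a : X.Out) =>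
      (((X.next q e a).1.map (Empty.elim : Empty → O)).map pay, (X.next q e a).2)) =
      fun q e a => ((X.next q e a).1.map Empty.elim, (X.next q e a).2) := by
    funext q e a
    rcases (X.next q e a).1 with _ | _ | _ | o | _
    · rfl
    · rfl
    · rfl
    · exact o.elim
    · rfl
  exact congrArg (fun nx => (⟨⟨X.Ctrl, X.Out, fun q e a => onWires emb (X.op q e a), nx⟩, c⟩ :
    NodeState W)) this

/-- The values of runs in a ring of two machines. -/
theorem run_eq_ringValue [DecidableEq O] (D : Machine J I O) (R : Sys I J)
    (L : Op (RingWire D R) →+ ℝ) (o : O) (t : ℕ) (f : Entry ⊕ Entry) (p : D.Ctrl) (q : R.Ctrl)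
    (ρ : Op (RingWire D R)) :
    L (run D R t f p q ρ o) =
      match f with
      | .inl e => ringValue t e ⟨D.node (embEnv D R) (fun o' ρ => if o' = o then L ρ else 0), p⟩
          [⟨R.node Sum.inl Empty.elim, q⟩] ρ
      | .inr e => ringValue t e ⟨R.node Sum.inl Empty.elim, q⟩
          [⟨D.node (embEnv D R) (fun o' ρ => if o' = o then L ρ else 0), p⟩] ρ := by
  induction t generalizing f p q ρ with
  | zero =>
    rcases f with e | e
    · exact map_zero L
    · exact map_zero L
  | succ t ih =>
    rcases f with e | e
    · simp only [run, ringValue, map_sum]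
      refine Finset.sum_congr rfl fun a _ => ?_
      rcases D.next p e a with ⟨_ | _ | _ | o' | _, p'⟩
      · exact ih _ _ _ _
      · exact ih _ _ _ _
      · exact ih _ _ _ _
      · simp only [Move.map, afterMove]
        split_ifs
        · rfl
        · exact map_zero L
      · exact map_zero L
    · simp only [run, ringValue, map_sum]
      refine Finset.sum_congr rfl fun a _ => ?_
      rcases R.next q e a with ⟨_ | _ | _ | o' | _, q'⟩
      · exact ih _ _ _ _
      · exact ih _ _ _ _
      · exact ih _ _ _ _
      · exact o'.elim
      · exact map_zero L

/-- The nodes `s` and `s'` have the same control, and `s'` simulates `s` along `F` on the states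
that satisfy `P`. -/
inductive NodeSim (F : Op W → Op W') (P : Op W → Prop) : NodeState W → NodeState W' → Prop
  | intro {I J : Iface} {O : Type} (X : Machine I J O)
      (act : X.Ctrl → Entry → X.Out → Op W → Op W)
      (act' : X.Ctrl → Entry → X.Out → Op W' → Op W') (pay : O → Op W → ℝ) (pay' : O → Op W' → ℝ)
      (hact : ∀ q e a ρ, P ρ → P (act q e a ρ) ∧ act' q e a (F ρ) = F (act q e a ρ))
      (hpay : ∀ o ρ, P ρ → pay' o (F ρ) = pay o ρ) (c : X.Ctrl) :
      NodeSim F P ⟨X.nodeWith act pay, c⟩ ⟨X.nodeWith act' pay', c⟩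

theorem forall₂_concat_inv {α β : Type*} {r : α → β → Prop} {L : List α} {m : α} {l : List β}
    (h : List.Forall₂ r (L ++ [m]) l) : ∃ L' m', l = L' ++ [m'] ∧ List.Forall₂ r L L' ∧ r m m' := by
  induction L generalizing l with
  | nil =>
    rcases h with _ | ⟨h1, h2⟩
    cases h2
    exact ⟨[], _, rfl, .nil, h1⟩
  | cons a L ih =>
    rcases h with _ | ⟨h1, h2⟩
    obtain ⟨L', m', rfl, h3, h4⟩ := ih h2
    exact ⟨_ :: L', m', rfl, .cons h1 h3, h4⟩

/-- Corresponding nodes have the same control, so both rings take the same branches; `F` transports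
the state along each branch. The invariant `P` allows payoffs to correspond only on the states that
really occur. -/
theorem ringValue_sim {F : Op W → Op W'} {P : Op W → Prop} {s : NodeState W} {s' : NodeState W'}
    {l : List (NodeState W)} {l' : List (NodeState W')} (hs : NodeSim F P s s')
    (hl : List.Forall₂ (NodeSim F P) l l') {ρ : Op W} (hρ : P ρ) (t : ℕ) (e : Entry) :
    ringValue t e s' l' (F ρ) = ringValue t e s l ρ := by
  induction t generalizing s s' l l' ρ e with
  | zero => rfl
  | succ t ih =>
    obtain ⟨X, act, act', pay, pay', hact, hpay, c⟩ := hs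
    refine Finset.sum_congr rfl fun a _ => ?_
    obtain ⟨h1, h2⟩ := hact c e a ρ hρ
    simp only [h2]
    have hsim : ∀ c', NodeSim F P ⟨X.nodeWith act pay, c'⟩ ⟨X.nodeWith act' pay', c'⟩ :=
      fun c' => .intro X act act' pay pay' hact hpay c'
    rcases X.next c e a with ⟨_ | _ | _ | o | _, c'⟩
    · rcases List.eq_nil_or_concat l with rfl | ⟨L, m, rfl⟩
      · cases hl
        exact ih (hsim c') .nil h1 _
      · rw [List.concat_eq_append] at hl
        obtain ⟨L', m', rfl, h3, h4⟩ := forall₂_concat_inv hl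
        simp only [afterMove, Move.map, List.concat_eq_append, goLeft_concat]
        exact ih h4 (.cons (hsim c') h3) h1 _
    · rcases hl with _ | ⟨h3, h4⟩
      · exact ih (hsim c') .nil h1 _
      · exact ih h3 (List.rel_append h4 (.cons (hsim c') .nil)) h1 _
    · exact ih (hsim c') hl h1 _
    · exact hpay o _ h1
    · rfl

theorem nodeSim_fill {ι : W → W'} (hι : ι.Injective) (X : Machine I J O)
    (h0 : ∀ q e a, X.op q e a 0 = 0) {emb : X.Wire → W} (he : emb.Injective)
    {emb' : X.Wire → W'} (he' : emb' = ι ∘ emb) (pay : O → Op W → ℝ) (pay' : O → Op W' → ℝ)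
    (hpay : ∀ o ρ, pay' o (fill ι ρ) = pay o ρ) (c : X.Ctrl) :
    NodeSim (fill ι) (fun _ => True) ⟨X.node emb pay, c⟩ ⟨X.node emb' pay', c⟩ := by
  subst he'
  exact .intro X _ _ pay pay' (fun q e a ρ _ => ⟨trivial, onWires_fill hι he (h0 q e a) ρ⟩)
    (fun o ρ _ => hpay o ρ) c

end Nodes

/-! ### Regrouping the components of a ring -/

section Regroup

variable {I J K : Iface}

/-- A composition in a ring may be replaced by its two components. -/
theorem ringValue_compAt {W : Type} {O : Type} (X : Machine I J O) (Y : Machine J K O)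
    (f : Entry ⊕ Entry) {emb : (X.compAt Y f).Wire → W} (he : emb.Injective) (pay : O → Op W → ℝ)
    (t : ℕ) (e : Entry) (s : NodeState W) (L R : List (NodeState W)) (x : X.Ctrl) (y : Y.Ctrl)
    (g : Entry ⊕ Entry) (ρ : Op W) :
    ringValue t e s (L ++ ⟨(X.compAt Y f).node emb pay, (x, y, g)⟩ :: R) ρ =
      ringValue t e s (L ++ ⟨X.node (emb ∘ embFst X Y) pay, x⟩ ::
        ⟨Y.node (emb ∘ embSnd X Y) pay, y⟩ :: R) ρ := by
  rw [nodeState_compAt X Y f he]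
  exact ringValue_comp t e s L (X.node (emb ∘ embFst X Y) pay)
    (Y.node (emb ∘ embSnd X Y) pay) x y g R ρ

theorem ringValue_compAt_fst {W : Type} {O : Type} (X : Machine I J O) (Y : Machine J K O)
    (f : Entry ⊕ Entry) {emb : (X.compAt Y f).Wire → W} (he : emb.Injective) (pay : O → Op W → ℝ)
    (t : ℕ) (e : Entry) (R : List (NodeState W)) (x : X.Ctrl) (y : Y.Ctrl) (ρ : Op W) :
    ringValue t .resume ⟨(X.compAt Y f).node emb pay, (x, y, .inl e)⟩ R ρ =
      ringValue t e ⟨X.node (emb ∘ embFst X Y) pay, x⟩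
        (⟨Y.node (emb ∘ embSnd X Y) pay, y⟩ :: R) ρ := by
  rw [nodeState_compAt X Y f he]
  exact ringValue_comp_fst t e (X.node (emb ∘ embFst X Y) pay)
    (Y.node (emb ∘ embSnd X Y) pay) x y R ρ

theorem ringValue_compAt_snd {W : Type} {O : Type} (X : Machine I J O) (Y : Machine J K O)
    (f : Entry ⊕ Entry) {emb : (X.compAt Y f).Wire → W} (he : emb.Injective) (pay : O → Op W → ℝ)
    (t : ℕ) (e : Entry) (R : List (NodeState W)) (x : X.Ctrl) (y : Y.Ctrl) (ρ : Op W) :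
    ringValue t .resume ⟨(X.compAt Y f).node emb pay, (x, y, .inr e)⟩ R ρ =
      ringValue t e ⟨Y.node (emb ∘ embSnd X Y) pay, y⟩
        (R ++ [⟨X.node (emb ∘ embFst X Y) pay, x⟩]) ρ := by
  rw [nodeState_compAt X Y f he]
  exact ringValue_comp_snd t e (X.node (emb ∘ embFst X Y) pay)
    (Y.node (emb ∘ embSnd X Y) pay) x y R ρ

theorem output_eq_ringValue {c q c' q' : ℕ} (Z : Sys (outIface c q) (outIface c' q'))
    (L : Op ((Fin c ⊕ Fin q) ⊕ (Fin c' ⊕ Fin q')) →+ ℝ) (t : ℕ) :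
    L (outputState Z t) = ringValue t .resume
      ⟨(collector c q c' q').node (embEnv _ Z) (fun _ ρ => L (marginal (messageWires Z) ρ)),
        (collector c q c' q').init⟩
      [⟨Z.node Sum.inl Empty.elim, Z.init⟩] (zeroState _) := by
  have h := run_eq_ringValue (collector c q c' q') Z
    (L.comp (marginal_linear (messageWires Z)).mk'.toAddMonoidHom) () t (.inl .resume)
    (collector c q c' q').init Z.init (zeroState _)
  exact h

/-- The real part of the trace. -/
def traceRe (W : Type) [Fintype W] [DecidableEq W] : Op W →+ ℝ :=
  Complex.reAddGroupHom.comp (Matrix.traceAddMonoidHom (W → Bool) ℂ)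

theorem traceRe_apply {W : Type} [Fintype W] [DecidableEq W] (X : Op W) :
    traceRe W X = X.trace.re := rfl

/-- The payoff for the probability of acceptance. -/
def acceptPay (W : Type) [Fintype W] [DecidableEq W] (o : Bool) (ρ : Op W) : ℝ :=
  if o = true then traceRe W ρ else 0

theorem acceptPay_fill {V W : Type} [Fintype V] [DecidableEq V] [Fintype W] [DecidableEq W]
    {ι : V → W} (hι : ι.Injective) (o : Bool) (ρ : Op V) :
    acceptPay W o (fill ι ρ) = acceptPay V o ρ := by
  simp [acceptPay, traceRe_apply, trace_fill hι]

theorem acceptWithin_eq_ringValue (D : Machine J I Bool) (R : Sys I J) (t : ℕ) :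
    acceptWithin D R t = ringValue t .resume
      ⟨D.node (embEnv D R) (acceptPay _), D.init⟩
      [⟨R.node Sum.inl Empty.elim, R.init⟩] (zeroState _) :=
  run_eq_ringValue D R (traceRe _) true t (.inl .resume) D.init R.init (zeroState _)

/-- A component at the right end of a resource may be moved to the distinguisher. -/
def rotateWires (D : Machine J I Bool) (R : Sys I K) (X : Sys K J) (f g : Entry ⊕ Entry) :
    RingWire D (R.compAt X g) → RingWire ((X.liftOut Bool).compAt D f) R
  | .inl (.inl i) => .inl (.inl i)
  | .inl (.inr (.inl (.inl r))) => .inl (.inr (.inl r))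
  | .inl (.inr (.inl (.inr (.inl k)))) => .inl (.inr (.inr k))
  | .inl (.inr (.inl (.inr (.inr x)))) => .inr (.inl x)
  | .inl (.inr (.inr j)) => .inr (.inr (.inl j))
  | .inr m => .inr (.inr (.inr m))

theorem rotateWires_injective (D : Machine J I Bool) (R : Sys I K) (X : Sys K J)
    (f g : Entry ⊕ Entry) : (rotateWires D R X f g).Injective := by
  refine Function.LeftInverse.injective (g := fun w => match w with
    | .inl (.inl i) => .inl (.inl i)
    | .inl (.inr (.inl r)) => .inl (.inr (.inl (.inl r)))
    | .inl (.inr (.inr k)) => .inl (.inr (.inl (.inr (.inl k))))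
    | .inr (.inl x) => .inl (.inr (.inl (.inr (.inr x))))
    | .inr (.inr (.inl j)) => .inl (.inr (.inr j))
    | .inr (.inr (.inr m)) => .inr m) ?_
  rintro ((i | (r | k | x) | j) | m) <;> rfl

/-- In the ring nothing separates the resource from the distinguisher. Both sides unfold to the
cyclic list `D`, `R`, `X` with `D` active, up to the names of the wires; the choice `.inr .resume`
makes `D` begin although `X` is on its left. -/
theorem acceptWithin_rotate (D : Machine J I Bool) (R : Sys I K) (X : Sys K J)
    (hD : ∀ q e a, D.op q e a 0 = 0) (hR : ∀ q e a, R.op q e a 0 = 0)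
    (hX : ∀ q e a, X.op q e a 0 = 0) (t : ℕ) :
    acceptWithin ((X.liftOut Bool).compAt D (.inr .resume)) R t = acceptWithin D (R ⋈ X) t := by
  rw [comp_eq_compAt, acceptWithin_eq_ringValue, acceptWithin_eq_ringValue]
  refine (ringValue_compAt_snd (X.liftOut Bool) D _ (embEnv_injective _ _) _ t _ _ _ _ _).trans
    (Eq.trans ?_ (ringValue_compAt R X _ Sum.inl_injective _ t _ _ [] [] _ _ _ _).symm)
  simp only [nodeState_liftOut]
  have hι := rotateWires_injective D R X (.inr .resume) (.inl .resume)
  refine Eq.trans (congrArg (ringValue t .resume _ _) (fill_zeroState hι).symm)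
    (ringValue_sim (F := fill (rotateWires D R X (.inr .resume) (.inl .resume)))
      (P := fun _ => True) ?_ ?_ trivial t .resume)
  · refine nodeSim_fill hι D hD (embEnv_injective _ _) ?_ _ _ (acceptPay_fill hι) _
    funext w
    rcases w with i | m | j <;> rfl
  · refine .cons (nodeSim_fill hι R hR ?_ ?_ _ _ (fun o => o.elim) _)
      (.cons (nodeSim_fill hι X hX ?_ ?_ _ _ (fun o => o.elim) _) .nil)
    · exact Sum.inl_injective.comp (embFst_injective _ _)
    · funext w
      rcases w with i | m | j <;> rfl
    · exact Sum.inl_injective.comp (embSnd_injective _ _)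
    · funext w
      rcases w with i | m | j <;> rfl

variable {c q c' q' : ℕ} {J₁ J₂ J₃ : Iface} (A : Sys (outIface c q) J₁) (B : Sys J₁ J₂)
  (C : Sys J₂ J₃) (D : Sys J₃ (outIface c' q'))

/-- From `((A B) C) D` to `(A (B C)) D`. -/
def assocWires (f₁ f₂ f₃ g₁ g₂ g₃ : Entry ⊕ Entry) :
    RingWire (collector c q c' q') (((A.compAt B f₁).compAt C f₂).compAt D f₃) →
      RingWire (collector c q c' q') ((A.compAt (B.compAt C g₁) g₂).compAt D g₃)
  | .inl (.inl i) => .inl (.inl i)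
  | .inl (.inr (.inl (.inl (.inl (.inl a))))) => .inl (.inr (.inl (.inl (.inl a))))
  | .inl (.inr (.inl (.inl (.inl (.inr (.inl j)))))) => .inl (.inr (.inl (.inl (.inr (.inl j)))))
  | .inl (.inr (.inl (.inl (.inl (.inr (.inr b)))))) =>
      .inl (.inr (.inl (.inl (.inr (.inr (.inl b))))))
  | .inl (.inr (.inl (.inl (.inr (.inl j))))) =>
      .inl (.inr (.inl (.inl (.inr (.inr (.inr (.inl j)))))))
  | .inl (.inr (.inl (.inl (.inr (.inr x))))) =>
      .inl (.inr (.inl (.inl (.inr (.inr (.inr (.inr x)))))))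
  | .inl (.inr (.inl (.inr (.inl j)))) => .inl (.inr (.inl (.inr (.inl j))))
  | .inl (.inr (.inl (.inr (.inr d)))) => .inl (.inr (.inl (.inr (.inr d))))
  | .inl (.inr (.inr j)) => .inl (.inr (.inr j))
  | .inr m => .inr m

theorem assocWires_injective (f₁ f₂ f₃ g₁ g₂ g₃ : Entry ⊕ Entry) :
    (assocWires A B C D f₁ f₂ f₃ g₁ g₂ g₃).Injective := by
  refine Function.LeftInverse.injective (g := fun w => match w with
    | .inl (.inl i) => .inl (.inl i)
    | .inl (.inr (.inl (.inl (.inl a)))) => .inl (.inr (.inl (.inl (.inl (.inl a)))))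
    | .inl (.inr (.inl (.inl (.inr (.inl j))))) => .inl (.inr (.inl (.inl (.inl (.inr (.inl j))))))
    | .inl (.inr (.inl (.inl (.inr (.inr (.inl b)))))) =>
        .inl (.inr (.inl (.inl (.inl (.inr (.inr b))))))
    | .inl (.inr (.inl (.inl (.inr (.inr (.inr (.inl j))))))) =>
        .inl (.inr (.inl (.inl (.inr (.inl j)))))
    | .inl (.inr (.inl (.inl (.inr (.inr (.inr (.inr x))))))) =>
        .inl (.inr (.inl (.inl (.inr (.inr x)))))
    | .inl (.inr (.inl (.inr (.inl j)))) => .inl (.inr (.inl (.inr (.inl j))))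
    | .inl (.inr (.inl (.inr (.inr d)))) => .inl (.inr (.inl (.inr (.inr d))))
    | .inl (.inr (.inr j)) => .inl (.inr (.inr j))
    | .inr m => .inr m) ?_
  rintro ((i | (((a | j | b) | j | x) | j | d) | j) | m) <;> rfl

/-- From `(A (B C)) D` to `(A B) (C D)`. -/
def assocWires' (f₁ f₂ f₃ g₁ g₂ g₃ : Entry ⊕ Entry) :
    RingWire (collector c q c' q') ((A.compAt (B.compAt C g₁) g₂).compAt D g₃) →
      RingWire (collector c q c' q') ((A.compAt B f₁).compAt (C.compAt D f₂) f₃)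
  | .inl (.inl i) => .inl (.inl i)
  | .inl (.inr (.inl (.inl (.inl a)))) => .inl (.inr (.inl (.inl (.inl a))))
  | .inl (.inr (.inl (.inl (.inr (.inl j))))) => .inl (.inr (.inl (.inl (.inr (.inl j)))))
  | .inl (.inr (.inl (.inl (.inr (.inr (.inl b)))))) => .inl (.inr (.inl (.inl (.inr (.inr b)))))
  | .inl (.inr (.inl (.inl (.inr (.inr (.inr (.inl j))))))) => .inl (.inr (.inl (.inr (.inl j))))
  | .inl (.inr (.inl (.inl (.inr (.inr (.inr (.inr x))))))) =>
      .inl (.inr (.inl (.inr (.inr (.inl x)))))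
  | .inl (.inr (.inl (.inr (.inl j)))) => .inl (.inr (.inl (.inr (.inr (.inr (.inl j))))))
  | .inl (.inr (.inl (.inr (.inr d)))) => .inl (.inr (.inl (.inr (.inr (.inr (.inr d))))))
  | .inl (.inr (.inr j)) => .inl (.inr (.inr j))
  | .inr m => .inr m

theorem assocWires'_injective (f₁ f₂ f₃ g₁ g₂ g₃ : Entry ⊕ Entry) :
    (assocWires' A B C D f₁ f₂ f₃ g₁ g₂ g₃).Injective := by
  refine Function.LeftInverse.injective (g := fun w => match w with
    | .inl (.inl i) => .inl (.inl i)
    | .inl (.inr (.inl (.inl (.inl a)))) => .inl (.inr (.inl (.inl (.inl a))))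
    | .inl (.inr (.inl (.inl (.inr (.inl j))))) => .inl (.inr (.inl (.inl (.inr (.inl j)))))
    | .inl (.inr (.inl (.inl (.inr (.inr b))))) => .inl (.inr (.inl (.inl (.inr (.inr (.inl b))))))
    | .inl (.inr (.inl (.inr (.inl j)))) => .inl (.inr (.inl (.inl (.inr (.inr (.inr (.inl j)))))))
    | .inl (.inr (.inl (.inr (.inr (.inl x))))) =>
        .inl (.inr (.inl (.inl (.inr (.inr (.inr (.inr x)))))))
    | .inl (.inr (.inl (.inr (.inr (.inr (.inl j)))))) => .inl (.inr (.inl (.inr (.inl j))))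
    | .inl (.inr (.inl (.inr (.inr (.inr (.inr d)))))) => .inl (.inr (.inl (.inr (.inr d))))
    | .inl (.inr (.inr j)) => .inl (.inr (.inr j))
    | .inr m => .inr m) ?_
  rintro ((i | ((a | j | b | j | x) | j | d) | j) | m) <;> rfl

theorem collector_zero (c q c' q' : ℕ) (p : (collector c q c' q').Ctrl) (e : Entry)
    (a : (collector c q c' q').Out) : (collector c q c' q').op p e a 0 = 0 :=
  (collector_preserves c q c' q' p e a).1

theorem messageWires_injective (Z : Sys (outIface c q) (outIface c' q')) :
    (messageWires Z).Injective := by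
  rintro ((i | i) | (i | i)) ((j | j) | (j | j)) h <;> simp [messageWires] at h <;> simp [h]

/-- Both bracketings unfold to the ring of the collector, `A`, `B`, `C`, `D`. Of the operations only
`op 0 = 0` is needed, to keep fresh wires at zero along `fill`. -/
theorem output_assoc (hA : ∀ q e a, A.op q e a 0 = 0) (hB : ∀ q e a, B.op q e a 0 = 0)
    (hC : ∀ q e a, C.op q e a 0 = 0) (hD : ∀ q e a, D.op q e a 0 = 0)
    (L : Op ((Fin c ⊕ Fin q) ⊕ (Fin c' ⊕ Fin q')) →+ ℝ) (t : ℕ) :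
    L (outputState (A ⋈ B ⋈ C ⋈ D) t) = L (outputState (A ⋈ (B ⋈ C) ⋈ D) t) := by
  simp only [comp_eq_compAt]
  have hι := assocWires_injective A B C D (.inl .resume) (.inl .resume) (.inl .resume)
    (.inl .resume) (.inl .resume) (.inl .resume)
  refine (output_eq_ringValue _ L t).trans (.trans ?_ (output_eq_ringValue _ L t).symm)
  refine (ringValue_compAt _ D _ Sum.inl_injective _ t _ _ [] [] _ _ _ _).trans ?_
  refine (ringValue_compAt _ C _ (Sum.inl_injective.comp (embFst_injective _ _))
    _ t _ _ [] _ _ _ _ _).trans ?_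
  refine (ringValue_compAt A B _ ((Sum.inl_injective.comp (embFst_injective _ _)).comp
    (embFst_injective _ _)) _ t _ _ [] _ _ _ _ _).trans ?_
  refine Eq.trans ?_ (ringValue_compAt _ D _ Sum.inl_injective _ t _ _ [] [] _ _ _ _).symm
  refine Eq.trans ?_ (ringValue_compAt A _ _ (Sum.inl_injective.comp (embFst_injective _ _))
    _ t _ _ [] _ _ _ _ _).symm
  refine Eq.trans ?_ (ringValue_compAt B C _ ((Sum.inl_injective.comp (embFst_injective _ _)).comp
    (embSnd_injective _ _)) _ t _ _ [_] _ _ _ _ _).symm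
  refine Eq.trans (ringValue_sim (F := fill (assocWires A B C D (.inl .resume) (.inl .resume)
    (.inl .resume) (.inl .resume) (.inl .resume) (.inl .resume)))
    (P := fun _ => True) ?_ ?_ trivial t .resume).symm
    (congrArg (ringValue t .resume _ _) (fill_zeroState hι))
  · refine nodeSim_fill hι _ (collector_zero c q c' q') (embEnv_injective _ _) ?_ _ _ ?_ _
    · funext w
      rcases w with i | m | j <;> rfl
    · intro o ρ
      have := marginal_fill hι (j := id) (e := messageWires (A.compAt B (.inl .resume) |>.compAt C
        (.inl .resume) |>.compAt D (.inl .resume)))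
        (e' := messageWires ((A.compAt (B.compAt C (.inl .resume)) (.inl .resume)).compAt D
          (.inl .resume))) (messageWires_injective _) (messageWires_injective _)
          (by rintro ((i | i) | (i | i)) <;> rfl) (fun v' h => absurd rfl (h v')) ρ
      rw [fill_id] at this
      exact congrArg L this
  · refine .cons (nodeSim_fill hι A hA ?_ ?_ _ _ (fun o => o.elim) _)
      (.cons (nodeSim_fill hι B hB ?_ ?_ _ _ (fun o => o.elim) _)
      (.cons (nodeSim_fill hι C hC ?_ ?_ _ _ (fun o => o.elim) _)
      (.cons (nodeSim_fill hι D hD ?_ ?_ _ _ (fun o => o.elim) _) .nil)))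
    all_goals
      first
      | (funext w; rcases w with i | m | j <;> rfl)
      | exact (Sum.inl_injective.comp (embSnd_injective _ _))
      | exact ((Sum.inl_injective.comp (embFst_injective _ _)).comp (embSnd_injective _ _))
      | exact (((Sum.inl_injective.comp (embFst_injective _ _)).comp (embFst_injective _ _)).comp
          (embFst_injective _ _))
      | exact (((Sum.inl_injective.comp (embFst_injective _ _)).comp (embFst_injective _ _)).comp
          (embSnd_injective _ _))

theorem output_assoc' (hA : ∀ q e a, A.op q e a 0 = 0) (hB : ∀ q e a, B.op q e a 0 = 0)
    (hC : ∀ q e a, C.op q e a 0 = 0) (hD : ∀ q e a, D.op q e a 0 = 0)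
    (L : Op ((Fin c ⊕ Fin q) ⊕ (Fin c' ⊕ Fin q')) →+ ℝ) (t : ℕ) :
    L (outputState (A ⋈ (B ⋈ C) ⋈ D) t) = L (outputState ((A ⋈ B) ⋈ (C ⋈ D)) t) := by
  simp only [comp_eq_compAt]
  have hι := assocWires'_injective A B C D (.inl .resume) (.inl .resume) (.inl .resume)
    (.inl .resume) (.inl .resume) (.inl .resume)
  refine (output_eq_ringValue _ L t).trans (.trans ?_ (output_eq_ringValue _ L t).symm)
  refine (ringValue_compAt _ D _ Sum.inl_injective _ t _ _ [] [] _ _ _ _).trans ?_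
  refine (ringValue_compAt A _ _ (Sum.inl_injective.comp (embFst_injective _ _))
    _ t _ _ [] _ _ _ _ _).trans ?_
  refine (ringValue_compAt B C _ ((Sum.inl_injective.comp (embFst_injective _ _)).comp
    (embSnd_injective _ _)) _ t _ _ [_] _ _ _ _ _).trans ?_
  refine Eq.trans ?_ (ringValue_compAt (A.compAt B _) (C.compAt D _) _ Sum.inl_injective _ t _ _ []
    [] _ _ _ _).symm
  refine Eq.trans ?_ (ringValue_compAt A B _ (Sum.inl_injective.comp (embFst_injective _ _))
    _ t _ _ [] _ _ _ _ _).symm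
  refine Eq.trans ?_ (ringValue_compAt C D _ (Sum.inl_injective.comp (embSnd_injective _ _))
    _ t _ _ [_, _] _ _ _ _ _).symm
  refine Eq.trans (ringValue_sim (F := fill (assocWires' A B C D (.inl .resume) (.inl .resume)
    (.inl .resume) (.inl .resume) (.inl .resume) (.inl .resume)))
    (P := fun _ => True) ?_ ?_ trivial t .resume).symm
    (congrArg (ringValue t .resume _ _) (fill_zeroState hι))
  · refine nodeSim_fill hι _ (collector_zero c q c' q') (embEnv_injective _ _) ?_ _ _ ?_ _
    · funext w
      rcases w with i | m | j <;> rfl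
    · intro o ρ
      have := marginal_fill hι (j := id) (e := messageWires ((A.compAt (B.compAt C (.inl .resume))
        (.inl .resume)).compAt D (.inl .resume)))
        (e' := messageWires ((A.compAt B (.inl .resume)).compAt
          (C.compAt D (.inl .resume)) (.inl .resume))) (messageWires_injective _) (messageWires_injective _)
          (by rintro ((i | i) | (i | i)) <;> rfl) (fun v' h => absurd rfl (h v')) ρ
      rw [fill_id] at this
      exact congrArg L this
  · refine .cons (nodeSim_fill hι A hA ?_ ?_ _ _ (fun o => o.elim) _)
      (.cons (nodeSim_fill hι B hB ?_ ?_ _ _ (fun o => o.elim) _)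
      (.cons (nodeSim_fill hι C hC ?_ ?_ _ _ (fun o => o.elim) _)
      (.cons (nodeSim_fill hι D hD ?_ ?_ _ _ (fun o => o.elim) _) .nil)))
    all_goals
      first
      | (funext w; rcases w with i | m | j <;> rfl)
      | exact (Sum.inl_injective.comp (embSnd_injective _ _))
      | exact ((Sum.inl_injective.comp (embFst_injective _ _)).comp (embFst_injective _ _))
      | exact (((Sum.inl_injective.comp (embFst_injective _ _)).comp (embSnd_injective _ _)).comp
          (embFst_injective _ _))
      | exact (((Sum.inl_injective.comp (embFst_injective _ _)).comp (embSnd_injective _ _)).comp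
          (embSnd_injective _ _))

end Regroup

/-! ### The test of a prepared state -/

section Tester

variable {k d : ℕ}

/-- Position of the wires of a measuring device among those of its tester. -/
def testEmb {M : Type} : (classicalIface k).Wire ⊕ M ⊕ (Iface.mk 0 d).Wire →
    (outIface 0 d).Wire ⊕ M ⊕ (outIface k 0).Wire
  | .inl (.inl i) => .inr (.inr (.inl i.succ))
  | .inl (.inr i) => i.elim0
  | .inr (.inl m) => .inr (.inl m)
  | .inr (.inr (.inl i)) => i.elim0
  | .inr (.inr (.inr j)) => .inl (.inr j)

/-- Position of the wires of the collector among those of a tester. -/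
def collectEmb {M : Type} : (collector k 0 0 d).Wire →
    (outIface 0 d).Wire ⊕ M ⊕ (outIface k 0).Wire
  | .inl i => .inl i
  | .inr (.inl m) => m.elim
  | .inr (.inr j) => .inr (.inr j)

theorem testEmb_injective {M : Type} : (testEmb (k := k) (d := d) (M := M)).Injective := by
  rintro ((i | i) | m | (i | j)) ((i' | i') | m' | (i' | j')) h <;>
    first
    | exact i.elim0
    | exact i'.elim0
    | (simp [testEmb] at h; try simp [h])

theorem collectEmb_injective {M : Type} :
    (collectEmb (k := k) (d := d) (M := M)).Injective := by
  rintro (i | m | j) (i' | m' | j') h <;>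
    first
    | exact m.elim
    | exact m'.elim
    | (simp [collectEmb] at h; try simp [h])

/-- The operations of the tester. -/
def testerOp (T : Machine (classicalIface k) ⟨0, d⟩ Bool) :
    Option T.Ctrl → Entry → Bool ⊕ T.Out →
      Op ((outIface 0 d).Wire ⊕ T.Mem ⊕ (outIface k 0).Wire) →
      Op ((outIface 0 d).Wire ⊕ T.Mem ⊕ (outIface k 0).Wire)
  | none, e, .inl b => onWires collectEmb ((collector k 0 0 d).op () e b)
  | some q, _, .inr a => onWires testEmb (T.op q .resume a)
  | _, _, _ => fun _ => 0

/-- The control of the tester. -/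
def testerNext (T : Machine (classicalIface k) ⟨0, d⟩ Bool) :
    Option T.Ctrl → Entry → Bool ⊕ T.Out → Move Bool × Option T.Ctrl
  | none, .resume, .inl _ => (.toRight, none)
  | none, _, .inl true => (.stay, some T.init)
  | none, .fromLeft, .inl false => (.toRight, none)
  | none, .fromRight, .inl false => (.toLeft, none)
  | some q, _, .inr a =>
    match T.next q .resume a with
    | (.stay, q') => (.stay, some q')
    | (.halt o, q') => (.halt o, some q')
    | (_, q') => (.hang, some q')
  | q, _, _ => (.hang, q)

/-- The environment that collects the two messages and then measures the quantum message as
prescribed by the classical one. -/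
abbrev tester (T : Machine (classicalIface k) ⟨0, d⟩ Bool) :
    Machine (outIface 0 d) (outIface k 0) Bool where
  Mem := T.Mem
  Ctrl := Option T.Ctrl
  Out := Bool ⊕ T.Out
  init := none
  op := testerOp T
  next := testerNext T

theorem isCP_project' {W : Type} [Fintype W] [DecidableEq W] (s : Set (W → Bool))
    {_ : DecidablePred (· ∈ s)} : IsCP (project s) :=
  isCP_project s

theorem isCP_collector (c q c' q' : ℕ) (p : (collector c q c' q').Ctrl) (e : Entry)
    (a : (collector c q c' q').Out) : IsCP ((collector c q c' q').op p e a) := by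
  cases e <;> cases a <;>
    first
    | exact isCP_zero
    | exact isCP_id
    | exact isCP_project' _

theorem trace_project_add {W : Type} [Fintype W] [DecidableEq W] (p : (W → Bool) → Prop)
    {_ : DecidablePred (· ∈ {x | p x})} {_ : DecidablePred (· ∈ {x | ¬ p x})} (X : Op W) :
    (project {x | p x} X).trace + (project {x | ¬ p x} X).trace = X.trace := by
  simp only [Matrix.trace, ← Finset.sum_add_distrib]
  refine Finset.sum_congr rfl fun x _ => ?_
  by_cases h : p x <;> simp [project, h]

theorem trace_collector (c q c' q' : ℕ) (p : (collector c q c' q').Ctrl) (e : Entry)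
    (X : Op (collector c q c' q').Wire) :
    ∑ a, ((collector c q c' q').op p e a X).trace = X.trace := by
  refine (Fintype.sum_bool (fun a => ((collector c q c' q').op p e a X).trace)).trans ?_
  cases e
  · exact trace_project_add _ _
  · exact trace_project_add _ _
  · exact (congrArg₂ (· + ·) (Matrix.trace_zero _ _) rfl).trans (zero_add _)

theorem classical_collector (c q c' q' : ℕ) (p : (collector c q c' q').Ctrl) (e : Entry)
    (a : (collector c q c' q').Out) {s : Set (collector c q c' q').Wire}
    {X : Op (collector c q c' q').Wire} (hX : IsClassicalOn s X) :
    IsClassicalOn s ((collector c q c' q').op p e a X) := by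
  cases e <;> cases a <;>
    first
    | exact fun _ _ _ => rfl
    | exact hX
    | exact hX.project _

theorem testEmb_preimage (T : Machine (classicalIface k) ⟨0, d⟩ Bool) :
    testEmb ⁻¹' (tester T).classicalWires = T.classicalWires := by
  ext w
  rcases w with (i | i) | m | (i | j)
  · exact ⟨fun _ => .inl ⟨i, rfl⟩, fun _ => .inr ⟨_, rfl⟩⟩
  · exact i.elim0
  · constructor <;> rintro (⟨_, h⟩ | ⟨_, h⟩) <;> cases h
  · exact i.elim0
  · constructor <;> rintro (⟨_, h⟩ | ⟨_, h⟩) <;> cases h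

/-- In each phase the outcomes of the other phase carry the zero operation, so the instrument is
that of the collector or that of `T`, placed on some of the wires. -/
theorem valid_tester {T : Machine (classicalIface k) ⟨0, d⟩ Bool} (hT : T.Valid) :
    (tester T).Valid where
  completelyPositive := by
    rintro (_ | q) e (a | a)
    · exact (isCP_collector _ _ _ _ _ e a).onWires collectEmb_injective
    · exact isCP_zero
    · exact isCP_zero
    · exact (hT.completelyPositive q .resume a).onWires testEmb_injective
  tracePreserving := by
    rintro (_ | q) e ρ
    · refine (Fintype.sum_sum_type _).trans ?_
      refine (congrArg₂ (· + ·) (Finset.sum_congr rfl fun a _ => trace_onWires collectEmb_injective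
        (isCP_collector k 0 0 d () e a).linear ρ) (Finset.sum_eq_zero fun a _ =>
          Matrix.trace_zero _ _)).trans ?_
      rw [add_zero]
      exact (trace_collector k 0 0 d () e _).trans (trace_marginal collectEmb_injective ρ)
    · refine (Fintype.sum_sum_type _).trans ?_
      refine (congrArg₂ (· + ·) (Finset.sum_eq_zero fun a _ => Matrix.trace_zero _ _)
        (Finset.sum_congr rfl fun a _ => trace_onWires testEmb_injective
          (hT.completelyPositive q .resume a).linear ρ)).trans ?_
      rw [zero_add]
      exact (hT.tracePreserving q .resume _).trans (trace_marginal testEmb_injective ρ)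
  classical := by
    rintro (_ | q) e (a | a) ρ hρ
    · exact hρ.onWires collectEmb_injective (collector_zero k 0 0 d () e a) fun Y hY =>
        classical_collector k 0 0 d () e a hY
    · exact fun _ _ _ => rfl
    · exact fun _ _ _ => rfl
    · refine hρ.onWires testEmb_injective (hT.completelyPositive q .resume a).map_zero fun Y hY => ?_
      rw [testEmb_preimage] at hY ⊢
      exact hT.classical q .resume a Y hY

theorem card_ctrl_tester (T : Machine (classicalIface k) ⟨0, d⟩ Bool) :
    Fintype.card (tester T).Ctrl = Fintype.card T.Ctrl + 1 :=
  Fintype.card_option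

theorem project_eq_onWires {V W : Type} {f : V → W} (hf : f.Injective) (s' : Set (V → Bool))
    {_ : DecidablePred (· ∈ s')} (s : Set (W → Bool)) {_ : DecidablePred (· ∈ s)}
    (h : ∀ x, x ∘ f ∈ s' ↔ x ∈ s) : project s = onWires f (project s') := by
  funext X
  ext x y
  simp only [project, onWires, Matrix.of_apply, extend_comp_self hf, h]

/-- While collecting, only the two delivery flags are inspected, which is a two-qubit instrument. -/
theorem isElementary_tester {T : Machine (classicalIface k) ⟨0, d⟩ Bool} (hT : T.IsElementary) :
    (tester T).IsElementary := by
  refine isElementary_of_embedding ?_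
  rintro (_ | q) e
  · let g : Fin 2 → (collector k 0 0 d).Wire := ![.inl (.inl 0), .inr (.inr (.inl 0))]
    have hg : g.Injective := by
      intro i j h
      fin_cases i <;> fin_cases j <;> first | rfl | cases h
    refine ⟨Fin 2, inferInstance, collectEmb ∘ g, collectEmb_injective.comp hg, le_rfl, ?_⟩
    have key : ∀ a, ∃ Φ : Op (Fin 2) → Op (Fin 2), (collector k 0 0 d).op () e a = onWires g Φ := by
      intro a
      cases e <;> cases a
      · exact ⟨_, @project_eq_onWires _ _ _ hg {x | ¬ (x 0 = true ∧ x 1 = true)} (Classical.decPred _) _ _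
          fun _ => Iff.rfl⟩
      · exact ⟨_, @project_eq_onWires _ _ _ hg {x | x 0 = true ∧ x 1 = true} (Classical.decPred _) _ _
          fun _ => Iff.rfl⟩
      · exact ⟨_, @project_eq_onWires _ _ _ hg {x | ¬ (x 0 = true ∧ x 1 = true)} (Classical.decPred _) _ _
          fun _ => Iff.rfl⟩
      · exact ⟨_, @project_eq_onWires _ _ _ hg {x | x 0 = true ∧ x 1 = true} (Classical.decPred _) _ _
          fun _ => Iff.rfl⟩
      · exact ⟨id, (onWires_id_map _ hg).symm⟩
      · exact ⟨fun _ => 0, (onWires_zero_map _).symm⟩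
    rintro (a | a)
    · obtain ⟨Φ, hΦ⟩ := key a
      exact ⟨Φ, (congrArg (onWires collectEmb) hΦ).trans (onWires_comp collectEmb_injective hg Φ)⟩
    · exact ⟨fun _ => 0, (onWires_zero_map _).symm⟩
  · obtain ⟨V, _, f, hf, hV, h⟩ := hT.embedding q .resume
    refine ⟨V, inferInstance, testEmb ∘ f, testEmb_injective.comp hf, hV, ?_⟩
    rintro (a | a)
    · exact ⟨fun _ => 0, (onWires_zero_map _).symm⟩
    · obtain ⟨Φ, hΦ⟩ := h a
      exact ⟨Φ, (congrArg (onWires testEmb) hΦ).trans (onWires_comp testEmb_injective hf Φ)⟩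

/-- A bound for the steps of a machine that are not answers to its neighbours. -/
def RelaysWithin {I J : Iface} {O : Type} (X : Machine I J O) (N : ℕ) : Prop :=
  ∃ rank : X.Ctrl → ℕ, rank X.init ≤ N ∧ ∀ q e a, (X.next q e a).1.Continues →
    rank (X.next q e a).2 < rank q ∨ rank (X.next q e a).2 = rank q ∧ (X.next q e a).1 ≠ .stay

theorem relaysWithin_tester {T : Machine (classicalIface k) ⟨0, d⟩ Bool} {N : ℕ}
    (hT : T.RunsWithin N) : RelaysWithin (tester T) (N + 1) := by
  obtain ⟨r, h0, h⟩ := hT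
  -- Forwarding keeps the rank and hands over control; the start of the measurement is a `stay` that
  -- lowers the rank from `r T.init + 1` to `r T.init`.
  refine ⟨fun q => match q with
    | none => r T.init + 1
    | some q => r q, Nat.succ_le_succ h0, ?_⟩
  rintro (_ | q) e (a | a) hc
  · cases e <;> cases a
    all_goals first
      | exact .inr ⟨rfl, by rintro ⟨⟩⟩
      | exact .inl (Nat.lt_succ_self _)
  · cases e <;> exact hc.elim
  · cases e <;> exact hc.elim
  · have h1 := h q .resume a
    revert hc h1
    simp only [testerNext]
    rcases T.next q .resume a with ⟨_ | _ | _ | o | _, q'⟩ <;> intro hc h1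
    · exact hc.elim
    · exact hc.elim
    · exact .inl (h1 trivial)
    · exact hc.elim
    · exact hc.elim

end Tester

/-- Two converters which are connected by a relay run for a bounded number of steps. -/
theorem RelaysWithin.runsWithin {I J K L : Iface} {O : Type} {X : Machine I J O}
    {Y : Machine J K O} {Z : Machine K L O} {NX NY NZ : ℕ} (hX : X.RunsWithin NX)
    (hY : RelaysWithin Y NY) (hZ : Z.RunsWithin NZ) (f g : Entry ⊕ Entry) :
    ((X.compAt Y f).compAt Z g).RunsWithin (2 * NX + NY + 2 * NZ + 1) := by
  obtain ⟨rX, hX0, hX⟩ := hX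
  obtain ⟨rY, hY0, hY⟩ := hY
  obtain ⟨rZ, hZ0, hZ⟩ := hZ
  -- `pend` is `1` exactly when the relay `Y` is due to act at the next `resume`. A step of `X` or
  -- `Z` lowers twice its rank by at least two, which pays for a possible activation of `Y`. A
  -- forwarding step of `Y` lowers `pend` from `1` to `0`.
  let pend : Entry ⊕ Entry → Entry ⊕ Entry → ℕ := fun f g =>
    match g with
    | .inl e => match focus f e with
      | .inr _ => 1
      | .inl _ => 0
    | .inr _ => 0
  have hp : ∀ f g, pend f g ≤ 1 := by
    intro f g
    rcases g with e | e
    · dsimp only [pend]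
      rcases focus f e <;> simp
    · exact Nat.zero_le _
  refine ⟨fun q => 2 * rX q.1.1 + rY q.1.2.1 + 2 * rZ q.2.1 + pend q.1.2.2 q.2.2, ?_, ?_⟩
  · have := hp f g
    dsimp only
    omega
  rintro ⟨⟨x, y, f⟩, z, g⟩ e c
  -- An activation from outside reaches `X` or `Z`, never `Y`; so `Y` acts only when this was
  -- pending.
  have hpend : ∀ e' e'', focus g e = .inl e' → focus f e' = .inr e'' → pend f g = 1 := by
    intro e' e'' h1 h2
    cases e
    · cases h1
      cases h2
    · cases h1
    · subst h1
      dsimp only [pend]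
      rw [h2]
  intro hc
  have hp0 := hp f g
  simp only at hc ⊢
  revert hc
  rcases hge : focus g e with e' | e' <;> rcases c with c | c
  · simp only [compNext, moveFst_continues]
    rcases hfe : focus f e' with e'' | e'' <;> rcases c with c | c <;> intro hc
    · have h1 := hX x e'' c ((moveFst_continues _).1 hc)
      have h2 := hp (moveFst (X.next x e'' c).1).2 (moveFst (moveFst (X.next x e'' c).1).1).2
      dsimp only
      omega
    · exact hc.elim
    · exact hc.elim
    · have h0 := hpend e' e'' hge hfe
      have h1 := hY y e'' c ((moveSnd_continues _).1 hc)
      dsimp only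
      have h2 := hp (moveSnd (Y.next y e'' c).1).2 (moveFst (moveSnd (Y.next y e'' c).1).1).2
      rcases h1 with h1 | ⟨h1, h3⟩
      · omega
      · have h4 : pend (moveSnd (Y.next y e'' c).1).2
            (moveFst (moveSnd (Y.next y e'' c).1).1).2 = 0 := by
          generalize (Y.next y e'' c).1 = m at h3
          cases m with
          | stay => exact absurd rfl h3
          | _ => rfl
        omega
  · exact fun hc => hc.elim
  · exact fun hc => hc.elim
  · intro hc
    have h1 := hZ z e' c ((moveSnd_continues _).1 hc)
    have h2 := hp f (moveSnd (Z.next z e' c).1).2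
    simp only [compNext]
    omega

/-! ### Rings of physical nodes -/

section Physical

variable {W : Type} [Fintype W] [DecidableEq W]

theorem trace_re_nonneg {X : Op W} (hX : X.PosSemidef) : 0 ≤ X.trace.re :=
  (Complex.le_def.1 hX.trace_nonneg).1

/-- Each step of the node is an instrument, and the payoffs are between `0` and the probability of
the run. -/
structure Node.Physical (N : Node W) : Prop where
  posSemidef : ∀ q e a {ρ : Op W}, ρ.PosSemidef → (N.op q e a ρ).PosSemidef
  trace : ∀ q e (ρ : Op W), ∑ a, (N.op q e a ρ).trace = ρ.trace
  payoff : ∀ q e a g, (N.next q e a).1 = .halt g → ∀ ρ : Op W, ρ.PosSemidef →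
    0 ≤ g ρ ∧ g ρ ≤ ρ.trace.re

theorem moveFst_halt {O : Type} {m : Move O} {o : O} (h : (moveFst m).1 = .halt o) :
    m = .halt o := by
  cases m <;> first | exact h | cases h

theorem moveSnd_halt {O : Type} {m : Move O} {o : O} (h : (moveSnd m).1 = .halt o) :
    m = .halt o := by
  cases m <;> first | exact h | cases h

theorem Node.Physical.comp {X Y : Node W} (hX : X.Physical) (hY : Y.Physical) :
    (X.comp Y).Physical where
  posSemidef := by
    intro q e c ρ hρ
    show (Node.compOp X Y q.1 q.2.1 (focus q.2.2 e) c ρ).PosSemidef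
    rcases focus q.2.2 e with e' | e' <;> rcases c with c | c
    · exact hX.posSemidef _ _ _ hρ
    · exact .zero
    · exact .zero
    · exact hY.posSemidef _ _ _ hρ
  trace := by
    intro q e ρ
    show ∑ c : X.Out ⊕ Y.Out, (Node.compOp X Y q.1 q.2.1 (focus q.2.2 e) c ρ).trace = _
    rw [Fintype.sum_sum_type]
    rcases focus q.2.2 e with e' | e'
    · exact (congrArg₂ (· + ·) (hX.trace _ _ _) (Finset.sum_eq_zero fun _ _ =>
        Matrix.trace_zero _ _)).trans (add_zero _)
    · exact (congrArg₂ (· + ·) (Finset.sum_eq_zero fun _ _ =>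
        Matrix.trace_zero _ _) (hY.trace _ _ _)).trans (zero_add _)
  payoff := by
    intro q e c g
    show (compNext X.next Y.next q (focus q.2.2 e) c).1 = .halt g → _
    rcases focus q.2.2 e with e' | e' <;> rcases c with c | c <;> intro h
    · exact hX.payoff _ _ _ g (moveFst_halt h)
    · cases h
    · cases h
    · exact hY.payoff _ _ _ g (moveSnd_halt h)

theorem Machine.Valid.physical {I J : Iface} {O : Type} {X : Machine I J O} (hX : X.Valid)
    {emb : X.Wire → W} (he : emb.Injective) {pay : O → Op W → ℝ}
    (hpay : ∀ o ρ, ρ.PosSemidef → 0 ≤ pay o ρ ∧ pay o ρ ≤ ρ.trace.re) :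
    (X.node emb pay).Physical where
  posSemidef q e a _ hρ := ((hX.completelyPositive q e a).onWires he).posSemidef hρ
  trace q e ρ := by
    refine (Finset.sum_congr rfl fun a _ =>
      trace_onWires he (hX.completelyPositive q e a).linear ρ).trans ?_
    exact (hX.tracePreserving q e _).trans (trace_marginal he ρ)
  payoff := by
    intro q e a g h
    dsimp only at h
    rcases h' : (X.next q e a).1 with _ | _ | _ | o | _ <;> rw [h'] at h <;> cases h
    exact hpay o

theorem acceptPay_bounds (o : Bool) (ρ : Op W) (hρ : ρ.PosSemidef) :
    0 ≤ acceptPay W o ρ ∧ acceptPay W o ρ ≤ ρ.trace.re := by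
  have := trace_re_nonneg hρ
  cases o
  · exact ⟨le_rfl, this⟩
  · exact ⟨this, le_rfl⟩

omit [Fintype W] [DecidableEq W] in
theorem mem_goLeft {s t : NodeState W} {l : List (NodeState W)}
    (h : t ∈ (goLeft s l).1 :: (goLeft s l).2) : t ∈ s :: l := by
  rcases List.eq_nil_or_concat l with rfl | ⟨L, m, rfl⟩
  · exact h
  · rw [List.concat_eq_append, goLeft_concat] at h
    simp only [List.mem_cons, List.concat_eq_append, List.mem_append, List.not_mem_nil,
      or_false] at h ⊢
    tauto

omit [Fintype W] [DecidableEq W] in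
theorem mem_goRight {s t : NodeState W} {l : List (NodeState W)}
    (h : t ∈ (goRight s l).1 :: (goRight s l).2) : t ∈ s :: l := by
  rcases l with _ | ⟨m, l⟩
  · exact h
  · simp only [goRight, List.mem_cons, List.mem_append, List.not_mem_nil, or_false] at h ⊢
    tauto

/-- Trace preservation splits the trace among the outcomes, and each final payoff is at most the
weight of its branch. This bounds the suprema over time by `1`. -/
theorem ringValue_bounds (t : ℕ) (e : Entry) (s : NodeState W) (l : List (NodeState W))
    (h : ∀ s' ∈ s :: l, s'.node.Physical) {ρ : Op W} (hρ : ρ.PosSemidef) :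
    0 ≤ ringValue t e s l ρ ∧ ringValue t e s l ρ ≤ ρ.trace.re := by
  induction t generalizing e s l ρ with
  | zero => exact ⟨le_rfl, trace_re_nonneg hρ⟩
  | succ t ih =>
    have hs := h s (List.mem_cons_self ..)
    have key : ∀ a, 0 ≤ afterMove (ringValue t) s.node l (s.node.op s.ctrl e a ρ)
        (s.node.next s.ctrl e a) ∧ afterMove (ringValue t) s.node l (s.node.op s.ctrl e a ρ)
        (s.node.next s.ctrl e a) ≤ (s.node.op s.ctrl e a ρ).trace.re := by
      intro a
      have hp := hs.posSemidef s.ctrl e a hρ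
      have hg := hs.payoff s.ctrl e a
      obtain ⟨N, c⟩ := s
      dsimp only at hp hg hs ⊢
      have h' : ∀ c' : N.Ctrl, ∀ s' ∈ (⟨N, c'⟩ : NodeState W) :: l, s'.node.Physical := by
        intro c' s' hs'
        rcases List.mem_cons.1 hs' with rfl | hs'
        · exact hs
        · exact h s' (List.mem_cons_of_mem _ hs')
      rcases hn : N.next c e a with ⟨_ | _ | _ | g | _, c'⟩
      · exact ih _ _ _ (fun s' hs' => h' c' s' (mem_goLeft hs')) hp
      · exact ih _ _ _ (fun s' hs' => h' c' s' (mem_goRight hs')) hp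
      · exact ih _ _ _ (h' c') hp
      · exact hg g (by rw [hn]) _ hp
      · exact ⟨le_rfl, trace_re_nonneg hp⟩
    refine ⟨Finset.sum_nonneg fun a _ => (key a).1,
      (Finset.sum_le_sum fun a _ => (key a).2).trans_eq ?_⟩
    rw [← hs.trace s.ctrl e ρ, Complex.re_sum]

theorem posSemidef_zeroState : (zeroState W).PosSemidef := by
  have h := Matrix.PosSemidef.one (n := W → Bool) (R := ℂ)
  have := h.mul_mul_conjTranspose_same (zeroState W)
  have h2 : zeroState W * 1 * (zeroState W).conjTranspose = zeroState W := by
    simp [zeroState]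
  rwa [h2] at this

theorem trace_zeroState : (zeroState W).trace = 1 := by
  simp [zeroState]

theorem acceptWithin_bounds {I J : Iface} {D : Machine J I Bool} {R : Sys I J} (hD : D.Valid)
    (hR : R.Valid) (t : ℕ) : 0 ≤ acceptWithin D R t ∧ acceptWithin D R t ≤ 1 := by
  rw [acceptWithin_eq_ringValue]
  have h := ringValue_bounds t .resume
    (⟨D.node (embEnv D R) (acceptPay _), D.init⟩ : NodeState (RingWire D R))
    [⟨R.node Sum.inl Empty.elim, R.init⟩] ?_ posSemidef_zeroState
  · rwa [trace_zeroState] at h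
  · intro s' hs'
    rcases List.mem_cons.1 hs' with rfl | hs'
    · exact hD.physical (embEnv_injective _ _) acceptPay_bounds
    · rw [List.mem_singleton] at hs'
      subst hs'
      exact hR.physical Sum.inl_injective fun o => o.elim

end Physical

/-! ### Measuring devices -/

section Solo

variable {I J : Iface} (T : Machine I J Bool)

/-- The probability that `T`, started in `q` with `ρ`, accepts within `t` steps. -/
def soloValue (t : ℕ) (q : T.Ctrl) (ρ : Op T.Wire) : ℝ :=
  (soloRun T t q ρ true).trace.re

theorem soloValue_succ (t : ℕ) (q : T.Ctrl) (ρ : Op T.Wire) :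
    soloValue T (t + 1) q ρ = ∑ a, match T.next q .resume a with
      | (.stay, q') => soloValue T t q' (T.op q .resume a ρ)
      | (.halt o', _) => acceptPay _ o' (T.op q .resume a ρ)
      | (.toLeft, _) => 0
      | (.toRight, _) => 0
      | (.hang, _) => 0 := by
  simp only [soloValue, soloRun, Matrix.trace_sum, Complex.re_sum]
  refine Finset.sum_congr rfl fun a _ => ?_
  rcases T.next q .resume a with ⟨_ | _ | _ | o' | _, q'⟩
  · simp
  · simp
  · rfl
  · cases o' <;> simp [acceptPay, traceRe_apply]
  · simp

variable {T} (hT : T.Valid)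
include hT

/-- The device is specified on normalized states with one fixed string `κ`; linearity extends this
to unnormalized states and to sums over `κ`. -/
theorem soloRun_linear (t : ℕ) (q : T.Ctrl) (o : Bool) :
    IsLinearMap ℂ fun ρ => soloRun T t q ρ o := by
  induction t generalizing q with
  | zero => exact ⟨fun _ _ => (add_zero _).symm, fun _ _ => (smul_zero _).symm⟩
  | succ t ih =>
    have h := fun a => (hT.completelyPositive q .resume a).linear
    refine ⟨fun x y => ?_, fun c x => ?_⟩
    · simp only [soloRun]
      rw [← Finset.sum_add_distrib]
      refine Finset.sum_congr rfl fun a _ => ?_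
      rw [(h a).map_add]
      rcases T.next q .resume a with ⟨_ | _ | _ | o' | _, q'⟩
      · exact (add_zero _).symm
      · exact (add_zero _).symm
      · exact (ih q').map_add _ _
      · dsimp only
        split_ifs
        · rfl
        · exact (add_zero _).symm
      · exact (add_zero _).symm
    · simp only [soloRun]
      rw [Finset.smul_sum]
      refine Finset.sum_congr rfl fun a _ => ?_
      rw [(h a).map_smul]
      rcases T.next q .resume a with ⟨_ | _ | _ | o' | _, q'⟩
      · exact (smul_zero _).symm
      · exact (smul_zero _).symm
      · exact (ih q').map_smul _ _
      · dsimp only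
        split_ifs
        · rfl
        · exact (smul_zero _).symm
      · exact (smul_zero _).symm

theorem soloValue_nonneg_mono (t : ℕ) (q : T.Ctrl) {ρ : Op T.Wire} (hρ : ρ.PosSemidef) :
    0 ≤ soloValue T t q ρ ∧ soloValue T t q ρ ≤ soloValue T (t + 1) q ρ := by
  have hn : ∀ t q {ρ : Op T.Wire}, ρ.PosSemidef → 0 ≤ soloValue T t q ρ := by
    intro t
    induction t with
    | zero => intro q ρ _; simp [soloValue, soloRun]
    | succ t ih =>
      intro q ρ hρ
      rw [soloValue_succ]
      refine Finset.sum_nonneg fun a _ => ?_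
      have h := (hT.completelyPositive q .resume a).posSemidef hρ
      rcases T.next q .resume a with ⟨_ | _ | _ | o' | _, q'⟩
      · exact le_rfl
      · exact le_rfl
      · exact ih q' h
      · exact (acceptPay_bounds o' _ h).1
      · exact le_rfl
  refine ⟨hn t q hρ, ?_⟩
  induction t generalizing q ρ with
  | zero => exact (by simp [soloValue, soloRun] : soloValue T 0 q ρ = 0).trans_le (hn 1 q hρ)
  | succ t ih =>
    rw [soloValue_succ, soloValue_succ T (t + 1)]
    refine Finset.sum_le_sum fun a _ => ?_
    have h := (hT.completelyPositive q .resume a).posSemidef hρ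
    rcases T.next q .resume a with ⟨_ | _ | _ | o' | _, q'⟩
    · exact le_rfl
    · exact le_rfl
    · exact ih q' h
    · exact le_rfl
    · exact le_rfl

theorem monotone_soloValue (q : T.Ctrl) {ρ : Op T.Wire} (hρ : ρ.PosSemidef) :
    Monotone fun t => soloValue T t q ρ :=
  monotone_nat_of_le_succ fun t => (soloValue_nonneg_mono hT t q hρ).2

omit hT in
theorem soloValue_eq_of_lt {rank : T.Ctrl → ℕ} (h : ∀ q e a, (T.next q e a).1.Continues →
    rank (T.next q e a).2 < rank q) {s t : ℕ} {q : T.Ctrl} (hs : rank q < s) (hst : s ≤ t)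
    (ρ : Op T.Wire) : soloValue T t q ρ = soloValue T s q ρ := by
  induction s generalizing t q ρ with
  | zero => exact absurd hs (Nat.not_lt_zero _)
  | succ s ih =>
    obtain ⟨t, rfl⟩ : ∃ t', t = t' + 1 := ⟨t - 1, by omega⟩
    rw [soloValue_succ, soloValue_succ]
    refine Finset.sum_congr rfl fun a _ => ?_
    have h1 := h q .resume a
    rcases hn : T.next q .resume a with ⟨_ | _ | _ | o' | _, q'⟩
    · rfl
    · rfl
    · rw [hn] at h1
      exact ih ((h1 trivial).trans_le (Nat.le_of_lt_succ hs)) (by omega) _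
    · rfl
    · rfl

/-- The bound is `N + 1` and not `N`, because a machine of rank `0` may still make the step in which
it halts. -/
theorem soloValue_le {N : ℕ} (hN : T.RunsWithin N) (t : ℕ) {ρ : Op T.Wire} (hρ : ρ.PosSemidef) :
    soloValue T t T.init ρ ≤ soloValue T (N + 1) T.init ρ := by
  obtain ⟨rank, h0, h⟩ := hN
  rcases le_total t (N + 1) with ht | ht
  · exact monotone_soloValue hT _ hρ ht
  · exact (soloValue_eq_of_lt h (Nat.lt_succ_of_le h0) ht ρ).le

theorem iSup_soloValue {N : ℕ} (hN : T.RunsWithin N) {ρ : Op T.Wire} (hρ : ρ.PosSemidef) :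
    ⨆ t, soloValue T t T.init ρ = soloValue T (N + 1) T.init ρ :=
  le_antisymm (ciSup_le fun t => soloValue_le hT hN t hρ)
    (le_ciSup ⟨_, Set.forall_mem_range.2 fun t => soloValue_le hT hN t hρ⟩ (N + 1))

end Solo

/-! ### The tester compared with the collector -/

section Compare

variable {k d : ℕ} {W : Type} [Fintype W] [DecidableEq W]
  {T : Machine (classicalIface k) ⟨0, d⟩ Bool}

theorem physical_tester (hT : T.Valid) {emb : (tester T).Wire → W} (he : emb.Injective) :
    ((tester T).node emb (acceptPay W)).Physical :=
  (valid_tester hT).physical he acceptPay_bounds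

/-- Once both messages have been delivered, the tester does not interact any more. -/
theorem ringValue_tester_some (hT : T.Valid) {emb : (tester T).Wire → W} (he : emb.Injective)
    (t : ℕ) (q : T.Ctrl) (l : List (NodeState W)) (ρ : Op W) :
    ringValue t .resume ⟨(tester T).node emb (acceptPay W), some q⟩ l ρ =
      soloValue T t q (marginal (emb ∘ testEmb) ρ) := by
  induction t generalizing q ρ with
  | zero => simp [ringValue, soloValue, soloRun]
  | succ t ih =>
    have hi := he.comp (testEmb_injective (k := k) (d := d) (M := T.Mem))
    rw [soloValue_succ]
    refine (Fintype.sum_sum_type _).trans ?_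
    refine (congrArg₂ (· + ·) (Finset.sum_eq_zero fun a _ => rfl) rfl).trans
      ((zero_add _).trans ?_)
    refine Finset.sum_congr rfl fun a _ => ?_
    have h1 : onWires emb (onWires testEmb (T.op q .resume a)) ρ =
        onWires (emb ∘ testEmb) (T.op q .resume a) ρ :=
      congrFun (onWires_comp he testEmb_injective _) ρ
    have h2 := marginal_onWires hi (hT.completelyPositive q .resume a).linear ρ
    show afterMove (ringValue t) ((tester T).node emb (acceptPay W)) l
      (onWires emb (onWires testEmb (T.op q .resume a)) ρ)
      ((testerNext T (some q) .resume (.inr a)).1.map (acceptPay W),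
        (testerNext T (some q) .resume (.inr a)).2) = _
    rw [h1]
    simp only [testerNext]
    rcases T.next q .resume a with ⟨_ | _ | _ | o' | _, q'⟩
    · rfl
    · rfl
    · refine (ih q' _).trans ?_
      rw [h2]
    · simp only [afterMove, Move.map]
      rw [← h2]
      cases o'
      · rfl
      · exact congrArg Complex.re (trace_marginal hi _).symm
    · rfl

/-- The two rings proceed in lockstep until both messages are there. At that moment the collector is
paid the full acceptance probability of `T`, whereas the tester has only the remaining steps for its
measurement. -/
theorem tester_le_collector (hT : T.Valid) {N : ℕ} (hN : T.RunsWithin N)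
    {emb : (tester T).Wire → W} (he : emb.Injective) {E : Node W} (hE : E.Physical) (t : ℕ) :
    (∀ e c (ρ : Op W), ρ.PosSemidef →
      ringValue t e ⟨(tester T).node emb (acceptPay W), none⟩ [⟨E, c⟩] ρ ≤
      ringValue t e ⟨(collector k 0 0 d).node (emb ∘ collectEmb) (fun _ ρ =>
        soloValue T (N + 1) T.init (marginal (emb ∘ testEmb) ρ)), ()⟩ [⟨E, c⟩] ρ) ∧
    ∀ e c (ρ : Op W), ρ.PosSemidef →
      ringValue t e ⟨E, c⟩ [⟨(tester T).node emb (acceptPay W), none⟩] ρ ≤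
      ringValue t e ⟨E, c⟩ [⟨(collector k 0 0 d).node (emb ∘ collectEmb) (fun _ ρ =>
        soloValue T (N + 1) T.init (marginal (emb ∘ testEmb) ρ)), ()⟩] ρ := by
  induction t with
  | zero => exact ⟨fun _ _ _ _ => le_rfl, fun _ _ _ _ => le_rfl⟩
  | succ t ih =>
    constructor
    · intro e c ρ hρ
      refine ((Fintype.sum_sum_type _).trans ((congrArg₂ (· + ·) rfl
        (Finset.sum_eq_zero fun a _ => ?_)).trans (add_zero _))).trans_le ?_
      · cases e <;> rfl
      refine Finset.sum_le_sum fun b _ => ?_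
      have h1 : onWires emb (onWires collectEmb ((collector k 0 0 d).op () e b)) ρ =
          onWires (emb ∘ collectEmb) ((collector k 0 0 d).op () e b) ρ :=
        congrFun (onWires_comp he collectEmb_injective _) ρ
      show afterMove (ringValue t) ((tester T).node emb (acceptPay W)) [⟨E, c⟩]
        (onWires emb (onWires collectEmb ((collector k 0 0 d).op () e b)) ρ)
        ((testerNext T none e (.inl b)).1.map (acceptPay W), (testerNext T none e (.inl b)).2) ≤ _
      rw [h1]
      have hp := ((isCP_collector k 0 0 d () e b).onWires
        (he.comp collectEmb_injective)).posSemidef hρ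
      have hm := posSemidef_marginal (he.comp testEmb_injective) hp
      cases e <;> cases b
      · exact ih.2 _ _ _ hp
      · exact (ringValue_tester_some hT he t T.init _ _).trans_le (soloValue_le hT hN t hm)
      · exact ih.2 _ _ _ hp
      · exact (ringValue_tester_some hT he t T.init _ _).trans_le (soloValue_le hT hN t hm)
      · exact ih.2 _ _ _ hp
      · exact ih.2 _ _ _ hp
    · intro e c ρ hρ
      refine Finset.sum_le_sum fun a _ => ?_
      have hp := hE.posSemidef c e a hρ
      dsimp only
      rcases E.next c e a with ⟨_ | _ | _ | g | _, c'⟩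
      · exact ih.1 _ _ _ hp
      · exact ih.1 _ _ _ hp
      · exact ih.2 _ _ _ hp
      · exact le_rfl
      · exact le_rfl

/-- With `N + 1` additional steps at the tester's disposal, at least `N + 1` of them are left when
the measurement starts, whenever the messages arrive. -/
theorem collector_le_tester (hT : T.Valid) (N : ℕ)
    {emb : (tester T).Wire → W} (he : emb.Injective) {E : Node W} (hE : E.Physical) (t : ℕ) :
    (∀ e c (ρ : Op W), ρ.PosSemidef →
      ringValue t e ⟨(collector k 0 0 d).node (emb ∘ collectEmb) (fun _ ρ =>
        soloValue T (N + 1) T.init (marginal (emb ∘ testEmb) ρ)), ()⟩ [⟨E, c⟩] ρ ≤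
      ringValue (t + (N + 1)) e ⟨(tester T).node emb (acceptPay W), none⟩ [⟨E, c⟩] ρ) ∧
    ∀ e c (ρ : Op W), ρ.PosSemidef →
      ringValue t e ⟨E, c⟩ [⟨(collector k 0 0 d).node (emb ∘ collectEmb) (fun _ ρ =>
        soloValue T (N + 1) T.init (marginal (emb ∘ testEmb) ρ)), ()⟩] ρ ≤
      ringValue (t + (N + 1)) e ⟨E, c⟩ [⟨(tester T).node emb (acceptPay W), none⟩] ρ := by
  have hM := physical_tester hT he
  induction t with
  | zero =>
    refine ⟨fun e c ρ hρ => (ringValue_bounds _ _ _ _ ?_ hρ).1,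
      fun e c ρ hρ => (ringValue_bounds _ _ _ _ ?_ hρ).1⟩ <;>
    · intro s' hs'
      simp only [List.mem_cons, List.not_mem_nil, or_false] at hs'
      rcases hs' with rfl | rfl <;> assumption
  | succ t ih =>
    rw [Nat.add_right_comm]
    constructor
    · intro e c ρ hρ
      refine le_of_le_of_eq ?_ ((Fintype.sum_sum_type _).trans ((congrArg₂ (· + ·) rfl
        (Finset.sum_eq_zero fun a _ => ?_)).trans (add_zero _))).symm
      swap
      · cases e <;> rfl
      refine Finset.sum_le_sum fun b _ => ?_
      have h1 : onWires emb (onWires collectEmb ((collector k 0 0 d).op () e b)) ρ =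
          onWires (emb ∘ collectEmb) ((collector k 0 0 d).op () e b) ρ :=
        congrFun (onWires_comp he collectEmb_injective _) ρ
      show _ ≤ afterMove (ringValue (t + (N + 1))) ((tester T).node emb (acceptPay W)) [⟨E, c⟩]
        (onWires emb (onWires collectEmb ((collector k 0 0 d).op () e b)) ρ)
        ((testerNext T none e (.inl b)).1.map (acceptPay W), (testerNext T none e (.inl b)).2)
      rw [h1]
      have hp := ((isCP_collector k 0 0 d () e b).onWires
        (he.comp collectEmb_injective)).posSemidef hρ
      have hm := posSemidef_marginal (he.comp testEmb_injective) hp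
      have hmono := monotone_soloValue hT T.init hm (Nat.le_add_left (N + 1) t)
      cases e <;> cases b
      · exact ih.2 _ _ _ hp
      · exact le_of_le_of_eq hmono (ringValue_tester_some hT he _ T.init _ _).symm
      · exact ih.2 _ _ _ hp
      · exact le_of_le_of_eq hmono (ringValue_tester_some hT he _ T.init _ _).symm
      · exact ih.2 _ _ _ hp
      · exact ih.2 _ _ _ hp
    · intro e c ρ hρ
      refine Finset.sum_le_sum fun a _ => ?_
      have hp := hE.posSemidef c e a hρ
      dsimp only
      rcases E.next c e a with ⟨_ | _ | _ | g | _, c'⟩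
      · exact ih.1 _ _ _ hp
      · exact ih.1 _ _ _ hp
      · exact ih.2 _ _ _ hp
      · exact le_rfl
      · exact le_rfl

end Compare

/-! ### Acceptance of the tester and expected overlap -/

section Overlap

/-- A reindexed matrix, possibly with repeated rows, compressed by a diagonal projection. -/
theorem posSemidef_ite {V W : Type} [Fintype V] [DecidableEq V] [Fintype W] [DecidableEq W]
    {X : Op V} (hX : X.PosSemidef) (p : (W → Bool) → Prop) [DecidablePred p]
    (f : (W → Bool) → V → Bool) :
    (Matrix.of fun x y => if p x ∧ p y then X (f x) (f y) else 0 : Op W).PosSemidef := by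
  have h := (hX.submatrix f).mul_mul_conjTranspose_same
    (Matrix.diagonal fun x => if p x then (1 : ℂ) else 0)
  convert h using 1
  ext x y
  by_cases hx : p x <;> by_cases hy : p y <;> simp [Matrix.diagonal_conjTranspose, hx, hy]

theorem IsClassicalOn.marginal {V W : Type} [Fintype V] [Fintype W] [DecidableEq W] {e : V → W}
    (he : e.Injective) {c : Set W} {X : Op W} (h : IsClassicalOn c X) :
    IsClassicalOn (e ⁻¹' c) (marginal e X) := by
  rintro a b ⟨v, hv, hab⟩
  refine Finset.sum_eq_zero fun x _ => ?_
  split_ifs with hx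
  · refine h _ _ ⟨e v, hv, ?_⟩
    rw [he.extend_apply]
    exact fun h => hab ((congrFun hx v).symm.trans h)
  · rfl

variable {k d : ℕ}

/-- The wires of a message of `k` bits and one of `d` qubits. -/
abbrev MessageWire (k d : ℕ) : Type := (Fin k ⊕ Fin 0) ⊕ (Fin 0 ⊕ Fin d)

/-- The values of the two messages. -/
def messageBits (κ : Fin k → Bool) (a : Fin d → Bool) : MessageWire k d → Bool :=
  Sum.elim (Sum.elim κ Fin.elim0) (Sum.elim Fin.elim0 a)

/-- The unnormalized state of the quantum message, when the classical message is `κ`. -/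
def messageBlock (κ : Fin k → Bool) (μ : Op (MessageWire k d)) : Op (Fin d) :=
  μ.submatrix (messageBits κ) (messageBits κ)

/-- The expected overlap of the quantum message with the state described by the classical one. -/
def overlap (desc : (Fin k → Bool) → Op (Fin d)) : Op (MessageWire k d) →+ ℝ where
  toFun μ := ∑ κ, (Matrix.trace (desc κ * messageBlock κ μ)).re
  map_zero' := by simp [messageBlock]
  map_add' μ ν := by
    rw [← Finset.sum_add_distrib]
    refine Finset.sum_congr rfl fun κ _ => ?_
    have : messageBlock κ (μ + ν) = messageBlock κ μ + messageBlock κ ν := rfl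
    rw [this, mul_add, Matrix.trace_add, Complex.add_re]

theorem expectedOverlap_eq (Z : Sys (outIface k 0) (outIface 0 d))
    (desc : (Fin k → Bool) → Op (Fin d)) :
    expectedOverlap Z desc = ⨆ t, overlap desc (outputState Z t) := rfl

variable {T : Machine (classicalIface k) ⟨0, d⟩ Bool}

/-- Position of the messages among the wires of a measuring device. -/
def inputWires (T : Machine (classicalIface k) ⟨0, d⟩ Bool) : MessageWire k d → T.Wire
  | .inl i => .inl i
  | .inr j => .inr (.inr j)

/-- Classicality of the first message makes `μ` block diagonal in `κ`, so the joint state is a sum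
of inputs of the kind for which the measuring device is specified. -/
theorem fill_inputWires {μ : Op (MessageWire k d)}
    (hμ : IsClassicalOn {w | ∃ i, w = .inl (.inl i)} μ) :
    fill (inputWires T) μ = ∑ κ, testInput T κ (messageBlock κ μ) := by
  ext x y
  have hz : ∀ x : T.Wire → Bool, ZeroOff (inputWires T) x ↔ ∀ m, x (.inr (.inl m)) = false := by
    refine fun x => ⟨fun h m => h _ ?_, fun h => ?_⟩
    · rintro (v | v) <;> rintro ⟨⟩
    · rintro (i | m | j) hw
      · exact absurd rfl (hw (.inl i))
      · exact h m
      · exact absurd rfl (hw (.inr j))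
  have hb : ∀ x : T.Wire → Bool, x ∘ inputWires T =
      messageBits (fun i => x (.inl (.inl i))) (fun j => x (.inr (.inr (.inr j)))) := by
    intro x
    funext v
    rcases v with (i | i) | (i | j)
    · rfl
    · exact i.elim0
    · exact i.elim0
    · rfl
  rw [Matrix.sum_apply, Finset.sum_eq_single fun i => x (.inl (.inl i))]
  · simp only [fill, testInput, Matrix.of_apply, hz, hb, messageBlock,
      Matrix.submatrix_apply, forall_and]
    by_cases hxy : ∀ i, y (.inl (.inl i)) = x (.inl (.inl i))
    · simp [hxy]
    · push Not at hxy
      obtain ⟨i, hi⟩ := hxy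
      have h1 : ¬ ∀ i, y (.inl (.inl i)) = x (.inl (.inl i)) := fun h => hi (h i)
      refine Eq.trans ?_ (if_neg fun h => h1 h.1.2).symm
      split_ifs
      · exact hμ _ _ ⟨.inl (.inl i), ⟨i, rfl⟩, fun h => hi h.symm⟩
      · rfl
  · intro κ _ hκ
    simp only [testInput, Matrix.of_apply]
    rw [if_neg]
    rintro ⟨h, -⟩
    exact hκ (funext fun i => (h i).1.symm)
  · exact fun h => absurd (Finset.mem_univ _) h

theorem posSemidef_testInput (κ : Fin k → Bool) {ρ : Op (Fin d)} (hρ : ρ.PosSemidef) :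
    (testInput T κ ρ).PosSemidef := by
  have h := posSemidef_ite (W := T.Wire) hρ
    (fun x => (∀ i, x (.inl (.inl i)) = κ i) ∧ ∀ m, x (.inr (.inl m)) = false)
    (fun x j => x (.inr (.inr (.inr j))))
  convert h using 1
  ext x y
  simp only [testInput, Matrix.of_apply, forall_and]
  congr 1
  exact propext (by tauto)

/-- Both sides scale with `ρ`, so the case of density matrices suffices; a positive semidefinite `ρ`
of trace zero is zero. -/
theorem soloValue_testInput (hT : T.Valid) {N : ℕ} (hN : T.RunsWithin N)
    {desc : (Fin k → Bool) → Op (Fin d)}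
    (h : ∀ κ ρ, IsDensity ρ → ⨆ t : ℕ, ((soloRun T t T.init (testInput T κ ρ) true).trace).re
      = ((desc κ * ρ).trace).re) (κ : Fin k → Bool) {ρ : Op (Fin d)} (hρ : ρ.PosSemidef) :
    soloValue T (N + 1) T.init (testInput T κ ρ) = ((desc κ * ρ).trace).re := by
  by_cases h0 : ρ.trace = 0
  · obtain rfl := hρ.trace_eq_zero_iff.1 h0
    have : testInput T κ 0 = 0 := by
      ext x y
      simp [testInput]
    rw [this, soloValue, (soloRun_linear hT _ _ _).map_zero]
    simp
  · have hr : ρ.trace = (ρ.trace.re : ℂ) :=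
      Complex.ext rfl (Complex.le_def.1 hρ.trace_nonneg).2.symm
    set r := ρ.trace.re with hrdef
    have hr0 : 0 < r := lt_of_le_of_ne (trace_re_nonneg hρ) fun h => h0 (by rw [hr, ← h]; rfl)
    have hd : IsDensity (r⁻¹ • ρ) := by
      refine ⟨hρ.smul (inv_nonneg.2 hr0.le), ?_⟩
      rw [Matrix.trace_smul, hr, Complex.real_smul, ← Complex.ofReal_mul, inv_mul_cancel₀ hr0.ne']
      rfl
    have h1 := h κ _ hd
    have h2 := iSup_soloValue hT hN (posSemidef_testInput (T := T) κ hd.1)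
    have h3 : testInput T κ (r⁻¹ • ρ) = ((r⁻¹ : ℝ) : ℂ) • testInput T κ ρ := by
      ext x y
      simp [testInput]
    have h4 := h2.symm.trans h1
    rw [h3, soloValue, (soloRun_linear hT _ _ _).map_smul, Matrix.trace_smul, Matrix.mul_smul,
      Matrix.trace_smul, smul_eq_mul, Complex.re_ofReal_mul, Complex.real_smul,
      Complex.re_ofReal_mul] at h4
    exact mul_left_cancel₀ (inv_ne_zero hr0.ne') h4

theorem soloValue_fill (hT : T.Valid) {N : ℕ} (hN : T.RunsWithin N)
    {desc : (Fin k → Bool) → Op (Fin d)}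
    (h : ∀ κ ρ, IsDensity ρ → ⨆ t : ℕ, ((soloRun T t T.init (testInput T κ ρ) true).trace).re
      = ((desc κ * ρ).trace).re) {μ : Op (MessageWire k d)} (hμ : μ.PosSemidef)
    (hc : IsClassicalOn {w | ∃ i, w = .inl (.inl i)} μ) :
    soloValue T (N + 1) T.init (fill (inputWires T) μ) = overlap desc μ := by
  rw [fill_inputWires hc, soloValue]
  have := map_sum (soloRun_linear hT (N + 1) T.init true).mk' (fun κ => testInput T κ (messageBlock κ μ))
    Finset.univ
  rw [IsLinearMap.mk'_apply] at this
  rw [this, Matrix.trace_sum, Complex.re_sum]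
  exact Finset.sum_congr rfl fun κ _ => soloValue_testInput hT hN h κ (hμ.submatrix _)

variable {I J : Iface}

/-- The payoffs of collector and measuring device correspond only on positive states whose first
message is classical; both properties are invariants of the run. -/
theorem nodeSim_fill_classical {I J : Iface} {O : Type} {W W' : Type} [Fintype W] [DecidableEq W]
    {ι : W → W'} (hι : ι.Injective) (X : Machine I J O) (hcp : ∀ q e a, IsCP (X.op q e a))
    {emb : X.Wire → W} (he : emb.Injective) {c : Set W}
    (hc : ∀ q e a Y, IsClassicalOn (emb ⁻¹' c) Y → IsClassicalOn (emb ⁻¹' c) (X.op q e a Y))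
    {emb' : X.Wire → W'} (he' : emb' = ι ∘ emb) (pay : O → Op W → ℝ) (pay' : O → Op W' → ℝ)
    (hpay : ∀ o ρ, ρ.PosSemidef ∧ IsClassicalOn c ρ → pay' o (fill ι ρ) = pay o ρ) (x : X.Ctrl) :
    NodeSim (fill ι) (fun ρ => ρ.PosSemidef ∧ IsClassicalOn c ρ) ⟨X.node emb pay, x⟩
      ⟨X.node emb' pay', x⟩ := by
  subst he'
  exact .intro X _ _ pay pay' (fun q e a ρ hρ =>
    ⟨⟨((hcp q e a).onWires he).posSemidef hρ.1, hρ.2.onWires he (hcp q e a).map_zero (hc q e a)⟩,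
      onWires_fill hι he (hcp q e a).map_zero ρ⟩) hpay x

/-- The distinguisher that consists of the two converters and the tester. -/
abbrev testEnv (A : Sys (outIface k 0) I) (T : Machine (classicalIface k) ⟨0, d⟩ Bool)
    (Q : Sys J (outIface 0 d)) : Machine J I Bool :=
  ((Q.liftOut Bool).compAt (tester T) (.inr .resume)).compAt (A.liftOut Bool) (.inl .resume)

variable (A : Sys (outIface k 0) I) (R : Sys I J) (Q : Sys J (outIface 0 d))
  (T : Machine (classicalIface k) ⟨0, d⟩ Bool)

/-- From the ring with the collector to the ring with the tester. -/
def testEnvWires (f g : Entry ⊕ Entry) :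
    RingWire (collector k 0 0 d) ((A.compAt R f).compAt Q g) → RingWire (testEnv A T Q) R
  | .inl (.inl i) => .inr (.inr (.inl i))
  | .inl (.inr (.inl (.inl (.inl a)))) => .inr (.inr (.inr a))
  | .inl (.inr (.inl (.inl (.inr (.inl i))))) => .inl (.inl i)
  | .inl (.inr (.inl (.inl (.inr (.inr r))))) => .inl (.inr (.inl r))
  | .inl (.inr (.inl (.inr (.inl j)))) => .inl (.inr (.inr j))
  | .inl (.inr (.inl (.inr (.inr q)))) => .inr (.inl (.inl q))
  | .inl (.inr (.inr o)) => .inr (.inl (.inr (.inl o)))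
  | .inr m => m.elim

theorem testEnvWires_injective (f g : Entry ⊕ Entry) :
    (testEnvWires A R Q T f g).Injective := by
  rintro ((i | ((a | i | r) | j | q) | o) | m) ((i' | ((a' | i' | r') | j' | q') | o') | m') h <;>
    first
    | exact m.elim
    | exact m'.elim
    | (simp [testEnvWires] at h; try simp [h])

/-- Position of the tester in the ring. -/
abbrev testerEmb : (tester T).Wire → RingWire (testEnv A T Q) R :=
  (embEnv (testEnv A T Q) R ∘
    embFst ((Q.liftOut Bool).compAt (tester T) (.inr .resume)) (A.liftOut Bool)) ∘
    embSnd (Q.liftOut Bool) (tester T)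

theorem testerEmb_injective : (testerEmb A R Q T).Injective :=
  ((embEnv_injective _ _).comp (embFst_injective _ _)).comp (embSnd_injective _ _)

/-- Position of the client's converter in the ring. -/
abbrev clientEmb : A.Wire → RingWire (testEnv A T Q) R :=
  embEnv (testEnv A T Q) R ∘
    embSnd ((Q.liftOut Bool).compAt (tester T) (.inr .resume)) (A.liftOut Bool)

/-- Position of the server's converter in the ring. -/
abbrev serverEmb : Q.Wire → RingWire (testEnv A T Q) R :=
  (embEnv (testEnv A T Q) R ∘
    embFst ((Q.liftOut Bool).compAt (tester T) (.inr .resume)) (A.liftOut Bool)) ∘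
    embFst (Q.liftOut Bool) (tester T)

/-- The components of the ring other than the tester. -/
abbrev testRest : List (NodeState (RingWire (testEnv A T Q) R)) :=
  [⟨A.node (clientEmb A R Q T) Empty.elim, A.init⟩, ⟨R.node Sum.inl Empty.elim, R.init⟩,
    ⟨Q.node (serverEmb A R Q T) Empty.elim, Q.init⟩]

theorem acceptWithin_testEnv (t : ℕ) : acceptWithin (testEnv A T Q) R t =
    ringValue t .resume ⟨(tester T).node (testerEmb A R Q T) (acceptPay _), none⟩
      (testRest A R Q T) (zeroState _) := by
  rw [acceptWithin_eq_ringValue]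
  refine (ringValue_compAt_fst _ _ _ (embEnv_injective _ _) _ t _ _ _ _ _).trans ?_
  refine (ringValue_compAt_snd _ _ _ ((embEnv_injective _ _).comp (embFst_injective _ _))
    _ t _ _ _ _ _).trans ?_
  simp only [nodeState_liftOut]
  rfl

variable {A R Q T}

/-- The right side is the collector in the ring that belongs to the tester: the memory of `T` is
present and stays `|0…0⟩` until the messages are collected. Only the message bits of `A` are
followed as classical, which strict validity permits. -/
theorem overlap_eq_ringValue (hA : A.StrictlyValid) (hR : R.StrictlyValid) (hQ : Q.StrictlyValid)
    (hT : T.Valid) {N : ℕ} (hN : T.RunsWithin N) {desc : (Fin k → Bool) → Op (Fin d)}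
    (h : ∀ κ ρ, IsDensity ρ → ⨆ t : ℕ, ((soloRun T t T.init (testInput T κ ρ) true).trace).re
      = ((desc κ * ρ).trace).re) (t : ℕ) :
    overlap desc (outputState (A ⋈ R ⋈ Q) t) =
    ringValue t .resume ⟨(collector k 0 0 d).node (testerEmb A R Q T ∘ collectEmb) (fun _ ρ =>
      soloValue T (N + 1) T.init (marginal (testerEmb A R Q T ∘ testEmb) ρ)), ()⟩
      (testRest A R Q T) (zeroState _) := by
  simp only [comp_eq_compAt]
  refine (output_eq_ringValue _ _ t).trans ?_
  refine (ringValue_compAt _ Q _ Sum.inl_injective _ t _ _ [] [] _ _ _ _).trans ?_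
  refine (ringValue_compAt A R _ (Sum.inl_injective.comp (embFst_injective _ _))
    _ t _ _ [] _ _ _ _ _).trans ?_
  have hι := testEnvWires_injective A R Q T (.inl .resume) (.inl .resume)
  refine Eq.trans (ringValue_sim (F := fill (testEnvWires A R Q T (.inl .resume) (.inl .resume)))
    (P := fun ρ => ρ.PosSemidef ∧ IsClassicalOn
      (Set.range fun i : Fin k => (.inl (.inl (.inl i.succ)) : RingWire (collector k 0 0 d)
        ((A.compAt R (.inl .resume)).compAt Q (.inl .resume)))) ρ) ?_ ?_
      ⟨posSemidef_zeroState, isClassicalOn_zeroState _⟩ t .resume).symm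
    (congrArg (ringValue t .resume _ _) (fill_zeroState hι))
  · refine nodeSim_fill_classical hι _ (isCP_collector k 0 0 d) (embEnv_injective _ _)
      (fun q e a Y hY => classical_collector k 0 0 d q e a hY) ?_ _ _ ?_ _
    · funext w
      rcases w with i | m | j
      · rfl
      · exact m.elim
      · rfl
    · rintro o ρ ⟨hp, hc⟩
      rw [← soloValue_fill hT hN h (posSemidef_marginal (messageWires_injective _) hp)
        ((hc.marginal (messageWires_injective _)).mono ?_)]
      · congr 1
        refine marginal_fill hι (messageWires_injective _)
          ((testerEmb_injective A R Q T).comp testEmb_injective) ?_ ?_ ρ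
        · rintro ((i | i) | (i | i))
          · rfl
          · exact i.elim0
          · exact i.elim0
          · rfl
        · rintro (i | m | j) hv
          · exact absurd rfl (hv (.inl i))
          · rintro ((i | ((a | i | r) | j | q) | o) | m) hw
            all_goals first
              | exact m.elim
              | cases hw
          · exact absurd rfl (hv (.inr j))
      · rintro w ⟨i, rfl⟩
        exact ⟨i, rfl⟩
  · refine .cons (nodeSim_fill_classical hι A hA.1 ?_ (hA.3 _ ?_) ?_ _ _ (fun o => o.elim) _)
      (.cons (nodeSim_fill_classical hι R hR.1 ?_ (hR.3 _ ?_) ?_ _ _ (fun o => o.elim) _)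
      (.cons (nodeSim_fill_classical hι Q hQ.1 ?_ (hQ.3 _ ?_) ?_ _ _ (fun o => o.elim) _) .nil))
    all_goals first
      | exact Sum.inl_injective.comp (embSnd_injective _ _)
      | exact (Sum.inl_injective.comp (embFst_injective _ _)).comp (embFst_injective _ _)
      | exact (Sum.inl_injective.comp (embFst_injective _ _)).comp (embSnd_injective _ _)
      | (funext w; rcases w with i | m | j <;> rfl)
      | skip
    · rintro (w | w | w) ⟨i, hi⟩ <;> cases hi
      exact .inl ⟨_, rfl⟩
    · rintro (w | w | w) ⟨i, hi⟩ <;> cases hi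
    · rintro (w | w | w) ⟨i, hi⟩ <;> cases hi

theorem ringValue_merge {W : Type} (t : ℕ) (e : Entry) (s x y z : NodeState W) (ρ : Op W) :
    ringValue t e s [x, y, z] ρ = ringValue t e s [⟨(x.node.comp y.node).comp z.node,
      ((x.ctrl, y.ctrl, .inl .resume), z.ctrl, .inl .resume)⟩] ρ :=
  ((ringValue_comp t e s [] _ _ _ _ _ [] ρ).trans
    (ringValue_comp t e s [] _ _ _ _ _ [_] ρ)).symm

/-- Up to a shift of time by the `N + 1` steps of the measurement, testing and computing the overlap
coincide. Merging `A`, `R`, `Q` into one node reduces this to a ring of two nodes. -/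
theorem overlap_acceptWithin (hA : A.StrictlyValid) (hR : R.StrictlyValid) (hQ : Q.StrictlyValid)
    (hT : T.Valid) {N : ℕ} (hN : T.RunsWithin N) {desc : (Fin k → Bool) → Op (Fin d)}
    (h : ∀ κ ρ, IsDensity ρ → ⨆ t : ℕ, ((soloRun T t T.init (testInput T κ ρ) true).trace).re
      = ((desc κ * ρ).trace).re) (t : ℕ) :
    acceptWithin (testEnv A T Q) R t ≤ overlap desc (outputState (A ⋈ R ⋈ Q) t) ∧
    overlap desc (outputState (A ⋈ R ⋈ Q) t) ≤ acceptWithin (testEnv A T Q) R (t + (N + 1)) := by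
  rw [overlap_eq_ringValue hA hR hQ hT hN h, acceptWithin_testEnv, acceptWithin_testEnv]
  have hphys : ∀ {I J : Iface} {X : Sys I J}, X.StrictlyValid → ∀ {W : Type} [Fintype W]
      [DecidableEq W] {emb : X.Wire → W} (_ : emb.Injective),
      (X.node emb Empty.elim).Physical := fun hX _ _ _ _ he =>
    hX.valid.physical he fun o => o.elim
  have hE := ((hphys hA (emb := clientEmb A R Q T)
      ((embEnv_injective _ _).comp (embSnd_injective _ _))).comp
    (hphys hR Sum.inl_injective)).comp (hphys hQ (emb := serverEmb A R Q T)
      (((embEnv_injective _ _).comp (embFst_injective _ _)).comp (embFst_injective _ _)))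
  have merge := fun t s => ringValue_merge t .resume s ⟨A.node (clientEmb A R Q T) Empty.elim, A.init⟩
    ⟨R.node Sum.inl Empty.elim, R.init⟩ ⟨Q.node (serverEmb A R Q T) Empty.elim, Q.init⟩ (zeroState _)
  exact ⟨(merge _ _).trans_le (((tester_le_collector hT hN
      (testerEmb_injective A R Q T) hE t).1 _ _ _ posSemidef_zeroState).trans_eq
        (merge _ _).symm),
    (merge _ _).trans_le (((collector_le_tester hT N
      (testerEmb_injective A R Q T) hE t).1 _ _ _ posSemidef_zeroState).trans_eq
        (merge _ _).symm)⟩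

end Overlap

/-! ### Linear dependence on the initial state -/

section Linear

variable {W : Type}

theorem isLinearMap_real {V : Type} {Φ : Op V → Op W} (h : IsLinearMap ℂ Φ) :
    IsLinearMap ℝ Φ where
  map_add := h.map_add
  map_smul r X := by
    rw [← algebraMap_smul ℂ r X, h.map_smul, algebraMap_smul]

/-- The operations and the payoffs of the node are linear. -/
structure Node.Linear (N : Node W) : Prop where
  op : ∀ q e a, IsLinearMap ℝ (N.op q e a)
  payoff : ∀ q e a g, (N.next q e a).1 = .halt g → IsLinearMap ℝ g

/-- This is used to follow the terms of a decomposed state separately. Scalars are real because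
payoffs are. -/
theorem ringValue_linear (t : ℕ) (e : Entry) (s : NodeState W) (l : List (NodeState W))
    (h : ∀ s' ∈ s :: l, s'.node.Linear) : IsLinearMap ℝ (ringValue t e s l) := by
  have h0 : IsLinearMap ℝ fun _ : Op W => (0 : ℝ) :=
    ⟨fun _ _ => (add_zero _).symm, fun _ _ => (smul_zero _).symm⟩
  induction t generalizing e s l with
  | zero => exact h0
  | succ t ih =>
    have hs := h s (List.mem_cons_self ..)
    have key : ∀ a, IsLinearMap ℝ fun ρ => afterMove (ringValue t) s.node l
        (s.node.op s.ctrl e a ρ) (s.node.next s.ctrl e a) := by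
      intro a
      have hg := hs.payoff s.ctrl e a
      have ho := hs.op s.ctrl e a
      obtain ⟨N, c⟩ := s
      have h' : ∀ c' : N.Ctrl, ∀ s' ∈ (⟨N, c'⟩ : NodeState W) :: l, s'.node.Linear := by
        intro c' s' hs'
        rcases List.mem_cons.1 hs' with rfl | hs'
        · exact hs
        · exact h s' (List.mem_cons_of_mem _ hs')
      dsimp only at hg ho ⊢
      rcases hn : N.next c e a with ⟨_ | _ | _ | g | _, c'⟩
      · exact ((ih _ _ _ fun s' hs' => h' c' s' (mem_goLeft hs')).mk'.comp ho.mk').isLinear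
      · exact ((ih _ _ _ fun s' hs' => h' c' s' (mem_goRight hs')).mk'.comp ho.mk').isLinear
      · exact ((ih _ _ _ (h' c')).mk'.comp ho.mk').isLinear
      · exact ((hg g (by rw [hn])).mk'.comp ho.mk').isLinear
      · exact h0
    refine ⟨fun x y => ?_, fun r x => ?_⟩
    · simp only [ringValue]
      rw [← Finset.sum_add_distrib]
      exact Finset.sum_congr rfl fun a _ => (key a).map_add x y
    · simp only [ringValue]
      rw [Finset.smul_sum]
      exact Finset.sum_congr rfl fun a _ => (key a).map_smul r x

end Linear

/-! ### Product states -/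

section Tensor

variable {U V C : Type}

/-- The tensor product. -/
def tens (X : Op U) (ρ : Op V) : Op (U ⊕ V) :=
  Matrix.of fun x y => X (x ∘ .inl) (y ∘ .inl) * ρ (x ∘ .inr) (y ∘ .inr)

/-- The projection onto a computational basis state. -/
abbrev ket [Fintype V] [DecidableEq V] (κ : V → Bool) : Op V := Matrix.single κ κ 1

theorem tens_smul (X : Op U) (r : ℝ) (ρ : Op V) : tens X (r • ρ) = r • tens X ρ := by
  ext x y
  simp only [tens, Matrix.of_apply, Matrix.smul_apply, Complex.real_smul]
  ring

theorem tens_zero (X : Op U) : tens X (0 : Op V) = 0 := by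
  ext x y
  simp [tens]

theorem tens_zeroState [Fintype U] [DecidableEq U] [Fintype V] [DecidableEq V] :
    tens (zeroState U) (zeroState V) = zeroState (U ⊕ V) := by
  ext x y
  have h : ∀ x : U ⊕ V → Bool, (fun _ => false) = x ↔
      (fun _ => false) = x ∘ Sum.inl ∧ (fun _ => false) = x ∘ Sum.inr := by
    intro x
    simp only [funext_iff, Sum.forall, Function.comp]
  simp only [tens, zeroState, Matrix.of_apply, Matrix.single_apply, h]
  split_ifs <;> first | (exfalso; tauto) | norm_num

theorem onWires_inl_tens {Φ : Op U → Op U} (hΦ : IsLinearMap ℂ Φ) (X : Op U) (ρ : Op V) :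
    onWires Sum.inl Φ (tens X ρ) = tens (Φ X) ρ := by
  ext x y
  have h : (Matrix.of fun a b => tens X ρ (Function.extend Sum.inl a x)
      (Function.extend Sum.inl b y)) = ρ (x ∘ .inr) (y ∘ .inr) • X := by
    ext a b
    have h1 : ∀ (a : U → Bool) (x : U ⊕ V → Bool), Function.extend Sum.inl a x ∘ .inl = a :=
      fun a x => Function.extend_comp Sum.inl_injective _ _
    have h2 : ∀ (a : U → Bool) (x : U ⊕ V → Bool),
        Function.extend Sum.inl a x ∘ .inr = x ∘ .inr :=
      fun a x => extend_comp_of_disjoint (fun _ _ => Sum.inr_ne_inl) a x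
    simp only [tens, Matrix.of_apply, h1, h2, Matrix.smul_apply, smul_eq_mul]
    ring
  show Φ _ _ _ = Φ X _ _ * _
  rw [h, hΦ.map_smul, Matrix.smul_apply, smul_eq_mul, mul_comm]

/-- The values of the wires `cl` change from `c` to `c'`. -/
def jump (cl : C → U) (X : Op U) (c c' : C → Bool) : Op U :=
  open Classical in
  Matrix.of fun x y => if x ∘ cl = c' ∧ y ∘ cl = c' then
    X (Function.extend cl c x) (Function.extend cl c y) else 0

/-- The unnormalized state after the operation `Ψ`, if the classical input is `c` and the
classical output is `c'`. -/
def outcome [Fintype C] [DecidableEq C] (Ψ : Op (C ⊕ V) → Op (C ⊕ V)) (c c' : C → Bool)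
    (ρ : Op V) : Op V :=
  (Ψ (tens (ket c) ρ)).submatrix (Sum.elim c') (Sum.elim c')

theorem posSemidef_jump [Fintype U] [DecidableEq U] (cl : C → U) {X : Op U} (hX : X.PosSemidef)
    (c c' : C → Bool) : (jump cl X c c').PosSemidef := by
  classical
  have h := posSemidef_ite hX (fun x => x ∘ cl = c') (fun x => Function.extend cl c x)
  have h2 : jump cl X c c' = Matrix.of fun x y => if x ∘ cl = c' ∧ y ∘ cl = c' then
      X (Function.extend cl c x) (Function.extend cl c y) else 0 := by
    ext x y
    simp [jump]
  rwa [h2]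

theorem isClassicalOn_jump (cl : C → U) (X : Op U) (c c' : C → Bool) :
    IsClassicalOn (Set.range cl) (jump cl X c c') := by
  rintro x y ⟨_, ⟨i, rfl⟩, hi⟩
  refine if_neg ?_
  rintro ⟨h1, h2⟩
  exact hi (congrFun (h1.trans h2.symm) i)

theorem posSemidef_tens_ket [Fintype V] [DecidableEq V] [Fintype C] [DecidableEq C] (c : C → Bool)
    {ρ : Op V} (hρ : ρ.PosSemidef) : (tens (ket c) ρ).PosSemidef := by
  have h := posSemidef_ite (W := C ⊕ V) hρ (fun x => c = x ∘ Sum.inl) (fun x => x ∘ Sum.inr)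
  convert h using 1
  ext x y
  simp only [tens, Matrix.of_apply, Matrix.single_apply]
  split_ifs <;> simp

theorem trace_tens_ket [Fintype V] [DecidableEq V] [Fintype C] [DecidableEq C] (c : C → Bool)
    (ρ : Op V) : (tens (ket c) ρ).trace = ρ.trace := by
  simp only [Matrix.trace, Matrix.diag]
  rw [← (Equiv.sumArrowEquivProdArrow C V Bool).symm.sum_comp, Fintype.sum_prod_type,
    Finset.sum_eq_single c]
  · refine Finset.sum_congr rfl fun v _ => ?_
    show ket c c c * ρ v v = _
    simp
  · intro b _ hb
    refine Finset.sum_eq_zero fun v _ => ?_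
    show ket c b b * ρ v v = _
    simp [hb.symm]
  · exact fun h => absurd (Finset.mem_univ _) h

theorem sum_trace_outcome [Fintype V] [DecidableEq V] [Fintype C] [DecidableEq C]
    (Ψ : Op (C ⊕ V) → Op (C ⊕ V)) (c : C → Bool) (ρ : Op V) :
    ∑ c', (outcome Ψ c c' ρ).trace = (Ψ (tens (ket c) ρ)).trace := by
  simp only [Matrix.trace, Matrix.diag]
  rw [← (Equiv.sumArrowEquivProdArrow C V Bool).symm.sum_comp, Fintype.sum_prod_type]
  rfl

theorem posSemidef_outcome [Fintype V] [DecidableEq V] [Fintype C] [DecidableEq C]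
    {Ψ : Op (C ⊕ V) → Op (C ⊕ V)} (hΨ : IsCP Ψ) (c c' : C → Bool)
    {ρ : Op V} (hρ : ρ.PosSemidef) : (outcome Ψ c c' ρ).PosSemidef :=
  (hΨ.posSemidef (posSemidef_tens_ket c hρ)).submatrix _

/-- No entanglement arises across a classical link. The operation meets `X` only through definite
values `c` of the link wires, and its output has definite values `c'` again; hence a product state
becomes a sum of products of an outer and a private state. -/
theorem onWires_tens [Fintype C] [DecidableEq C] {cl : C → U} (hcl : cl.Injective)
    {Ψ : Op (C ⊕ V) → Op (C ⊕ V)} (hΨ : IsLinearMap ℂ Ψ)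
    (hc : ∀ X, IsClassicalOn (Set.range Sum.inl) X → IsClassicalOn (Set.range Sum.inl) (Ψ X))
    {X : Op U} (hX : IsClassicalOn (Set.range cl) X) (ρ : Op V) :
    onWires (Sum.map cl id) Ψ (tens X ρ) =
      ∑ c, ∑ c', tens (jump cl X c c') (outcome Ψ c c' ρ) := by
  classical
  have hm : (Sum.map cl id : C ⊕ V → U ⊕ V).Injective := hcl.sumMap Function.injective_id
  have h1 : ∀ (a : C ⊕ V → Bool) (x : U ⊕ V → Bool),
      Function.extend (Sum.map cl id) a x ∘ .inl = Function.extend cl (a ∘ .inl) (x ∘ .inl) := by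
    intro a x
    funext u
    by_cases hu : ∃ i, cl i = u
    · obtain ⟨i, rfl⟩ := hu
      rw [hcl.extend_apply]
      exact hm.extend_apply a x (.inl i)
    · rw [Function.extend_apply' _ _ _ hu]
      refine Function.extend_apply' _ _ _ ?_
      rintro ⟨i | v, h⟩
      · exact hu ⟨i, Sum.inl_injective h⟩
      · cases h
  have h2 : ∀ (a : C ⊕ V → Bool) (x : U ⊕ V → Bool),
      Function.extend (Sum.map cl id) a x ∘ .inr = a ∘ .inr := by
    intro a x
    funext v
    exact hm.extend_apply a x (.inr v)
  ext x y
  -- The block on which `Ψ` acts is diagonal in the link wires, by `hX`.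
  have hM : (Matrix.of fun a b => tens X ρ (Function.extend (Sum.map cl id) a x)
      (Function.extend (Sum.map cl id) b y)) = ∑ c, X (Function.extend cl c (x ∘ .inl))
        (Function.extend cl c (y ∘ .inl)) • tens (ket c) ρ := by
    ext a b
    rw [Matrix.sum_apply]
    simp only [tens, Matrix.of_apply, h1, h2, Matrix.smul_apply, Matrix.single_apply, smul_eq_mul]
    by_cases hab : a ∘ Sum.inl = b ∘ Sum.inl
    · rw [Finset.sum_eq_single (a ∘ Sum.inl)]
      · rw [if_pos ⟨rfl, hab⟩, one_mul, hab]
      · intro c _ hne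
        rw [if_neg fun h => hne h.1]
        simp
      · exact fun h => absurd (Finset.mem_univ _) h
    · obtain ⟨i, hi⟩ := Function.ne_iff.1 hab
      rw [hX _ _ ⟨cl i, ⟨i, rfl⟩, by rwa [hcl.extend_apply, hcl.extend_apply]⟩, zero_mul]
      refine (Finset.sum_eq_zero fun c _ => ?_).symm
      rw [if_neg fun h => hab (h.1.symm.trans h.2)]
      simp
  have hk : ∀ c : C → Bool, IsClassicalOn (Set.range Sum.inl) (tens (ket c) ρ) := by
    rintro c x y ⟨_, ⟨i, rfl⟩, hi⟩
    simp only [tens, Matrix.of_apply, Matrix.single_apply]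
    rw [if_neg, zero_mul]
    rintro ⟨h, h'⟩
    exact hi (congrFun (h.symm.trans h') i)
  show Ψ _ _ _ = _
  rw [hM]
  have hs := map_sum hΨ.mk' (fun c => X (Function.extend cl c (x ∘ .inl))
        (Function.extend cl c (y ∘ .inl)) • tens (ket c) ρ) Finset.univ
  simp only [IsLinearMap.mk'_apply, hΨ.map_smul] at hs
  rw [hs, Matrix.sum_apply, Matrix.sum_apply]
  refine Finset.sum_congr rfl fun c _ => ?_
  rw [Matrix.sum_apply, Matrix.smul_apply, smul_eq_mul]
  by_cases hxy : x ∘ Sum.inl ∘ cl = y ∘ Sum.inl ∘ cl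
  · rw [Finset.sum_eq_single (x ∘ Sum.inl ∘ cl)]
    · have e1 : ∀ z : U ⊕ V → Bool, z ∘ Sum.map cl id = Sum.elim (z ∘ Sum.inl ∘ cl) (z ∘ .inr) := by
        intro z
        funext w
        rcases w with w | w <;> rfl
      simp only [tens, Matrix.of_apply, jump, outcome, Matrix.submatrix_apply, e1]
      rw [if_pos ⟨rfl, hxy.symm⟩, hxy]
    · intro c' _ hne
      simp only [tens, Matrix.of_apply, jump]
      rw [if_neg fun h => hne h.1.symm, zero_mul]
    · exact fun h => absurd (Finset.mem_univ _) h
  · obtain ⟨i, hi⟩ := Function.ne_iff.1 hxy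
    rw [hc _ (hk c) _ _ ⟨.inl i, ⟨i, rfl⟩, hi⟩, mul_zero]
    refine (Finset.sum_eq_zero fun c' _ => ?_).symm
    simp only [tens, Matrix.of_apply, jump]
    rw [if_neg fun h => hxy (h.1.trans h.2.symm), zero_mul]

end Tensor

/-! ### Converters with classical interfaces -/

section Transcript

variable {U V V' C : Type} [Fintype U] [DecidableEq U] [Fintype V] [DecidableEq V]
  [Fintype V'] [DecidableEq V'] [Fintype C] [DecidableEq C]

/-- A system which communicates through the classical wires `C` only and has the private
wires `V`. -/
structure Converter (C V : Type) [Fintype C] [DecidableEq C] [Fintype V] [DecidableEq V] where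
  Ctrl : Type
  Out : Type
  [outFintype : Fintype Out]
  init : Ctrl
  op : Ctrl → Entry → Out → Op (C ⊕ V) → Op (C ⊕ V)
  next : Ctrl → Entry → Out → Move Empty × Ctrl
  completelyPositive : ∀ q e a, IsCP (op q e a)
  tracePreserving : ∀ q e ρ, ∑ a, (op q e a ρ).trace = ρ.trace
  classical : ∀ q e a ρ, IsClassicalOn (Set.range Sum.inl) ρ →
    IsClassicalOn (Set.range Sum.inl) (op q e a ρ)

attribute [instance] Converter.outFintype

/-- The state divided by its trace. -/
def normalize (σ : Op V) : Op V :=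
  open Classical in if σ.trace.re = 0 then zeroState V else σ.trace.re⁻¹ • σ

theorem trace_eq_re {σ : Op V} (hσ : σ.PosSemidef) : σ.trace = (σ.trace.re : ℂ) :=
  Complex.ext rfl (Complex.le_def.1 hσ.trace_nonneg).2.symm

theorem smul_normalize {σ : Op V} (hσ : σ.PosSemidef) : σ.trace.re • normalize σ = σ := by
  unfold normalize
  split_ifs with h
  · have h0 : σ.trace = 0 := by rw [trace_eq_re hσ, h, Complex.ofReal_zero]
    rw [h, zero_smul, hσ.trace_eq_zero_iff.1 h0]
  · rw [smul_smul, mul_inv_cancel₀ h, one_smul]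

theorem isDensity_zeroState : IsDensity (zeroState V) :=
  ⟨posSemidef_zeroState, trace_zeroState⟩

theorem isDensity_normalize {σ : Op V} (hσ : σ.PosSemidef) : IsDensity (normalize σ) := by
  unfold normalize
  split_ifs with h
  · exact isDensity_zeroState
  · refine ⟨hσ.smul (inv_nonneg.2 (trace_re_nonneg hσ)), ?_⟩
    rw [Matrix.trace_smul, trace_eq_re hσ, Complex.real_smul, Complex.ofReal_re,
      ← Complex.ofReal_mul, inv_mul_cancel₀ h, Complex.ofReal_one]

namespace Converter

variable (Z : Converter C V)

/-- One step of a converter, as seen from outside, with its classical outcome: the way of being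
activated, the classical input, the outcome, the classical output. -/
abbrev Step : Type := Entry × (C → Bool) × Z.Out × (C → Bool)

/-- The control state and the normalized private state after a list of steps, the latest step
coming first. -/
def record : List Z.Step → Z.Ctrl × Op V
  | [] => (Z.init, zeroState V)
  | (e, c, a, c') :: h => ((Z.next (record h).1 e a).2,
      normalize (outcome (Z.op (record h).1 e a) c c' (record h).2))

theorem isDensity_record (h : List Z.Step) : IsDensity (Z.record h).2 := by
  induction h with
  | nil => exact isDensity_zeroState
  | cons s h ih =>
    exact isDensity_normalize (posSemidef_outcome (Z.completelyPositive _ _ _) _ _ ih.1)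

/-- The probability of a step after the steps `h`. -/
def prob (h : List Z.Step) (e : Entry) (c : C → Bool) (a : Z.Out) (c' : C → Bool) : ℝ :=
  (outcome (Z.op (Z.record h).1 e a) c c' (Z.record h).2).trace.re

theorem prob_nonneg (h : List Z.Step) (e : Entry) (c : C → Bool) (a : Z.Out) (c' : C → Bool) :
    0 ≤ Z.prob h e c a c' :=
  trace_re_nonneg (posSemidef_outcome (Z.completelyPositive _ _ _) _ _ (Z.isDensity_record h).1)

theorem sum_prob (h : List Z.Step) (e : Entry) (c : C → Bool) :
    ∑ a, ∑ c', Z.prob h e c a c' = 1 := by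
  have h1 := Z.tracePreserving (Z.record h).1 e (tens (ket c) (Z.record h).2)
  rw [trace_tens_ket, (Z.isDensity_record h).2] at h1
  simp only [prob, ← Complex.re_sum, sum_trace_outcome, h1, Complex.one_re]

/-- This is trace preservation for `transcript`: for each input on the link, the simulated outcomes
have total probability one. -/
theorem sum_prob_mul (h : List Z.Step) (e : Entry) (ρ : Op (C ⊕ V')) :
    ∑ s : (C → Bool) × Z.Out × (C → Bool), (Z.prob h e s.1 s.2.1 s.2.2 : ℂ) *
      ∑ z : C ⊕ V' → Bool, (if z ∘ Sum.inl = s.1 then ρ z z else 0) = ρ.trace := by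
  have h3 : ∀ (c : C → Bool) (S : ℂ), ∑ a, ∑ c', (Z.prob h e c a c' : ℂ) * S = S := by
    intro c S
    have h1 : ∑ a, ∑ c', (Z.prob h e c a c' : ℂ) = 1 := by exact_mod_cast Z.sum_prob h e c
    conv_rhs => rw [← one_mul S, ← h1, Finset.sum_mul]
    exact Finset.sum_congr rfl fun a _ => (Finset.sum_mul ..).symm
  rw [Fintype.sum_prod_type]
  have h4 : ∀ c : C → Bool, ∑ y : Z.Out × (C → Bool), (Z.prob h e c y.1 y.2 : ℂ) *
      ∑ z : C ⊕ V' → Bool, (if z ∘ Sum.inl = c then ρ z z else 0) =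
      ∑ z : C ⊕ V' → Bool, (if z ∘ Sum.inl = c then ρ z z else 0) := by
    intro c
    rw [Fintype.sum_prod_type]
    exact h3 c (∑ z : C ⊕ V' → Bool, (if z ∘ Sum.inl = c then ρ z z else 0))
  refine (Finset.sum_congr rfl fun c _ => h4 c).trans ?_
  rw [Finset.sum_comm]
  simp [Matrix.trace]

theorem outcome_record (h : List Z.Step) (e : Entry) (c : C → Bool) (a : Z.Out) (c' : C → Bool) :
    outcome (Z.op (Z.record h).1 e a) c c' (Z.record h).2 =
      Z.prob h e c a c' • (Z.record ((e, c, a, c') :: h)).2 :=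
  (smul_normalize (posSemidef_outcome (Z.completelyPositive _ _ _) _ _
    (Z.isDensity_record h).1)).symm

/-- Lists of at most `N` steps. -/
abbrev History (N : ℕ) : Type := {h : List Z.Step // h.length ≤ N}

/-- Recording one more step, as long as there is room for it. -/
def push {N : ℕ} (h : Z.History N) (s : Z.Step) : Z.History N :=
  if hl : h.1.length < N then ⟨s :: h.1, hl⟩ else h

theorem isClassicalOn_smul_ket (s : Set V) (r : ℂ) (κ : V → Bool) :
    IsClassicalOn s (r • ket κ) := by
  rintro x y ⟨w, _, hw⟩
  show r * Matrix.single κ κ (1 : ℂ) x y = 0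
  rw [Matrix.single_apply, if_neg, mul_zero]
  rintro ⟨h1, h2⟩
  exact hw (congrFun (h1.symm.trans h2) w)

/-- The converter which replaces the private state of `Z` by a classical record of the steps so
far. -/
abbrev transcript (N : ℕ) (enc : Z.History N → V' → Bool) : Converter C V' where
  Ctrl := Z.History N
  Out := (C → Bool) × Z.Out × (C → Bool)
  init := ⟨[], Nat.zero_le _⟩
  op h e s X := (Z.prob h.1 e s.1 s.2.1 s.2.2 * ∑ z : C ⊕ V' → Bool,
    if z ∘ Sum.inl = s.1 then X z z else 0) • ket (Sum.elim s.2.2 (enc (Z.push h (e, s))))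
  -- When the history is full, the imitated converter cannot continue either, provided that rank
  -- plus length never exceeds `N`.
  next h e s := (if h.1.length < N then (Z.next (Z.record h.1).1 e s.2.1).1 else .hang,
    Z.push h (e, s))
  completelyPositive h e s := by
    -- One Kraus operator `√p |c', code⟩⟨z|` for each basis state `z` with link value `s.1`. The
    -- previous private wires are discarded; the history itself is kept in the control state.
    refine isCP_of_kraus (fun z : C ⊕ V' → Bool => if z ∘ Sum.inl = s.1 then
      Matrix.single (Sum.elim s.2.2 (enc (Z.push h (e, s)))) z
        (√(Z.prob h.1 e s.1 s.2.1 s.2.2) : ℂ) else 0) fun X => ?_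
    rw [Finset.mul_sum, Finset.sum_smul]
    refine Finset.sum_congr rfl fun z _ => ?_
    split_ifs
    · rw [Matrix.conjTranspose_single, Matrix.single_mul_mul_single, Matrix.smul_single]
      congr 1
      have := Real.mul_self_sqrt (Z.prob_nonneg h.1 e s.1 s.2.1 s.2.2)
      rw [smul_eq_mul, mul_one, Complex.star_def, Complex.conj_ofReal, mul_right_comm,
        ← Complex.ofReal_mul, this]
    · simp
  tracePreserving h e ρ := by
    refine Eq.trans (Finset.sum_congr rfl fun s _ => ?_) (Z.sum_prob_mul h.1 e ρ)
    rw [Matrix.trace_smul, Matrix.trace_single_eq_same, smul_eq_mul, mul_one]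
  classical _ _ _ _ _ := isClassicalOn_smul_ket _ _ _

/-- The outcome announces the link values before and after the step, so in the sum over the actual
link values a single term survives. -/
theorem outcome_transcript {N : ℕ} (enc : Z.History N → V' → Bool) (h : Z.History N) (e : Entry)
    (c₀ : C → Bool) (a : Z.Out) (c₀' c c' : C → Bool) (κ : V' → Bool) :
    outcome ((Z.transcript N enc).op h e (c₀, a, c₀')) c c' (ket κ) =
      if c = c₀ ∧ c' = c₀' then
        Z.prob h.1 e c a c' • ket (enc (Z.push h (e, c₀, a, c₀'))) else 0 := by
  have h1 : ∑ z : C ⊕ V' → Bool, (if z ∘ Sum.inl = c₀ then tens (ket c) (ket κ) z z else 0) =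
      if c = c₀ then 1 else 0 := by
    rw [← (Equiv.sumArrowEquivProdArrow C V' Bool).symm.sum_comp, Fintype.sum_prod_type,
      Finset.sum_eq_single c₀, Finset.sum_eq_single κ]
    · show (if c₀ = c₀ then ket c c₀ c₀ * ket κ κ κ else 0) = _
      simp [Matrix.single_apply]
    · intro v _ hv
      show (if c₀ = c₀ then ket c c₀ c₀ * ket κ v v else 0) = _
      simp [Matrix.single_apply, hv.symm]
    · exact fun h => absurd (Finset.mem_univ _) h
    · intro c₁ _ hc
      refine Finset.sum_eq_zero fun v _ => ?_
      exact if_neg hc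
    · exact fun h => absurd (Finset.mem_univ _) h
  ext v w
  simp only [outcome, Matrix.submatrix_apply, Matrix.smul_apply, h1]
  by_cases hc : c = c₀
  · by_cases hc' : c' = c₀'
    · subst hc hc'
      simp [Matrix.single_apply, funext_iff]
    · have : ∀ v : V' → Bool, ∀ v', Sum.elim c₀' v ≠ Sum.elim c' v' := by
        intro v v' h
        exact hc' (funext fun i => (congrFun h (.inl i)).symm)
      simp [this, hc']
  · simp [hc]

/-- The converter, in contact with the wires `cl`, as a node. -/
abbrev node (cl : C → U) : Node (U ⊕ V) where
  Ctrl := Z.Ctrl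
  Out := Z.Out
  op q e a := onWires (Sum.map cl id) (Z.op q e a)
  next q e a := ((Z.next q e a).1.map Empty.elim, (Z.next q e a).2)

omit [Fintype U] [DecidableEq U] in
theorem linear_node (cl : C → U) : (Z.node cl).Linear where
  op q e a := isLinearMap_real (onWires_linear (Z.completelyPositive q e a).linear)
  payoff q e a g h := by
    dsimp only at h
    rcases h' : (Z.next q e a).1 with _ | _ | _ | o | _
    · rw [h'] at h; cases h
    · rw [h'] at h; cases h
    · rw [h'] at h; cases h
    · exact o.elim
    · rw [h'] at h; cases h

end Converter

/-- A node which acts on the wires `U` only. -/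
abbrev outerNode {Q A : Type} [Fintype A] (act : Q → Entry → A → Op U → Op U)
    (next : Q → Entry → A → Move Unit × Q) (g : Op (U ⊕ V) → ℝ) : Node (U ⊕ V) where
  Ctrl := Q
  Out := A
  op q e a := onWires Sum.inl (act q e a)
  next q e a := ((next q e a).1.map fun _ => g, (next q e a).2)

section Main

variable {Q A : Type} [Fintype A] {act : Q → Entry → A → Op U → Op U}
  {next : Q → Entry → A → Move Unit × Q}

omit [Fintype V] [DecidableEq V] in
theorem linear_outerNode (hact : ∀ q e a, IsCP (act q e a)) {g : Op (U ⊕ V) → ℝ}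
    (hg : IsLinearMap ℝ g) : (outerNode act next g).Linear where
  op q e a := isLinearMap_real (onWires_linear (hact q e a).linear)
  payoff q e a g' h := by
    dsimp only at h
    rcases h' : (next q e a).1 with _ | _ | _ | o | _ <;> rw [h'] at h <;> cases h
    exact hg

theorem afterMove_converter_linear (Z : Converter C V) (cl : C → U)
    (hact : ∀ q e a, IsCP (act q e a)) {g : Op (U ⊕ V) → ℝ} (hg : IsLinearMap ℝ g) (t : ℕ)
    (c : Q) (p : Move Empty × Z.Ctrl) :
    IsLinearMap ℝ fun μ => afterMove (ringValue t) (Z.node cl) [⟨outerNode act next g, c⟩] μ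
      (p.1.map Empty.elim, p.2) := by
  have hl : ∀ z', ∀ s' ∈ [(⟨Z.node cl, z'⟩ : NodeState (U ⊕ V)), ⟨outerNode act next g, c⟩],
      s'.node.Linear := by
    intro z' s' hs'
    simp only [List.mem_cons, List.not_mem_nil, or_false] at hs'
    rcases hs' with rfl | rfl
    · exact Z.linear_node cl
    · exact linear_outerNode hact hg
  rcases p with ⟨_ | _ | _ | o | _, z'⟩
  · exact ringValue_linear t _ _ _ fun s' hs' => hl z' s' (mem_goLeft hs')
  · exact ringValue_linear t _ _ _ fun s' hs' => hl z' s' (mem_goRight hs')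
  · exact ringValue_linear t _ _ _ (hl z')
  · exact o.elim
  · exact ⟨fun _ _ => (add_zero _).symm, fun _ _ => (smul_zero _).symm⟩

/-- A step of the converter. -/
theorem ringValue_converter (Z : Converter C V) {cl : C → U} (hcl : cl.Injective)
    (hact : ∀ q e a, IsCP (act q e a)) {g : Op (U ⊕ V) → ℝ} (hg : IsLinearMap ℝ g) (t : ℕ)
    (e : Entry) (c : Q) (z : Z.Ctrl) {X : Op U} (hX : IsClassicalOn (Set.range cl) X) (ρ : Op V) :
    ringValue (t + 1) e ⟨Z.node cl, z⟩ [⟨outerNode act next g, c⟩] (tens X ρ) =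
      ∑ a, ∑ x, ∑ x', afterMove (ringValue t) (Z.node cl) [⟨outerNode act next g, c⟩]
        (tens (jump cl X x x') (outcome (Z.op z e a) x x' ρ))
        ((Z.next z e a).1.map Empty.elim, (Z.next z e a).2) := by
  refine Finset.sum_congr rfl fun a _ => ?_
  have h := onWires_tens hcl (Z.completelyPositive z e a).linear (Z.classical z e a) hX ρ
  have key := afterMove_converter_linear (next := next) Z cl hact hg t c (Z.next z e a)
  have e1 : ∀ ι : Type, ∀ _ : Fintype ι, ∀ f : ι → Op (U ⊕ V), _ := fun ι _ f =>
    map_sum key.mk' f Finset.univ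
  simp only [IsLinearMap.mk'_apply] at e1
  show afterMove (ringValue t) (Z.node cl) _ (onWires (Sum.map cl id) (Z.op z e a) (tens X ρ)) _ = _
  rw [h]
  refine (e1 _ inferInstance _).trans (Finset.sum_congr rfl fun x _ => ?_)
  exact e1 _ inferInstance _

/-- The rest of the world cannot distinguish a converter from its transcript. -/
theorem ringValue_transcript (Z : Converter C V) {rank : Z.Ctrl → ℕ} {N : ℕ}
    (hrank : ∀ q e a, (Z.next q e a).1.Continues → rank (Z.next q e a).2 < rank q)
    {cl : C → U} (hcl : cl.Injective) (enc : Z.History N → V' → Bool)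
    (hact : ∀ q e a, IsCP (act q e a))
    (hcls : ∀ q e a X, IsClassicalOn (Set.range cl) X → IsClassicalOn (Set.range cl) (act q e a X))
    {g : Op (U ⊕ V) → ℝ} (hg : IsLinearMap ℝ g) {g' : Op (U ⊕ V') → ℝ} (hg' : IsLinearMap ℝ g')
    (hgg : ∀ (h : Z.History N) X, X.PosSemidef →
      g' (tens X (ket (enc h))) = g (tens X (Z.record h.1).2)) (t : ℕ) :
    (∀ (h : Z.History N), rank (Z.record h.1).1 + h.1.length ≤ N → ∀ e c X, X.PosSemidef →
      IsClassicalOn (Set.range cl) X →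
      ringValue t e ⟨outerNode act next g', c⟩ [⟨(Z.transcript N enc).node cl, h⟩]
        (tens X (ket (enc h))) =
      ringValue t e ⟨outerNode act next g, c⟩ [⟨Z.node cl, (Z.record h.1).1⟩]
        (tens X (Z.record h.1).2)) ∧
    ∀ (h : Z.History N), rank (Z.record h.1).1 + h.1.length ≤ N → ∀ e c X, X.PosSemidef →
      IsClassicalOn (Set.range cl) X →
      ringValue t e ⟨(Z.transcript N enc).node cl, h⟩ [⟨outerNode act next g', c⟩]
        (tens X (ket (enc h))) =
      ringValue t e ⟨Z.node cl, (Z.record h.1).1⟩ [⟨outerNode act next g, c⟩]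
        (tens X (Z.record h.1).2) := by
  -- Invariant: the private states are `ket (enc h)` and the normalized state determined by `h`,
  -- next to the same outer state. The bound on rank plus length ensures that there is room for
  -- every step after which the run goes on.
  induction t with
  | zero => exact ⟨fun _ _ _ _ _ _ _ => rfl, fun _ _ _ _ _ _ _ => rfl⟩
  | succ t ih =>
    constructor
    · intro h hh e c X hp hc
      refine Finset.sum_congr rfl fun a _ => ?_
      have h1 := onWires_inl_tens (hact c e a).linear X (ket (enc h))
      have h2 := onWires_inl_tens (hact c e a).linear X (Z.record h.1).2
      have hp' := (hact c e a).posSemidef hp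
      have hc' := hcls c e a X hc
      show afterMove (ringValue t) (outerNode act next g') _ (onWires Sum.inl (act c e a) _) _ =
        afterMove (ringValue t) (outerNode act next g) _ (onWires Sum.inl (act c e a) _) _
      rw [h1, h2]
      dsimp only
      rcases next c e a with ⟨_ | _ | _ | o | _, c'⟩
      · exact ih.2 h hh _ _ _ hp' hc'
      · exact ih.2 h hh _ _ _ hp' hc'
      · exact ih.1 h hh _ _ _ hp' hc'
      · exact hgg h _ hp'
      · rfl
    · intro h hh e c X hp hc
      rw [ringValue_converter Z hcl hact hg t e c _ hc,
        ringValue_converter (Z.transcript N enc) hcl hact hg' t e c h hc]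
      -- Both sides carry the factor `Z.prob`, which linearity removes; what remains is the
      -- induction hypothesis for the extended history.
      have key : ∀ (a : Z.Out) (x x' : C → Bool),
          afterMove (ringValue t) ((Z.transcript N enc).node cl) [⟨outerNode act next g', c⟩]
            (tens (jump cl X x x') (Z.prob h.1 e x a x' •
              ket (enc (Z.push h (e, x, a, x')))))
            ((((Z.transcript N enc).next h e (x, a, x')).1).map Empty.elim,
              Z.push h (e, x, a, x')) =
          afterMove (ringValue t) (Z.node cl) [⟨outerNode act next g, c⟩]
            (tens (jump cl X x x') (outcome (Z.op (Z.record h.1).1 e a) x x' (Z.record h.1).2))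
            ((Z.next (Z.record h.1).1 e a).1.map Empty.elim, (Z.next (Z.record h.1).1 e a).2) := by
        intro a x x'
        have hn : (Z.next (Z.record h.1).1 e a).1.Continues → h.1.length < N ∧
            rank (Z.record (Z.push h (e, x, a, x')).1).1 + (Z.push h (e, x, a, x')).1.length ≤ N := by
          intro hcont
          have h1 := hrank _ e a hcont
          have hl : h.1.length < N := by omega
          refine ⟨hl, ?_⟩
          simp only [Converter.push, dif_pos hl, Converter.record, List.length_cons]
          omega
        have hpush : h.1.length < N → (Z.push h (e, x, a, x')).1 = (e, x, a, x') :: h.1 := by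
          intro hl
          simp only [Converter.push, dif_pos hl]
        have hjp := posSemidef_jump cl hp x x'
        have hjc := isClassicalOn_jump cl X x x'
        rw [Z.outcome_record, tens_smul, tens_smul]
        refine ((afterMove_converter_linear (next := next) (Z.transcript N enc) cl hact hg' t c
          ((Z.transcript N enc).next h e (x, a, x'))).map_smul _ _).trans (Eq.trans ?_
            ((afterMove_converter_linear (next := next) Z cl hact hg t c
              (Z.next (Z.record h.1).1 e a)).map_smul _ _).symm)
        congr 1
        by_cases hl : h.1.length < N
        · have h4 := ih.1 (Z.push h (e, x, a, x'))
          have h5 := ih.2 (Z.push h (e, x, a, x'))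
          have h6 : (Z.record (Z.push h (e, x, a, x')).1).1 = (Z.next (Z.record h.1).1 e a).2 := by
            rw [hpush hl]
            rfl
          rw [h6, hpush hl] at h4 h5
          rw [h6, hpush hl] at hn
          simp only [if_pos hl]
          rcases hm : Z.next (Z.record h.1).1 e a with ⟨_ | _ | _ | o | _, z'⟩
          · rw [hm] at h4 hn
            exact h4 (hn trivial).2 _ _ _ hjp hjc
          · rw [hm] at h4 hn
            exact h4 (hn trivial).2 _ _ _ hjp hjc
          · rw [hm] at h5 hn
            exact h5 (hn trivial).2 _ _ _ hjp hjc
          · exact o.elim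
          · rfl
        -- For a full history the invariant excludes a continuing move, and there are no outputs. So
        -- `Z` hangs, as its transcript does.
        · simp only [if_neg hl]
          rcases hm : Z.next (Z.record h.1).1 e a with ⟨_ | _ | _ | o | _, z'⟩
          · exact absurd (hn (by rw [hm]; trivial)).1 hl
          · exact absurd (hn (by rw [hm]; trivial)).1 hl
          · exact absurd (hn (by rw [hm]; trivial)).1 hl
          · exact o.elim
          · rfl
      have hsum : ∀ (a : Z.Out) (x x' : C → Bool), ∑ y, ∑ y',
          afterMove (ringValue t) ((Z.transcript N enc).node cl) [⟨outerNode act next g', c⟩]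
          (tens (jump cl X y y') (outcome ((Z.transcript N enc).op h e (x, a, x')) y y'
            (ket (enc h)))) ((((Z.transcript N enc).next h e (x, a, x')).1).map Empty.elim,
              Z.push h (e, x, a, x')) = afterMove (ringValue t) ((Z.transcript N enc).node cl)
                [⟨outerNode act next g', c⟩] (tens (jump cl X x x') (Z.prob h.1 e x a x' •
              ket (enc (Z.push h (e, x, a, x')))))
            ((((Z.transcript N enc).next h e (x, a, x')).1).map Empty.elim,
              Z.push h (e, x, a, x')) := by
        intro a x x'
        have h0 := (afterMove_converter_linear (next := next) (Z.transcript N enc) cl hact hg' t c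
          ((Z.transcript N enc).next h e (x, a, x'))).map_zero
        rw [Finset.sum_eq_single x, Finset.sum_eq_single x']
        · rw [Z.outcome_transcript, if_pos ⟨rfl, rfl⟩]
        · intro y' _ hy'
          rw [Z.outcome_transcript, if_neg fun h => hy' h.2, tens_zero]
          exact h0
        · exact fun h => absurd (Finset.mem_univ _) h
        · intro y _ hy
          refine Finset.sum_eq_zero fun y' _ => ?_
          rw [Z.outcome_transcript, if_neg fun h => hy h.1, tens_zero]
          exact h0
        · exact fun h => absurd (Finset.mem_univ _) h
      -- An outcome of the transcript is a triple whose first entry is the input on the link, so the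
      -- order of the sums over inputs and outcomes has to be exchanged.
      refine (Fintype.sum_prod_type _).trans ?_
      refine (Finset.sum_congr rfl fun x _ => (Fintype.sum_prod_type _).trans
        (Finset.sum_congr rfl fun a _ => Finset.sum_congr rfl fun x' _ => (hsum a x x').trans
          (key a x x'))).trans Finset.sum_comm

end Main

end Transcript

/-! ### The ring around a converter with a classical interface -/

section Split

/-- The classical wires of a converter: those of its inner interface, and the wire that is set
when the message has been delivered. -/
abbrev LinkWire (w : ℕ) : Type := Fin w ⊕ Fin 1

variable {k w c q : ℕ} {M : Type}

/-- Separating the classical wires of a converter from its private wires. -/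
def splitEmb : (classicalIface w).Wire ⊕ M ⊕ (outIface c q).Wire →
    LinkWire w ⊕ (M ⊕ (Fin c ⊕ Fin q))
  | .inl (.inl i) => .inl (.inl i)
  | .inl (.inr i) => i.elim0
  | .inr (.inl m) => .inr (.inl m)
  | .inr (.inr (.inl i)) =>
      Fin.cases (.inl (.inr 0)) (fun j => .inr (.inr (.inl j))) i
  | .inr (.inr (.inr j)) => .inr (.inr (.inr j))

/-- The inverse of `splitEmb`. -/
def joinEmb : LinkWire w ⊕ (M ⊕ (Fin c ⊕ Fin q)) →
    (classicalIface w).Wire ⊕ M ⊕ (outIface c q).Wire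
  | .inl (.inl i) => .inl (.inl i)
  | .inl (.inr _) => .inr (.inr (.inl 0))
  | .inr (.inl m) => .inr (.inl m)
  | .inr (.inr (.inl i)) => .inr (.inr (.inl i.succ))
  | .inr (.inr (.inr j)) => .inr (.inr (.inr j))

theorem joinEmb_splitEmb (x : (classicalIface w).Wire ⊕ M ⊕ (outIface c q).Wire) :
    joinEmb (splitEmb x) = x := by
  rcases x with (i | i) | m | i | j
  · rfl
  · exact i.elim0
  · rfl
  · refine Fin.cases ?_ (fun i => ?_) i <;> rfl
  · rfl

theorem splitEmb_joinEmb (x : LinkWire w ⊕ (M ⊕ (Fin c ⊕ Fin q))) :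
    splitEmb (joinEmb x) = x := by
  rcases x with (i | i) | m | i | j
  · rfl
  · obtain rfl := Subsingleton.elim i 0
    rfl
  · rfl
  · rfl
  · rfl

theorem splitEmb_injective : (splitEmb (w := w) (M := M) (c := c) (q := q)).Injective :=
  Function.LeftInverse.injective joinEmb_splitEmb

theorem joinEmb_injective : (joinEmb (w := w) (M := M) (c := c) (q := q)).Injective :=
  Function.LeftInverse.injective splitEmb_joinEmb

variable (Y : Sys (outIface k 0) (classicalIface w)) (Z : Sys (classicalIface w) (outIface c q))

/-- The wires outside of a converter on the server's side of `Y`. -/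
abbrev OuterWire : Type := Y.Wire ⊕ Fin 1

/-- Position of the classical wires of the converter. -/
def linkEmb : LinkWire w → OuterWire Y
  | .inl i => .inl (.inr (.inr (.inl i)))
  | .inr i => .inr i

theorem linkEmb_injective : (linkEmb Y).Injective := by
  rintro (i | i) (j | j) h <;> simp [linkEmb] at h <;> simp [h]

/-- Separating the private wires of the converter from the other wires of the ring. -/
def ringSplit (f : Entry ⊕ Entry) : RingWire (collector k 0 c q) (Y.compAt Z f) →
    OuterWire Y ⊕ (Z.Mem ⊕ (Fin c ⊕ Fin q))
  | .inl (.inl i) => .inl (.inl (.inl i))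
  | .inl (.inr (.inl (.inl y))) => .inl (.inl (.inr (.inl y)))
  | .inl (.inr (.inl (.inr (.inl j)))) => .inl (.inl (.inr (.inr j)))
  | .inl (.inr (.inl (.inr (.inr m)))) => .inr (.inl m)
  | .inl (.inr (.inr (.inl i))) => Fin.cases (.inl (.inr 0)) (fun j => .inr (.inr (.inl j))) i
  | .inl (.inr (.inr (.inr j))) => .inr (.inr (.inr j))
  | .inr m => m.elim

theorem ringSplit_injective (f : Entry ⊕ Entry) : (ringSplit Y Z f).Injective := by
  refine Function.LeftInverse.injective (g := fun x => match x with
    | .inl (.inl (.inl i)) => .inl (.inl i)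
    | .inl (.inl (.inr (.inl y))) => .inl (.inr (.inl (.inl y)))
    | .inl (.inl (.inr (.inr j))) => .inl (.inr (.inl (.inr (.inl j))))
    | .inl (.inr _) => .inl (.inr (.inr (.inl 0)))
    | .inr (.inl m) => .inl (.inr (.inl (.inr (.inr m))))
    | .inr (.inr (.inl j)) => .inl (.inr (.inr (.inl j.succ)))
    | .inr (.inr (.inr j)) => .inl (.inr (.inr (.inr j)))) ?_
  rintro ((i | (y | j | m) | i | j) | m)
  · rfl
  · rfl
  · rfl
  · rfl
  · refine Fin.cases ?_ (fun i => ?_) i <;> rfl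
  · rfl
  · exact m.elim

/-- The operations of the collector on the two wires which it looks at. -/
def flagOp : Entry → Bool → Op (Fin 2) → Op (Fin 2)
  | .resume, true => fun _ => 0
  | .resume, false => id
  | _, true => open Classical in project {x | x 0 = true ∧ x 1 = true}
  | _, false => open Classical in project {x | ¬ (x 0 = true ∧ x 1 = true)}

/-- The wires which the collector looks at. -/
def flagWires : Fin 2 → (collector k 0 c q).Wire := ![.inl (.inl 0), .inr (.inr (.inl 0))]

theorem flagWires_injective : (flagWires (k := k) (c := c) (q := q)).Injective := by
  intro i j h
  fin_cases i <;> fin_cases j <;> first | rfl | cases h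

theorem collector_op_eq (e : Entry) (b : Bool) :
    (collector k 0 c q).op () e b = onWires flagWires (flagOp e b) := by
  cases e <;> cases b
  · exact @project_eq_onWires _ _ _ flagWires_injective _ (_) _ _ fun _ => Iff.rfl
  · exact @project_eq_onWires _ _ _ flagWires_injective _ (_) _ _ fun _ => Iff.rfl
  · exact @project_eq_onWires _ _ _ flagWires_injective _ (_) _ _ fun _ => Iff.rfl
  · exact @project_eq_onWires _ _ _ flagWires_injective _ (_) _ _ fun _ => Iff.rfl
  · exact (onWires_id_map _ flagWires_injective).symm
  · exact (onWires_zero_map _).symm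

theorem isCP_flagOp (e : Entry) (b : Bool) : IsCP (flagOp e b) := by
  cases e <;> cases b <;> first | exact isCP_zero | exact isCP_id | exact isCP_project' _

theorem IsClassicalOn.flagOp {s : Set (Fin 2)} {X : Op (Fin 2)} (hX : IsClassicalOn s X)
    (e : Entry) (b : Bool) : IsClassicalOn s (flagOp e b X) := by
  cases e <;> cases b <;> first | exact fun _ _ _ => rfl | exact hX | exact hX.project _

/-- Position of the two wires which the collector looks at. -/
def outerFlags : Fin 2 → OuterWire Y := ![.inr 0, .inl (.inl (.inl 0))]

theorem outerFlags_injective : (outerFlags Y).Injective := by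
  intro i j h
  fin_cases i <;> fin_cases j <;> first | rfl | cases h

/-- The operations of the collector and of `Y`. -/
def outerOp (q : Unit × Y.Ctrl × (Entry ⊕ Entry)) (e : Entry) (a : Bool ⊕ Y.Out) :
    Op (OuterWire Y) → Op (OuterWire Y) :=
  match focus q.2.2 e, a with
  | .inl e', .inl b => onWires (outerFlags Y) (flagOp e' b)
  | .inr e', .inr a => onWires Sum.inl (Y.op q.2.1 e' a)
  | _, _ => fun _ => 0

/-- The control of the collector and of `Y`. -/
def outerNext (q : Unit × Y.Ctrl × (Entry ⊕ Entry)) (e : Entry) (a : Bool ⊕ Y.Out) :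
    Move Unit × Unit × Y.Ctrl × (Entry ⊕ Entry) :=
  compNext (A := Bool) (collector k 0 0 0).next (Y.liftOut Unit).next q (focus q.2.2 e) a

variable {Y} in
theorem isCP_outerOp (hY : Y.StrictlyValid) (q : Unit × Y.Ctrl × (Entry ⊕ Entry)) (e : Entry)
    (a : Bool ⊕ Y.Out) : IsCP (outerOp Y q e a) := by
  unfold outerOp
  rcases focus q.2.2 e with e' | e' <;> rcases a with a | a
  · exact (isCP_flagOp e' a).onWires (outerFlags_injective Y)
  · exact isCP_zero
  · exact isCP_zero
  · exact (hY.completelyPositive _ _ _).onWires Sum.inl_injective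

variable {Y} in
theorem classical_outerOp (hY : Y.StrictlyValid) (q : Unit × Y.Ctrl × (Entry ⊕ Entry)) (e : Entry)
    (a : Bool ⊕ Y.Out) (X : Op (OuterWire Y)) (hX : IsClassicalOn (Set.range (linkEmb Y)) X) :
    IsClassicalOn (Set.range (linkEmb Y)) (outerOp Y q e a X) := by
  unfold outerOp
  rcases focus q.2.2 e with e' | e' <;> rcases a with a | a
  · exact hX.onWires (outerFlags_injective Y) (isCP_flagOp e' a).map_zero fun Z hZ => hZ.flagOp _ _
  · exact fun _ _ _ => rfl
  · exact fun _ _ _ => rfl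
  · refine hX.onWires Sum.inl_injective (hY.completelyPositive _ _ _).map_zero
      (hY.classical _ ?_ _ _ _)
    rintro v ⟨i | i, hi⟩ <;> cases hi
    exact .inr ⟨i, rfl⟩

/-- Position of the messages. -/
def outerMessage : (Fin k ⊕ Fin 0) → OuterWire Y
  | .inl i => .inl (.inl (.inl i.succ))
  | .inr i => i.elim0

theorem outerMessage_injective : (outerMessage Y).Injective := by
  rintro (i | i) (j | j) h <;> first | exact i.elim0 | exact j.elim0 | skip
  simp [outerMessage] at h
  simp [h]

theorem splitMessage_injective : (Sum.map (outerMessage Y) (Sum.inr : Fin c ⊕ Fin q → M ⊕ _)).Injective :=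
  (outerMessage_injective Y).sumMap Sum.inr_injective

variable {Y Z}

/-- This is the shape required by `ringValue_transcript`: collector and `Y` form one node that never
touches the private wires of `Z`. The delivery flag of `Z` counts as a link wire because the
collector reads it; the message of `Z` is private, since it is looked at only by the payoff. -/
theorem output_eq_outer (hY : Y.StrictlyValid) (hZ : Z.StrictlyValid)
    (L : Op ((Fin k ⊕ Fin 0) ⊕ (Fin c ⊕ Fin q)) →+ ℝ) (t : ℕ) :
    L (outputState (Y ⋈ Z) t) = ringValue t .resume
      ⟨outerNode (V := Z.Mem ⊕ (Fin c ⊕ Fin q)) (outerOp Y) (outerNext Y)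
        (fun ρ => L (marginal (Sum.map (outerMessage Y) Sum.inr) ρ)), ((), Y.init, .inl .resume)⟩
      [⟨Z.node (Sum.map (linkEmb Y) id ∘ splitEmb) Empty.elim, Z.init⟩] (zeroState _) := by
  rw [comp_eq_compAt]
  refine (output_eq_ringValue _ L t).trans ?_
  refine (ringValue_compAt Y Z _ Sum.inl_injective _ t _ _ [] [] _ _ _ _).trans ?_
  have hι := ringSplit_injective Y Z (.inl .resume)
  refine Eq.trans (ringValue_sim (F := fill (ringSplit Y Z (.inl .resume)))
    (P := fun _ => True)
    (s' := ⟨(collector k 0 c q).node (ringSplit Y Z (.inl .resume) ∘ embEnv _ _)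
      (fun _ ρ => L (marginal (Sum.map (outerMessage Y) Sum.inr) ρ)), ()⟩)
    (l' := [⟨Y.node (Sum.inl ∘ Sum.inl) Empty.elim, Y.init⟩,
      ⟨Z.node (Sum.map (linkEmb Y) id ∘ splitEmb) Empty.elim, Z.init⟩]) ?_ ?_ trivial t .resume).symm
    ((congrArg (ringValue t .resume _ _) (fill_zeroState hι)).trans ?_)
  · refine nodeSim_fill hι _ (collector_zero k 0 c q) (embEnv_injective _ _) rfl _ _ ?_ _
    intro o ρ
    have h1 := marginal_fill hι (j := id) (e := messageWires (Y.compAt Z (.inl .resume)))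
      (messageWires_injective _) (splitMessage_injective Y) (by
        rintro ((i | i) | (i | i))
        · rfl
        · exact i.elim0
        · rfl
        · rfl) (fun v' h => absurd rfl (h v')) ρ
    rw [fill_id] at h1
    exact congrArg L h1
  · refine .cons (nodeSim_fill hι Y (fun q e a => (hY.completelyPositive q e a).map_zero)
        (Sum.inl_injective.comp (embFst_injective _ _)) ?_ _ _ (fun o => o.elim) _)
      (.cons (nodeSim_fill hι Z (fun q e a => (hZ.completelyPositive q e a).map_zero)
        (Sum.inl_injective.comp (embSnd_injective _ _)) ?_ _ _ (fun o => o.elim) _) .nil)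
    · funext w
      rcases w with i | m | j <;> rfl
    · funext w
      rcases w with (i | i) | m | i | j
      · rfl
      · exact i.elim0
      · rfl
      · refine Fin.cases ?_ (fun i => ?_) i <;> rfl
      · rfl
  -- The collector and `Y` are merged into a single node, whose operations and control are then
  -- identified with `outerOp` and `outerNext`.
  · refine (ringValue_comp_fst t .resume _ _ _ _ _ _).symm.trans ?_
    have h1 : (fun (q' : Unit × Y.Ctrl × (Entry ⊕ Entry)) (e : Entry) (a : Bool ⊕ Y.Out) =>
        Node.compOp ((collector k 0 c q).node (ringSplit Y Z (.inl .resume) ∘ embEnv _ _)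
          (fun _ ρ => L (marginal (Sum.map (outerMessage Y) Sum.inr) ρ)))
          (Y.node (Sum.inl ∘ Sum.inl) Empty.elim) q'.1 q'.2.1 (focus q'.2.2 e) a) =
        fun q' e a => onWires Sum.inl (outerOp Y q' e a) := by
      funext q' e a
      unfold outerOp
      rcases focus q'.2.2 e with e' | e' <;> rcases a with a | a
      · show onWires _ ((collector k 0 c q).op () e' a) = onWires Sum.inl (onWires _ _)
        rw [collector_op_eq, onWires_comp (hι.comp (embEnv_injective _ _)) flagWires_injective,
          onWires_comp Sum.inl_injective (outerFlags_injective Y)]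
        congr 1
        funext i
        fin_cases i <;> rfl
      · exact (onWires_zero_map _).symm
      · exact (onWires_zero_map _).symm
      · exact (onWires_comp Sum.inl_injective Sum.inl_injective _).symm
    have h2 : (fun (q' : Unit × Y.Ctrl × (Entry ⊕ Entry)) (e : Entry) (a : Bool ⊕ Y.Out) =>
        compNext ((collector k 0 c q).node (ringSplit Y Z (.inl .resume) ∘ embEnv _ _)
          (fun _ ρ => L (marginal (Sum.map (outerMessage Y) Sum.inr) ρ))).next
          (Y.node (Sum.inl ∘ Sum.inl) Empty.elim).next q' (focus q'.2.2 e) a) =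
        fun q' e a => ((outerNext Y q' e a).1.map
          fun _ ρ => L (marginal (Sum.map (outerMessage Y) Sum.inr) ρ), (outerNext Y q' e a).2) := by
      funext q' e a
      unfold outerNext
      rcases focus q'.2.2 e with e' | e' <;> rcases a with a | a
      · cases e' <;> cases a <;> rfl
      · rfl
      · rfl
      · simp only [compNext]
        show _ = (Move.map _ (moveSnd (Move.map Empty.elim (Y.next q'.2.1 e' a).1)).1, _)
        rcases (Y.next q'.2.1 e' a).1 with _ | _ | _ | o | _ <;> first | exact o.elim | rfl
    exact congrArg₂ (fun op nx => ringValue t .resume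
      (⟨⟨Unit × Y.Ctrl × (Entry ⊕ Entry), Bool ⊕ Y.Out, op, nx⟩, ((), Y.init, .inl .resume)⟩ :
        NodeState (OuterWire Y ⊕ (Z.Mem ⊕ (Fin c ⊕ Fin q))))
      [⟨Z.node (Sum.map (linkEmb Y) id ∘ splitEmb) Empty.elim, Z.init⟩] (zeroState _)) h1 h2

end Split

/-! ### Classical descriptions of the messages of a converter -/

section Describe

variable {k w c q : ℕ}

/-- A converter with a classical inner interface, seen as one with classical wires and private
wires. -/
abbrev toConverter (B : Sys (classicalIface w) (outIface c q)) (hB : B.StrictlyValid) :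
    Converter (LinkWire w) (B.Mem ⊕ (Fin c ⊕ Fin q)) where
  Ctrl := B.Ctrl
  Out := B.Out
  init := B.init
  op q e a := onWires splitEmb (B.op q e a)
  next := B.next
  completelyPositive q e a := (hB.completelyPositive q e a).onWires splitEmb_injective
  tracePreserving q e ρ := by
    simp only [trace_onWires splitEmb_injective (hB.completelyPositive _ _ _).linear]
    rw [hB.tracePreserving, trace_marginal splitEmb_injective]
  classical q e a ρ hρ := by
    refine hρ.onWires splitEmb_injective (hB.completelyPositive _ _ _).map_zero
      (hB.classical _ ?_ _ _ _)
    rintro ((i | i) | m | i | j) ⟨v, hv⟩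
    · exact .inl ⟨i, rfl⟩
    · exact i.elim0
    · cases hv
    · exact .inr ⟨i, rfl⟩
    · cases hv

/-- A converter with classical wires and private wires, as a system. -/
abbrev fromConverter {M : Type} [Fintype M] [DecidableEq M]
    (K : Converter (LinkWire w) (M ⊕ (Fin c ⊕ Fin q))) [Fintype K.Ctrl] :
    Sys (classicalIface w) (outIface c q) where
  Mem := M
  Ctrl := K.Ctrl
  Out := K.Out
  init := K.init
  op q e a := onWires joinEmb (K.op q e a)
  next := K.next

theorem strictlyValid_fromConverter {M : Type} [Fintype M] [DecidableEq M]
    (K : Converter (LinkWire w) (M ⊕ (Fin c ⊕ Fin q))) [Fintype K.Ctrl]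
    (hK : ∀ s q e a ρ, IsClassicalOn s (K.op q e a ρ)) : (fromConverter K).StrictlyValid where
  completelyPositive q e a := (K.completelyPositive q e a).onWires joinEmb_injective
  tracePreserving q e ρ := by
    simp only [trace_onWires joinEmb_injective (K.completelyPositive _ _ _).linear]
    rw [K.tracePreserving, trace_marginal joinEmb_injective]
  classical _ _ q e a _ hρ := hρ.onWires joinEmb_injective (K.completelyPositive _ _ _).map_zero
    fun _ _ => hK _ _ _ _ _

theorem nodeState_toConverter {U : Type} {cl : LinkWire w → U} (hcl : cl.Injective)
    (B : Sys (classicalIface w) (outIface c q)) (hB : B.StrictlyValid) (q₀ : B.Ctrl) :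
    (⟨B.node (Sum.map cl id ∘ splitEmb) Empty.elim, q₀⟩ : NodeState _) =
      ⟨(toConverter B hB).node cl, q₀⟩ := by
  have h : (fun q e a => onWires (Sum.map cl id ∘ splitEmb) (B.op q e a)) =
      fun q e a => onWires (Sum.map cl id) (onWires splitEmb (B.op q e a)) := by
    funext q e a
    exact (onWires_comp (hcl.sumMap Function.injective_id) splitEmb_injective _).symm
  exact congrArg (fun op => NodeState.mk (Node.mk _ _ op _) q₀) h

theorem nodeState_fromConverter {U M : Type} [Fintype M] [DecidableEq M] {cl : LinkWire w → U}
    (hcl : cl.Injective) (K : Converter (LinkWire w) (M ⊕ (Fin c ⊕ Fin q))) [Fintype K.Ctrl]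
    (q₀ : K.Ctrl) :
    (⟨(fromConverter K).node (Sum.map cl id ∘ splitEmb) Empty.elim, q₀⟩ : NodeState _) =
      ⟨K.node cl, q₀⟩ := by
  have h : (fun q e a => onWires (Sum.map cl id ∘ splitEmb) (onWires joinEmb (K.op q e a))) =
      fun q e a => onWires (Sum.map cl id) (K.op q e a) := by
    funext q e a
    rw [onWires_comp ((hcl.sumMap Function.injective_id).comp splitEmb_injective)
      joinEmb_injective]
    congr 1
    funext x
    exact congrArg _ (splitEmb_joinEmb x)
  exact congrArg (fun op => NodeState.mk (Node.mk _ _ op _) q₀) h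

theorem marginal_tens {U V U' V' : Type} [Fintype U] [DecidableEq U] [Fintype V] [DecidableEq V]
    [Fintype U'] [DecidableEq U'] [Fintype V'] [DecidableEq V'] {e : U → U'} (he : e.Injective)
    {f : V → V'} (hf : f.Injective) (X : Op U') (ρ : Op V') :
    marginal (Sum.map e f) (tens X ρ) = tens (marginal e X) (marginal f ρ) := by
  ext a b
  have h1 : ∀ x : U' ⊕ V' → Bool, Function.extend (Sum.map e f) b x ∘ .inl =
      Function.extend e (b ∘ .inl) (x ∘ .inl) := by
    intro x
    funext u
    by_cases h : ∃ v, e v = u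
    · obtain ⟨v, rfl⟩ := h
      rw [he.extend_apply]
      exact (he.sumMap hf).extend_apply b x (.inl v)
    · rw [Function.extend_apply' _ _ _ h]
      refine Function.extend_apply' _ _ _ ?_
      rintro ⟨v | v, hv⟩
      · exact h ⟨v, Sum.inl_injective hv⟩
      · cases hv
  have h2 : ∀ x : U' ⊕ V' → Bool, Function.extend (Sum.map e f) b x ∘ .inr =
      Function.extend f (b ∘ .inr) (x ∘ .inr) := by
    intro x
    funext u
    by_cases h : ∃ v, f v = u
    · obtain ⟨v, rfl⟩ := h
      rw [hf.extend_apply]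
      exact (he.sumMap hf).extend_apply b x (.inr v)
    · rw [Function.extend_apply' _ _ _ h]
      refine Function.extend_apply' _ _ _ ?_
      rintro ⟨v | v, hv⟩
      · cases hv
      · exact h ⟨v, Sum.inr_injective hv⟩
  simp only [marginal, tens, Matrix.of_apply, h1, h2]
  rw [← (Equiv.sumArrowEquivProdArrow U' V' Bool).symm.sum_comp, Fintype.sum_prod_type,
    Finset.sum_mul_sum]
  refine Finset.sum_congr rfl fun x _ => Finset.sum_congr rfl fun y _ => ?_
  have h3 : ((Equiv.sumArrowEquivProdArrow U' V' Bool).symm (x, y) ∘ Sum.map e f = a) ↔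
      x ∘ e = a ∘ .inl ∧ y ∘ f = a ∘ .inr := by
    simp only [funext_iff, Sum.forall]
    rfl
  simp only [h3]
  by_cases hx : x ∘ e = a ∘ .inl <;> by_cases hy : y ∘ f = a ∘ .inr <;> simp [hx, hy]; rfl

theorem marginal_ket {V W : Type} [Fintype V] [DecidableEq V] [Fintype W] [DecidableEq W]
    {e : V → W} (he : e.Injective) (κ : W → Bool) : marginal e (ket κ) = ket (κ ∘ e) := by
  ext a b
  simp only [marginal, Matrix.of_apply, Matrix.single_apply]
  rw [Finset.sum_eq_single κ]
  · have : κ ∘ e = a → (κ = Function.extend e b κ ↔ κ ∘ e = b) := by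
      rintro -
      refine ⟨fun h => by rw [h, Function.extend_comp he], fun h => ?_⟩
      rw [← h, extend_comp_self he]
    by_cases h : κ ∘ e = a <;> simp [h, this]
  · intro x _ hx
    simp [hx.symm]
  · simp

/-- The state of the quantum message in the private state of a converter. -/
abbrev quantumMessage {M : Type} [Fintype M] [DecidableEq M] {d : ℕ}
    (ρ : Op (M ⊕ (Fin 0 ⊕ Fin d))) : Op (Fin d) :=
  marginal (Sum.inr ∘ Sum.inr) ρ

theorem isDensity_quantumMessage {M : Type} [Fintype M] [DecidableEq M] {d : ℕ}
    {ρ : Op (M ⊕ (Fin 0 ⊕ Fin d))} (hρ : IsDensity ρ) : IsDensity (quantumMessage ρ) :=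
  ⟨posSemidef_marginal (Sum.inr_injective.comp Sum.inr_injective) hρ.1,
    (trace_marginal (Sum.inr_injective.comp Sum.inr_injective) ρ).trans hρ.2⟩

theorem quantumMessage_eq {M : Type} [Fintype M] [DecidableEq M] {d : ℕ}
    (ρ : Op (M ⊕ (Fin 0 ⊕ Fin d))) : quantumMessage ρ =
      (marginal Sum.inr ρ).submatrix (Sum.elim Fin.elim0) (Sum.elim Fin.elim0) := by
  ext a b
  refine Finset.sum_congr rfl fun x _ => ?_
  have h1 : x ∘ Sum.inr = Sum.elim Fin.elim0 a ↔ x ∘ Sum.inr ∘ Sum.inr = a := by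
    simp only [funext_iff, Sum.forall]
    exact ⟨fun h => h.2, fun h => ⟨fun i => i.elim0, h⟩⟩
  have h2 : Function.extend Sum.inr (Sum.elim Fin.elim0 b) x =
      Function.extend (Sum.inr ∘ Sum.inr) b x := by
    funext y
    rcases y with m | i | j
    · rw [Function.extend_apply' _ _ _ (by simp), Function.extend_apply' _ _ _ (by simp)]
    · exact i.elim0
    · rw [Sum.inr_injective.extend_apply]
      exact ((Sum.inr_injective.comp Sum.inr_injective).extend_apply b x j).symm
  simp only [h1, h2]

variable {k' d : ℕ}

/-- The expected overlap of the states described by two classical messages. -/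
def describedOverlap (desc : (Fin k → Bool) → Op (Fin d)) (desc' : (Fin k' → Bool) → Op (Fin d)) :
    Op ((Fin k ⊕ Fin 0) ⊕ (Fin k' ⊕ Fin 0)) →+ ℝ where
  toFun μ := ∑ κ : Fin k → Bool, ∑ κ' : Fin k' → Bool,
    (μ (Sum.elim (Sum.elim κ Fin.elim0) (Sum.elim κ' Fin.elim0))
      (Sum.elim (Sum.elim κ Fin.elim0) (Sum.elim κ' Fin.elim0))).re *
    (Matrix.trace (desc κ * desc' κ')).re
  map_zero' := by simp
  map_add' μ ν := by
    simp only [← Finset.sum_add_distrib, Matrix.add_apply, Complex.add_re, add_mul]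

theorem expectedDescribedOverlap_eq (Z : Sys (outIface k 0) (outIface k' 0))
    (desc : (Fin k → Bool) → Op (Fin d)) (desc' : (Fin k' → Bool) → Op (Fin d)) :
    expectedDescribedOverlap Z desc desc' =
      ⨆ t, describedOverlap desc desc' (outputState Z t) := rfl

theorem describedOverlap_tens (desc : (Fin k → Bool) → Op (Fin d))
    (desc' : (Fin k' → Bool) → Op (Fin d)) (X : Op (Fin k ⊕ Fin 0)) (κ' : Fin k' → Bool) :
    describedOverlap desc desc' (tens X (ket (Sum.elim κ' Fin.elim0))) =
      ∑ κ, (X (Sum.elim κ Fin.elim0) (Sum.elim κ Fin.elim0)).re *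
        (Matrix.trace (desc κ * desc' κ')).re := by
  refine Finset.sum_congr rfl fun κ _ => ?_
  rw [Finset.sum_eq_single κ']
  · congr 2
    show X _ _ * ket _ _ _ = X _ _
    exact (congrArg _ (Matrix.single_apply_same _ _ _)).trans (mul_one _)
  · intro κ₁ _ h
    have h0 : ket (Sum.elim κ' Fin.elim0 : Fin k' ⊕ Fin 0 → Bool) (Sum.elim κ₁ Fin.elim0)
        (Sum.elim κ₁ Fin.elim0) = 0 := by
      refine (Matrix.single_apply _ _ _ _ _).trans (if_neg ?_)
      rintro ⟨h1, -⟩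
      exact h (funext fun i => (congrFun h1 (.inl i)).symm)
    have h1 : tens X (ket (Sum.elim κ' Fin.elim0 : Fin k' ⊕ Fin 0 → Bool))
        (Sum.elim (Sum.elim κ Fin.elim0) (Sum.elim κ₁ Fin.elim0))
        (Sum.elim (Sum.elim κ Fin.elim0) (Sum.elim κ₁ Fin.elim0)) = 0 :=
      (congrArg (X (Sum.elim κ Fin.elim0) (Sum.elim κ Fin.elim0) * ·) h0).trans (mul_zero _)
    rw [h1, Complex.zero_re, zero_mul]
  · exact fun h => absurd (Finset.mem_univ _) h

theorem overlap_tens (desc : (Fin k → Bool) → Op (Fin d)) {X : Op (Fin k ⊕ Fin 0)}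
    (hX : X.PosSemidef) (ρ : Op (Fin 0 ⊕ Fin d)) : overlap desc (tens X ρ) =
      ∑ κ, (X (Sum.elim κ Fin.elim0) (Sum.elim κ Fin.elim0)).re * (Matrix.trace (desc κ *
        ρ.submatrix (Sum.elim Fin.elim0) (Sum.elim Fin.elim0))).re := by
  refine Finset.sum_congr rfl fun κ _ => ?_
  have h : messageBlock κ (tens X ρ) = X (Sum.elim κ Fin.elim0) (Sum.elim κ Fin.elim0) •
      ρ.submatrix (Sum.elim Fin.elim0) (Sum.elim Fin.elim0) := rfl
  have h0 : (X (Sum.elim κ Fin.elim0) (Sum.elim κ Fin.elim0)).im = 0 :=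
    (Complex.le_def.1 (hX.diag_nonneg (i := Sum.elim κ Fin.elim0))).2.symm
  rw [h, Matrix.mul_smul, Matrix.trace_smul, smul_eq_mul, Complex.mul_re, h0, zero_mul, sub_zero]

theorem isLinearMap_overlap (desc : (Fin k → Bool) → Op (Fin d)) :
    IsLinearMap ℝ (overlap desc) where
  map_add := map_add _
  map_smul r μ := by
    refine Eq.trans ?_ (Finset.mul_sum ..).symm
    refine Finset.sum_congr rfl fun κ _ => ?_
    have h : messageBlock κ (r • μ) = r • messageBlock κ μ := rfl
    rw [h, Matrix.mul_smul, Matrix.trace_smul, Complex.smul_re, smul_eq_mul]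

theorem isLinearMap_describedOverlap (desc : (Fin k → Bool) → Op (Fin d))
    (desc' : (Fin k' → Bool) → Op (Fin d)) : IsLinearMap ℝ (describedOverlap desc desc') where
  map_add := map_add _
  map_smul r μ := by
    refine Eq.trans ?_ (Finset.mul_sum ..).symm
    refine Finset.sum_congr rfl fun κ _ => ?_
    rw [Finset.mul_sum]
    refine Finset.sum_congr rfl fun κ' _ => ?_
    rw [Matrix.smul_apply, Complex.smul_re, smul_eq_mul, mul_assoc]

/-- Every finite type with a distinguished element can be encoded as bit strings, the
distinguished element as a string of zeros. -/
theorem exists_code (H : Type) [Finite H] (h₀ : H) :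
    ∃ (k : ℕ) (code : H → Fin k → Bool), code.Injective ∧ code h₀ = fun _ => false := by
  classical
  obtain ⟨k, ⟨e⟩⟩ := Finite.exists_equiv_fin H
  refine ⟨k, fun h i => decide (h ≠ h₀ ∧ e h = i), fun h h' hh => ?_, by simp⟩
  have h1 := congrFun hh (e h)
  have h2 := congrFun hh (e h')
  simp only [decide_eq_decide, e.apply_eq_iff_eq, and_true] at h1 h2
  by_cases hz : h = h₀
  · by_cases hz' : h' = h₀
    · exact hz.trans hz'.symm
    · exact (h2.2 hz').2
  · exact (h1.1 hz).2.symm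

/-- `P` runs the transcript of `B` and delivers the code of its history; `desc'` decodes the history
and returns the reduced state of the message. The choice depends only on `B` and `N`, so it serves
every `Y` and every number of steps. -/
theorem exists_described (B : Sys (classicalIface w) (outIface 0 d)) (hB : B.StrictlyValid)
    {N : ℕ} (hN : B.RunsWithin N) :
    ∃ (k' : ℕ) (P : Sys (classicalIface w) (outIface k' 0)) (desc' : (Fin k' → Bool) → Op (Fin d)),
      P.StrictlyValid ∧ P.RunsWithin N ∧ (∀ κ', IsDensity (desc' κ')) ∧
      ∀ (k : ℕ) (Y : Sys (outIface k 0) (classicalIface w)), Y.StrictlyValid →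
        ∀ (desc : (Fin k → Bool) → Op (Fin d)) (t : ℕ),
          describedOverlap desc desc' (outputState (Y ⋈ P) t) =
            overlap desc (outputState (Y ⋈ B) t) := by
  classical
  let Z := toConverter B hB
  have : Finite (Z.History N) := (List.finite_length_le Z.Step N).to_subtype
  obtain ⟨k', code, hcode, hinit⟩ := exists_code (Z.History N) ⟨[], Nat.zero_le _⟩
  -- The code occupies the message wires from the start and is updated in every step; no further
  -- memory is needed.
  let enc : Z.History N → Empty ⊕ (Fin k' ⊕ Fin 0) → Bool :=
    fun h => Sum.elim Empty.elim (Sum.elim (code h) Fin.elim0)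
  let _ : Fintype (Z.transcript N enc).Ctrl := Fintype.ofFinite (Z.History N)
  have : Nonempty (Z.History N) := ⟨⟨[], Nat.zero_le _⟩⟩
  have hP : (fromConverter (Z.transcript N enc)).StrictlyValid :=
    strictlyValid_fromConverter _ fun _ _ _ _ _ => Converter.isClassicalOn_smul_ket _ _ _
  refine ⟨k', fromConverter (Z.transcript N enc),
    -- A string that is no code is read as an arbitrary history, which still gives a density matrix.
    fun κ' => quantumMessage (Z.record (Function.invFun code κ').1).2, hP, ?_,
    fun _ => isDensity_quantumMessage (Z.isDensity_record _), ?_⟩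
  -- The rank is the room left in the history.
  · refine ⟨fun h => N - h.1.length, Nat.sub_le _ _, fun h e s hc => ?_⟩
    have hl : h.1.length < N := by
      by_contra hl
      have : (if h.1.length < N then (Z.next (Z.record h.1).1 e s.2.1).1 else .hang).Continues := hc
      rw [if_neg hl] at this
      exact this
    show N - (Z.push h (e, s)).1.length < N - h.1.length
    have : (Z.push h (e, s)).1.length = h.1.length + 1 := by
      rw [Converter.push, dif_pos hl]
      rfl
    omega
  · intro k Y hY desc t
    obtain ⟨rank, hr0, hrank⟩ := hN
    rw [output_eq_outer hY hP, output_eq_outer hY hB]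
    rw [nodeState_toConverter (linkEmb_injective Y) B hB,
      nodeState_fromConverter (linkEmb_injective Y)]
    have hz : ∀ V : Type, ∀ [Fintype V] [DecidableEq V],
        zeroState (OuterWire Y ⊕ V) = tens (zeroState (OuterWire Y)) (zeroState V) :=
      fun V _ _ => tens_zeroState.symm
    -- The empty history must have the zero code, since runs start with all wires at `|0⟩`.
    have he : enc ⟨[], Nat.zero_le _⟩ = fun _ => false := by
      funext x
      rcases x with x | x | x
      · exact x.elim
      · exact congrFun hinit x
      · exact x.elim0
    have hk : zeroState (Empty ⊕ (Fin k' ⊕ Fin 0)) = ket (enc ⟨[], Nat.zero_le _⟩) := by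
      rw [he]
      rfl
    refine (congrArg _ ((hz _).trans (congrArg _ hk))).trans
      (Eq.trans ?_ (congrArg _ (hz _)).symm)
    refine (ringValue_transcript Z hrank (linkEmb_injective Y) enc (isCP_outerOp hY)
      (classical_outerOp hY) ?_ ?_ ?_ t).1 ⟨[], Nat.zero_le _⟩ ?_ _ _ _ posSemidef_zeroState
      (isClassicalOn_zeroState _)
    · exact ((isLinearMap_overlap desc).mk' _ ∘ₗ (isLinearMap_real (marginal_linear _)).mk' _).isLinear
    · exact ((isLinearMap_describedOverlap _ _).mk' _ ∘ₗ
        (isLinearMap_real (marginal_linear _)).mk' _).isLinear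
    -- Agreement of payoffs: on a product state both overlaps pair the diagonal of the outer message
    -- with the same density matrix.
    · intro h X hX
      rw [marginal_tens (outerMessage_injective Y) Sum.inr_injective,
        marginal_tens (outerMessage_injective Y) Sum.inr_injective,
        marginal_ket Sum.inr_injective]
      refine (describedOverlap_tens _ _ _ (code h)).trans (Eq.trans ?_ (overlap_tens _
        (posSemidef_marginal (outerMessage_injective Y) hX) _).symm)
      rw [Function.leftInverse_invFun hcode h, quantumMessage_eq]
    · exact hr0

end Describe

/-! ### Admissible families -/

section Feasible

variable {lev : Level} {I J K : ℕ → Iface} {O : Type}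

theorem Feasible.valid {X : ∀ n, Machine (I n) (J n) O} (hX : Feasible lev X) (n : ℕ) :
    (X n).Valid := by
  cases lev
  · exact (hX n).1
  · exact (hX.choose_spec n).1

theorem Feasible.runsWithin {X : ∀ n, Machine (I n) (J n) O} (hX : Feasible lev X) (n : ℕ) :
    ∃ N, (X n).RunsWithin N := by
  cases lev
  · exact (hX n).2
  · exact ⟨_, (hX.choose_spec n).2.2.1⟩

theorem Feasible.dephased {X : ∀ n, Machine (I n) (J n) O} (hX : Feasible lev X) :
    Feasible lev fun n => (X n).dephased := by
  cases lev
  · exact fun n => ⟨(hX n).1.dephased.valid, (hX n).2⟩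
  · obtain ⟨p, hp⟩ := hX
    exact ⟨p, fun n => ⟨(hp n).1.dephased.valid, (hp n).2.1.dephased, (hp n).2.2⟩⟩

/-- Strict validity makes the composition valid. The factor `6` counts the possible pending entries
of a composition. -/
theorem Feasible.liftOut_compAt {X : ∀ n, Sys (I n) (J n)} {Y : ∀ n, Machine (J n) (K n) O}
    (hX : Feasible lev X) (hX' : ∀ n, (X n).StrictlyValid) (hY : Feasible lev Y)
    (hY' : ∀ n, (Y n).StrictlyValid) (f : Entry ⊕ Entry) :
    Feasible lev fun n => ((X n).liftOut O).compAt (Y n) f := by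
  cases lev
  · intro n
    obtain ⟨N, hN⟩ := (hX n).2
    obtain ⟨M, hM⟩ := (hY n).2
    exact ⟨((hX' n).liftOut.compAt (hY' n) f).valid, _, hN.liftOut.compAt hM f⟩
  · obtain ⟨p, hp⟩ := hX
    obtain ⟨r, hr⟩ := hY
    refine ⟨p + r + p * r * 6, fun n => ⟨((hX' n).liftOut.compAt (hY' n) f).valid,
      (hp n).2.1.liftOut.compAt (hr n).2.1 f,
      ((hp n).2.2.1.liftOut.compAt (hr n).2.2.1 f).mono ?_, ?_⟩⟩
    · simp only [Polynomial.eval_add]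
      exact Nat.le_add_right _ _
    · rw [card_ctrl_compAt]
      have h := Nat.mul_le_mul (hp n).2.2.2 (hr n).2.2.2
      simp only [Polynomial.eval_add, Polynomial.eval_mul, Polynomial.eval_ofNat]
      exact (Nat.mul_le_mul_right 6 h).trans (Nat.le_add_left _ _)

end Feasible

/-! ### The distinguishers -/

section Distinguisher

/-- The distinguisher which lets the two converters deliver their messages and tests the quantum
message. -/
abbrev distinguisher {I J : Iface} {k d : ℕ} (A : Sys (outIface k 0) I)
    (T : Machine (classicalIface k) ⟨0, d⟩ Bool) (Q : Sys J (outIface 0 d)) : Machine J I Bool :=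
  ((Q.dephased.liftOut Bool).compAt (tester T).dephased (.inr .resume)).compAt
    (A.dephased.liftOut Bool) (.inl .resume)

theorem strictlyValid_distinguisher {I J : Iface} {k d : ℕ} {A : Sys (outIface k 0) I}
    {T : Machine (classicalIface k) ⟨0, d⟩ Bool} {Q : Sys J (outIface 0 d)} (hA : A.Valid)
    (hT : T.Valid) (hQ : Q.Valid) : (distinguisher A T Q).StrictlyValid :=
  (hQ.dephased.liftOut.compAt (valid_tester hT).dephased _).compAt hA.dephased.liftOut _

/-- The time bound comes from `RelaysWithin.runsWithin`, as the tester has none of its own; control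
states multiply, with a factor `6` for each of the two compositions. -/
theorem feasible_distinguisher {lev : Level} {I J : ℕ → Iface} {k d : ℕ → ℕ}
    {A : ∀ n, Sys (outIface (k n) 0) (I n)} {T : ∀ n, Machine (classicalIface (k n)) ⟨0, d n⟩ Bool}
    {Q : ∀ n, Sys (J n) (outIface 0 (d n))} (hA : Feasible lev A) (hT : Feasible lev T)
    (hQ : Feasible lev Q) : Feasible lev fun n => distinguisher (A n) (T n) (Q n) := by
  have hv := fun n => (strictlyValid_distinguisher (hA.valid n) (hT.valid n) (hQ.valid n)).valid
  cases lev
  · intro n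
    obtain ⟨a, ha⟩ := (hA n).2
    obtain ⟨t, ht⟩ := (hT n).2
    obtain ⟨q, hq⟩ := (hQ n).2
    exact ⟨hv n, _, RelaysWithin.runsWithin hq.dephased.liftOut (relaysWithin_tester ht)
      ha.dephased.liftOut _ _⟩
  · obtain ⟨a, ha⟩ := hA
    obtain ⟨t, ht⟩ := hT
    obtain ⟨q, hq⟩ := hQ
    refine ⟨2 * q + (t + 1) + 2 * a + 1 + q * (t + 1) * 6 * a * 6, fun n => ⟨hv n, ?_, ?_, ?_⟩⟩
    · exact ((hq n).2.1.dephased.liftOut.compAt (isElementary_tester (ht n).2.1).dephased _).compAt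
        (ha n).2.1.dephased.liftOut _
    · have h : (distinguisher (A n) (T n) (Q n)).RunsWithin _ :=
        RelaysWithin.runsWithin (hq n).2.2.1.dephased.liftOut
          (relaysWithin_tester (ht n).2.2.1) (ha n).2.2.1.dephased.liftOut _ _
      refine h.mono ?_
      simp only [Polynomial.eval_add, Polynomial.eval_mul, Polynomial.eval_ofNat,
        Polynomial.eval_one]
      exact Nat.le_add_right _ _
    · rw [card_ctrl_compAt, card_ctrl_compAt]
      simp only [Polynomial.eval_add, Polynomial.eval_mul, Polynomial.eval_ofNat,
        Polynomial.eval_one]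
      refine le_trans ?_ (Nat.le_add_left _ _)
      have h := (card_ctrl_tester (T n)).le.trans (Nat.succ_le_succ (ht n).2.2.2)
      exact Nat.mul_le_mul_right 6 (Nat.mul_le_mul (Nat.mul_le_mul_right 6
        (Nat.mul_le_mul (hq n).2.2.2 h)) (ha n).2.2.2)

variable {IA IB IB' : Iface} {k d w : ℕ} {S : Sys IA IB} {A : Sys (outIface k 0) IA}
  {T : Machine (classicalIface k) ⟨0, d⟩ Bool} {desc : (Fin k → Bool) → Op (Fin d)}

/-- Boundedness is needed to compare a term with the real supremum. The resource is often a
composition of valid machines, of which only a dephased version is known to be valid. -/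
theorem acceptProb_bddAbove {I J : Iface} {D : Machine J I Bool} {R R' : Sys I J} (hD : D.Valid)
    (hR : R.ClassicallyEq R') (hR' : R'.Valid) : BddAbove (Set.range (acceptWithin D R)) := by
  refine ⟨1, ?_⟩
  rintro _ ⟨t, rfl⟩
  rw [acceptWithin_congr hD.classicallyEq_self hR]
  exact (acceptWithin_bounds hD hR' t).2

theorem acceptWithin_testEnv_eq {I J : Iface} {A : Sys (outIface k 0) I} {Q : Sys J (outIface 0 d)}
    {R : Sys I J} (hA : A.Valid) (hT : T.Valid) (hQ : Q.Valid) (hR : R.Valid) (t : ℕ) :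
    acceptWithin (testEnv A.dephased T Q.dephased) R t = acceptWithin (distinguisher A T Q) R t :=
  acceptWithin_congr (((hQ.dephased.valid.classicallyEq_self.liftOut).compAt
    (valid_tester hT).classicallyEq_dephased _).compAt
      hA.dephased.valid.classicallyEq_self.liftOut _) hR.classicallyEq_self t

/-- The state delivered by the resource is tested successfully with high probability. -/
theorem expectedOverlap_le_acceptProb {filt : Sys IB IB'} {Q : Sys IB' (outIface 0 d)}
    (hS : S.Valid) (hA : A.Valid) (hf : filt.Valid) (hQ : Q.Valid) (hT : T.Valid) {N : ℕ}
    (hN : T.RunsWithin N)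
    (h : ∀ κ ρ, IsDensity ρ → ⨆ t : ℕ, ((soloRun T t T.init (testInput T κ ρ) true).trace).re
      = ((desc κ * ρ).trace).re) :
    expectedOverlap (A ⋈ S ⋈ filt ⋈ Q) desc ≤ acceptProb (distinguisher A T Q) (S ⋈ filt) := by
  rw [expectedOverlap_eq]
  have hSf := hS.classicallyEq_dephased.comp hf.classicallyEq_dephased
  have hD := (strictlyValid_distinguisher hA hT hQ).valid
  have hSf' := hS.dephased.comp hf.dephased
  refine ciSup_le fun t => ?_
  -- All components are dephased, and then `S` and the filter are bracketed together to become the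
  -- resource that the distinguisher tests.
  rw [outputState_congr (((hA.classicallyEq_dephased.comp hS.classicallyEq_dephased).comp
    hf.classicallyEq_dephased).comp hQ.classicallyEq_dephased),
    output_assoc _ _ _ _ (fun q e a => (hA.dephased.1 q e a).map_zero)
      (fun q e a => (hS.dephased.1 q e a).map_zero) (fun q e a => (hf.dephased.1 q e a).map_zero)
      (fun q e a => (hQ.dephased.1 q e a).map_zero)]
  refine (overlap_acceptWithin hA.dephased hSf' hQ.dephased hT hN h t).2.trans ?_
  rw [acceptWithin_testEnv_eq hA hT hQ hSf'.valid,
    ← acceptWithin_congr hD.classicallyEq_self hSf]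
  exact le_ciSup (acceptProb_bddAbove hD hSf hSf'.valid) _

theorem copyClassical_zero {V W : Type} [Fintype V] [Fintype W] [DecidableEq W] (src dst : V → W) :
    copyClassical src dst 0 = 0 := by
  ext x y
  simp [copyClassical]

theorem classicalChannel_op_zero (w : ℕ) (q : Unit) (e : Entry) (a : Unit) :
    (classicalChannel w).op q e a 0 = 0 := by
  cases e
  · exact copyClassical_zero _ _
  · exact copyClassical_zero _ _
  · rfl

/-- Whatever the channel reads, the result of copying is diagonal. The regrouping uses no more about
the channel than this and `op 0 = 0`. -/
theorem classicallyEq_classicalChannel (w : ℕ) :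
    (classicalChannel w).ClassicallyEq (classicalChannel w) := by
  refine .refl (classicalChannel_op_zero w) fun q e a ρ hρ => ?_
  have hc : ∀ src dst : Fin w ⊕ Fin 0 → (classicalChannel w).Wire,
      IsClassicalOn (classicalChannel w).classicalWires (copyClassical src dst ρ) := by
    rintro src dst x y ⟨v, _, hv⟩
    exact if_neg fun h => hv (congrFun h.1 v)
  cases e
  · exact hc _ _
  · exact hc _ _
  · exact hρ

theorem comp_op_zero {I J K : Iface} {X : Sys I J} {Y : Sys J K} (hX : ∀ q e a, X.op q e a 0 = 0)
    (hY : ∀ q e a, Y.op q e a 0 = 0) : ∀ q e a, (X ⋈ Y).op q e a 0 = 0 := by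
  rw [comp_eq_compAt]
  exact fun q e a => compOp_zero hX hY _ _ _ _

/-- With `X` the converter `πB`, this turns a distinguisher for the correctness condition into one
for the security condition. The dephased `X` is used on the left, where it has to be part of a valid
machine. -/
theorem acceptProb_rotate {D : Machine IB' IA Bool} (hD : D.StrictlyValid)
    {R : Sys IA (classicalIface w)} (hR : R.ClassicallyEq R) (hR0 : ∀ q e a, R.op q e a 0 = 0)
    {X : Sys (classicalIface w) IB'} (hX : X.Valid) :
    acceptProb ((X.dephased.liftOut Bool).compAt D (.inr .resume)) R = acceptProb D (R ⋈ X) := by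
  refine congrArg iSup (funext fun t => ?_)
  refine (acceptWithin_rotate D R X.dephased (fun q e a => (hD.1 q e a).map_zero) hR0
    (fun q e a => (hX.dephased.1 q e a).map_zero) t).trans ?_
  exact (acceptWithin_congr hD.valid.classicallyEq_self (hR.comp hX.classicallyEq_dephased) t).symm

/-- A converter that outputs a classical description of the message of the converters `σ`, `πB`
and `Q`. -/
theorem exists_describing_converter {σ : Sys IB (classicalIface w)}
    {πB : Sys (classicalIface w) IB'} {Q : Sys IB' (outIface 0 d)} (hσ : σ.Valid) (hB : πB.Valid)
    (hQ : Q.Valid) {Nσ NB NQ : ℕ} (hNσ : σ.RunsWithin Nσ) (hNB : πB.RunsWithin NB)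
    (hNQ : Q.RunsWithin NQ) :
    ∃ (k' : ℕ) (P : Sys IB (outIface k' 0)) (desc' : (Fin k' → Bool) → Op (Fin d)),
      P.Valid ∧ (∃ N, P.RunsWithin N) ∧ (∀ κ', IsDensity (desc' κ')) ∧
      ∀ (IA : Iface) (k : ℕ) (S : Sys IA IB) (A : Sys (outIface k 0) IA)
        (desc : (Fin k → Bool) → Op (Fin d)), S.Valid → A.Valid → ∀ t,
        describedOverlap desc desc' (outputState (A ⋈ S ⋈ P) t) = overlap desc (outputState
          (A.dephased ⋈ (S.dephased ⋈ σ.dephased ⋈ πB.dephased) ⋈ Q.dephased) t) := by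
  have hBQ : (πB.dephased ⋈ Q.dephased).RunsWithin (NB + NQ) := by
    rw [comp_eq_compAt]
    exact hNB.dephased.compAt hNQ.dephased _
  -- The link between `σ` and `πB` is classical, so `πB` followed by `Q` is the converter to be
  -- described; the chain up to `σ` plays the role of `Y`.
  obtain ⟨k', P, desc', hP, hNP, hd, h⟩ := exists_described _ (hB.dephased.comp hQ.dephased) hBQ
  refine ⟨k', σ.dephased ⋈ P, desc', (hσ.dephased.comp hP).valid, ⟨Nσ + (NB + NQ), ?_⟩, hd, ?_⟩
  · rw [comp_eq_compAt]
    exact hNσ.dephased.compAt hNP _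
  · intro IA k S A desc hS hA t
    have zero : ∀ {I J : Iface} {X : Sys I J}, X.StrictlyValid → ∀ q e a, X.op q e a 0 = 0 :=
      fun hX q e a => (hX.1 q e a).map_zero
    rw [outputState_congr ((hA.classicallyEq_dephased.comp hS.classicallyEq_dephased).comp
        (hσ.dephased.comp hP).valid.classicallyEq_self),
      ← output_assoc' _ _ _ _ (zero hA.dephased) (zero hS.dephased) (zero hσ.dephased) (zero hP),
      h _ _ (hA.dephased.comp (hS.dephased.comp hσ.dephased)),
      ← output_assoc' _ _ _ _ (zero hA.dephased) (zero (hS.dephased.comp hσ.dephased))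
        (zero hB.dephased) (zero hQ.dephased)]

/-- Seen as a ring, `πB` at the distinguisher is `πB` at the resource. The acceptance within `t`
steps is then at most the overlap within `t` steps, which is the described overlap by `hP`. -/
theorem acceptProb_le_expectedDescribedOverlap {σ : Sys IB (classicalIface w)}
    {πB : Sys (classicalIface w) IB'} {Q : Sys IB' (outIface 0 d)} (hS : S.Valid) (hA : A.Valid)
    (hσ : σ.Valid) (hB : πB.Valid) (hQ : Q.Valid) (hT : T.Valid) {N : ℕ} (hN : T.RunsWithin N)
    (h : ∀ κ ρ, IsDensity ρ → ⨆ t : ℕ, ((soloRun T t T.init (testInput T κ ρ) true).trace).re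
      = ((desc κ * ρ).trace).re) {k' : ℕ} {P : Sys IB (outIface k' 0)}
    {desc' : (Fin k' → Bool) → Op (Fin d)}
    (hP : ∀ t, describedOverlap desc desc' (outputState (A ⋈ S ⋈ P) t) = overlap desc (outputState
      (A.dephased ⋈ (S.dephased ⋈ σ.dephased ⋈ πB.dephased) ⋈ Q.dephased) t)) :
    acceptProb ((πB.dephased.liftOut Bool).compAt (distinguisher A T Q) (.inr .resume)) (S ⋈ σ) ≤
      expectedDescribedOverlap (A ⋈ S ⋈ P) desc desc' := by
  have hD := strictlyValid_distinguisher hA hT hQ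
  have hR := (hS.dephased.comp hσ.dephased).comp hB.dephased
  have hSσ := hS.classicallyEq_dephased.comp hσ.classicallyEq_dephased
  have hDB := (hB.dephased.liftOut (O := Bool)).compAt hD (.inr .resume)
  have hov := overlap_acceptWithin hA.dephased hR hQ.dephased hT hN h
  rw [expectedDescribedOverlap_eq]
  -- The bound `1` holds because each overlap is at most an acceptance probability at a later time.
  refine ciSup_mono ⟨1, ?_⟩ fun t => ?_
  · rintro _ ⟨t, rfl⟩
    refine (hP t).le.trans ((hov t).2.trans ?_)
    rw [acceptWithin_testEnv_eq hA hT hQ hR.valid]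
    exact (acceptWithin_bounds hD.valid hR.valid _).2
  · refine le_trans (le_of_eq ?_) ((hov t).1.trans (hP t).ge)
    rw [acceptWithin_testEnv_eq hA hT hQ hR.valid]
    refine (acceptWithin_congr hDB.valid.classicallyEq_self hSσ t).trans ?_
    exact acceptWithin_rotate _ _ _ (fun q e a => (hD.1 q e a).map_zero)
      (fun q e a => ((hS.dephased.comp hσ.dephased).1 q e a).map_zero)
      (fun q e a => (hB.dephased.1 q e a).map_zero) t

end Distinguisher

theorem Negligible.add {ε ε' : ℕ → ℝ} (h : Negligible ε) (h' : Negligible ε') :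
    Negligible fun n => ε n + ε' n :=
  Asymptotics.SuperpolynomialDecay.add h h'

theorem Negligible.const_mul {ε : ℕ → ℝ} (h : Negligible ε) (c : ℝ) :
    Negligible fun n => c * ε n :=
  Asymptotics.SuperpolynomialDecay.const_mul h c

end RSP

end

/-! ### The theorem, from two changes of the resource. -/

theorem mainTheorem1 (lev : Level) (l : Filter ℕ)
    (IA IB IB' : ℕ → Iface) (k d : ℕ → ℕ)
    (S : ∀ n, Sys (IA n) (IB n)) (hS : ∀ n, (S n).Valid)
    (filt : ∀ n, Sys (IB n) (IB' n)) (hfilt : Feasible .unbounded filt)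
    (A : ∀ n, Sys (outIface (k n) 0) (IA n))
    (desc : ∀ n, (Fin (k n) → Bool) → Op (Fin (d n)))
    (Q : ∀ n, Sys (IB' n) (outIface 0 (d n)))
    (ε₁ ε₂ : ℕ → ℝ)
    (hRSP : IsRSP lev l S filt A desc Q ε₁)
    (hReal : ClassicallyRealizable lev l S filt ε₂) :
    Describable l S A desc (fun n => ε₁ n + 2 * ε₂ n) ∧
      (Negligible ε₁ → Negligible ε₂ → Negligible (fun n => ε₁ n + 2 * ε₂ n)) := by
  refine ⟨?_, fun h₁ h₂ => h₁.add (h₂.const_mul 2)⟩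
  obtain ⟨w, πA, πB, hπA, hπB, hcor, σ, hσ, hsec⟩ := hReal
  obtain ⟨T, hT, htest⟩ := hRSP.testable
  have hA := hRSP.feasible_left
  have hQ := hRSP.feasible_right
  -- The describing converter is built separately for each `n`; no uniformity or efficiency in `n`
  -- is required of it.
  have hconv : ∀ n, ∃ (k' : ℕ) (P : Sys (IB n) (outIface k' 0))
      (desc' : (Fin k' → Bool) → Op (Fin (d n))), P.Valid ∧ (∃ N, P.RunsWithin N) ∧
      (∀ κ', IsDensity (desc' κ')) ∧
      acceptProb (((πB n).dephased.liftOut Bool).compAt (distinguisher (A n) (T n) (Q n))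
        (.inr .resume)) (S n ⋈ σ n) ≤
        expectedDescribedOverlap (A n ⋈ S n ⋈ P) (desc n) desc' := by
    intro n
    obtain ⟨Nσ, hNσ⟩ := hσ.runsWithin n
    obtain ⟨NB, hNB⟩ := hπB.runsWithin n
    obtain ⟨NQ, hNQ⟩ := hQ.runsWithin n
    obtain ⟨NT, hNT⟩ := hT.runsWithin n
    obtain ⟨k', P, desc', hP, hPN, hd, h⟩ := exists_describing_converter (hσ.valid n)
      (hπB.valid n) (hQ.valid n) hNσ hNB hNQ
    exact ⟨k', P, desc', hP, hPN, hd, acceptProb_le_expectedDescribedOverlap (hS n) (hA.valid n)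
      (hσ.valid n) (hπB.valid n) (hQ.valid n) (hT.valid n) hNT (fun κ ρ hρ => (htest n κ ρ hρ).1)
      (h _ _ _ _ _ (hS n) (hA.valid n))⟩
  choose k' P desc' hP hPN hd hle using hconv
  refine ⟨k', P, desc', fun n => ⟨hP n, hPN n⟩, hd, ?_⟩
  have hD := fun n => strictlyValid_distinguisher (hA.valid n) (hT.valid n) (hQ.valid n)
  have hDf := feasible_distinguisher hA hT hQ
  -- Correctness is applied to `D`, security to `D` with `πB` attached. Both are admissible at the
  -- given level, so only admissible distinguishers are ever used.
  filter_upwards [hRSP.accurate, hcor _ hDf, hsec _ (hπB.dephased.liftOut_compAt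
    (fun n => (hπB.valid n).dephased) hDf hD (.inr .resume))] with n hacc hc hs
  obtain ⟨NT, hNT⟩ := hT.runsWithin n
  have h₁ := expectedOverlap_le_acceptProb (hS n) (hA.valid n) (hfilt n).1 (hQ.valid n)
    (hT.valid n) hNT fun κ ρ hρ => (htest n κ ρ hρ).1
  have h₂ := acceptProb_rotate (hD n) ((hπA.valid n).classicallyEq_self.comp
    (classicallyEq_classicalChannel (w n))) (comp_op_zero (fun q e a =>
      ((hπA.valid n).1 q e a).map_zero) (classicalChannel_op_zero (w n))) (hπB.valid n)
  -- The two estimates now share the term for `πA`, the channel and `πB`. They add up to a loss of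
  -- `2 * ε₂`, in addition to the `ε₁` of the accuracy.
  rw [h₂] at hs
  linarith [hle n, abs_le.1 hc, abs_le.1 hs]
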